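/- **Setting.** There are $n$ arms. Sampling arm $i$ returns an independent draw from a probability distribution $\nu_i$ on $\mathbb R$ supported on $[0,1]$, with mean $\theta_i$ and variance $\sigma_i^2$, all unknown to the algorithm. All non-integer sample sizes below are rounded up. **Procedures.** * $\mathrm{VarTest}(i,\tau,\delta,c)$: let $T=\lceil \frac c\tau\ln\delta^{-1}\rceil$, sample arm $i$ for $2T$ times obtaining $x_1,\dots,x_{2T}$, and output whether $\frac1T\sum_{r=1}^T\frac{(x_r-x_{r+T})^2}{2}>\tau$. * $\mathrm{VarEst}(i,\delta,\ell)$: for $r=1,2,\dots$ let $\tau_r=2^{-r}$; stop and output $\tau_r$ as soon as $\tau_r\le \ell$ or $\mathrm{VarTest}(i,\tau_r,\delta/e,80)$ is true (the test is run only if $\tau_r>\ell$). * $\mathrm{MeanEst}(i,\epsilon,\delta)$: let $\widehat\sigma_i^2=\mathrm{VarEst}(i,\delta/2,\epsilon)$, sample arm $i$ for $\lceil(\frac{8\widehat\sigma_i^2}{\epsilon^2}+\frac{2}{3\epsilon})\ln\frac4\delta\rceil$ times, and output the empirical mean of these samples. * $\mathrm{GroupElim}(S,\epsilon,\delta)$: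 let $N=\lceil\log_2(2/\epsilon)\rceil$ and $\widehat\sigma_i^2=\mathrm{VarEst}(i,\delta/(2N^2),\epsilon)$ for $i\in S$. For $j=1,\dots,N$ let $\widehat B_j=\{i\in S: 2^{-j}<\widehat\sigma_i^2\le 2^{-j+1}\}$. Start with $T=R=\emptyset$. For each $j$: if $|\widehat B_j|\ge2$, let $\widehat\theta_i=\mathrm{MeanEst}(i,\epsilon/2,\delta/(9N))$ for $i\in\widehat B_j$ and add to $T$ the $\lceil|\widehat B_j|/2\rceil$ arms of $\widehat B_j$ with the largest $\widehat\theta_i$ (ties broken by the index); otherwise add $\widehat B_j$ to $R$. Output $(T,R)$. * $\mathrm{IterElim}(S,\epsilon,\delta)$: let $\beta=\frac{\sqrt{255}}{16}e^{0.001}$, $\epsilon_r=\beta^r(1-\beta)\epsilon$, $\delta_r=e^{-0.1r}(1-e^{-0.1})\delta$. Start with $r=0$, $T_0=S$, $R_0=\emptyset$. While $|T_r|>10$: let $(T_{r+1},R')=\mathrm{GroupElim}(T_r,\epsilon_r,\delta_r)$, $R_{r+1}=R_r\cup R'$, and increase $r$ by one. Output $T_r\cup R_r$. * $\mathrm{NaiveBestArmEst}(S,\epsilon,\delta)$: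 start with $r=1$, $S_1=S$. While $|S_r|>1$ and $r\le\lceil\log_2(2/\epsilon)\rceil$: let $\epsilon_r=2^{-r}$, $\delta_r=\frac{\delta}{2r^2}$, $\widehat\theta_i=\mathrm{MeanEst}(i,\epsilon_r/2,\delta_r/|S_r|)$ for $i\in S_r$, $S_{r+1}=\{i\in S_r:\widehat\theta_i\ge\max_{a\in S_r}\widehat\theta_a-\epsilon_r\}$, and increase $r$ by one. Output a uniformly random arm of $S_r$. * $\mathrm{BestArmEst}(S,\epsilon,\delta)$: let $S_1=\mathrm{IterElim}(S,\epsilon/3,\delta/3)$; let $S_2=S_1$ if $\epsilon^{-1}\le\ln|S|$ and $S_2=\mathrm{IterElim}(S_1,\epsilon/3,\delta/3)$ otherwise; output $\mathrm{NaiveBestArmEst}(S_2,\epsilon/3,\delta/3)$. **Theorem.** There is a universal constant $C>0$ such that for every $n$, all reward distributions $\nu_1,\dots,\nu_n$ supported on $[0,1]$, every nonempty set $S$ of arms, every $0<\epsilon\le1$ and every $0<\delta<1$, the following holds. With probability at least $1-\delta$, $\mathrm{BestArmEst}(S,\epsilon,\delta)$ outputs an arm $a\in S$ with $$\Bigl|\theta_a-\max_{i\in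 S}\theta_i\Bigr|\le\epsilon$$ and uses in total at most $$C\sum_{i\in S}\Bigl(\frac{\sigma_i^2}{\epsilon^2}+\frac1\epsilon\Bigr)\bigl(\ln\delta^{-1}+\ln(e+\ln\epsilon^{-1})\bigr)$$ samples. -/

import Mathlib

open MeasureTheory ProbabilityTheory

noncomputable section

namespace Bandit

/-- An adaptive sampling algorithm on `n` arms with output in `α`. It learns about the reward
distributions only through the rewards it observes.
* `done a`: stop and output `a`;
* `pull i m k`: sample arm `i` for `m` times, observe the rewards `x 0, …, x (m - 1)`, and continue
  with `k x`;
* `choose s k`: draw an element `i` of `s` uniformly at random (no arm is sampled), and continue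
  with `k i`. -/
inductive Algo (n : ℕ) (α : Type) : Type where
  | done (a : α) : Algo n α
  | pull (i : Fin n) (m : ℕ) (k : (Fin m → ℝ) → Algo n α) : Algo n α
  | choose (s : Finset (Fin n)) (k : Fin n → Algo n α) : Algo n α

variable {n : ℕ}

/-- Sequential composition: run the first algorithm, hand its output to the second one. -/
def Algo.andThen {α β : Type} : Algo n α → (α → Algo n β) → Algo n β
  | .done a, f => f a
  | .pull i m k, f => .pull i m (fun x => (k x).andThen f)
  | .choose s k, f => .choose s (fun i => (k i).andThen f)

instance : Monad (Algo n) where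
  pure := Algo.done
  bind := Algo.andThen

/-- The joint law of the output and of the total number of samples used, when the samples of each
arm `i` are drawn from `ν i`, independently of each other and of everything drawn before. -/
def Algo.law (ν : Fin n → Measure ℝ) {α : Type} [MeasurableSpace α] :
    Algo n α → Measure (α × ℕ)
  | .done a => Measure.dirac (a, 0)
  | .pull i m k =>
      (Measure.pi (fun _ : Fin m => ν i)).bind
        (fun x => (Algo.law ν (k x)).map (fun p => (p.1, p.2 + m)))
  | .choose s k => (uniformOn (s : Set (Fin n))).bind (fun i => Algo.law ν (k i))

/-- Run `f i` for each arm `i` of the list, one after the other, and record the results (the value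
at an arm outside of the list is a dummy). -/
def forList (f : Fin n → Algo n ℝ) : List (Fin n) → Algo n (Fin n → ℝ)
  | [] => pure (fun _ => 0)
  | i :: l => do
      let v ← f i
      let g ← forList f l
      pure (Function.update g i v)

/-- `for i ∈ S` do `f i`. -/
def forEach (S : Finset (Fin n)) (f : Fin n → Algo n ℝ) : Algo n (Fin n → ℝ) :=
  forList f (S.sort (· ≤ ·))

open Classical in
/-- `VarTest(i, τ, δ, c)`: is the variance of arm `i` above the threshold `τ`? -/
def varTest (i : Fin n) (τ δ c : ℝ) : Algo n Bool :=
  let T : ℕ := ⌈c / τ * Real.log (1 / δ)⌉₊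
  .pull i (T + T) fun x =>
    .done (decide
      (τ < 1 / (T : ℝ) * ∑ r : Fin T, (x (Fin.castAdd T r) - x (Fin.natAdd T r)) ^ 2 / 2))

open Classical in
/-- The loop of `VarEst(i, δ, ℓ)`, from round `r` on, for at most `fuel` rounds. -/
def varEstLoop (i : Fin n) (δ ℓ : ℝ) : (fuel r : ℕ) → Algo n ℝ
  | 0, r => pure (1 / 2 ^ r)
  | fuel + 1, r =>
      if (1 / 2 ^ r : ℝ) ≤ ℓ then pure (1 / 2 ^ r)
      else do
        let b ← varTest i (1 / 2 ^ r) (δ / Real.exp 1) 80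
        if b = true then pure (1 / 2 ^ r) else varEstLoop i δ ℓ fuel (r + 1)

/-- `VarEst(i, δ, ℓ)`: estimate the variance of arm `i`. As `1 / 2 ^ r ≤ ℓ` for `r = ⌈1 / ℓ⌉`, the
bound `⌈1 / ℓ⌉` on the number of rounds never interrupts the loop. -/
def varEst (i : Fin n) (δ ℓ : ℝ) : Algo n ℝ :=
  varEstLoop i δ ℓ ⌈1 / ℓ⌉₊ 1

/-- `MeanEst(i, ε, δ)`: estimate the mean of arm `i`. -/
def meanEst (i : Fin n) (ε δ : ℝ) : Algo n ℝ := do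
  let v ← varEst i (δ / 2) ε
  let m : ℕ := ⌈(8 * v / ε ^ 2 + 2 / (3 * ε)) * Real.log (4 / δ)⌉₊
  Algo.pull i m (fun x => Algo.done ((∑ r, x r) / m))

open Classical in
/-- The loop of `NaiveBestArm(·, δ)`, from round `r` on with active set `S`, for at most `k` rounds;
then a random active arm is output. An arm stays active if its empirical mean is not below the
largest one by more than `ε_r = 1 / 2 ^ r`. -/
def naiveLoop (δ : ℝ) : (k r : ℕ) → Finset (Fin n) → Algo n (Fin n)
  | 0, _, S => .choose S .done
  | k + 1, r, S =>
      if S.card ≤ 1 then .choose S .done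
      else do
        let θ ← forEach S
          (fun i => meanEst i (1 / 2 ^ r / 2) (1 / (2 * (r : ℝ) ^ 2) * δ / (S.card : ℝ)))
        naiveLoop δ k (r + 1) (S.filter (fun i => ∀ a ∈ S, θ a - 1 / 2 ^ r ≤ θ i))

/-- `NaiveBestArmEst(S, ε, δ)`: the loop of `NaiveBestArm(S, δ)`, stopped after
`⌈log₂ (2 / ε)⌉` rounds. -/
def naiveBestArmEst (S : Finset (Fin n)) (ε δ : ℝ) : Algo n (Fin n) :=
  naiveLoop δ ⌈Real.logb 2 (2 / ε)⌉₊ 1 S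

open Classical in
/-- The `j`-th bucket: the arms of `S` with estimated variance in `(2 ^ (-j), 2 ^ (-j + 1)]`. -/
def bucket (S : Finset (Fin n)) (v : Fin n → ℝ) (j : ℕ) : Finset (Fin n) :=
  S.filter (fun i => (1 / 2 ^ j : ℝ) < v i ∧ v i ≤ 2 / 2 ^ j)

open Classical in
/-- Median elimination: discard the arms of `B` whose empirical mean is below the median, ties
being broken by the index. So the arms that stay are the best `⌈|B| / 2⌉` ones, i.e. those
that fewer than `|B| / 2` arms of `B` precede. -/
def medianElim (B : Finset (Fin n)) (θ : Fin n → ℝ) : Finset (Fin n) :=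
  B.filter (fun i =>
    2 * (B.filter (fun a => θ i < θ a ∨ (θ a = θ i ∧ a < i))).card < B.card)

/-- The loop of `GroupElim(S, ε, δ)` over the buckets `1, …, j`, where `N` is the number of all
buckets and `v` holds the variance estimates; the output is the pair `(T, R)`. -/
def groupLoop (S : Finset (Fin n)) (ε δ : ℝ) (N : ℕ) (v : Fin n → ℝ) :
    (j : ℕ) → Algo n (Finset (Fin n) × Finset (Fin n))
  | 0 => pure (∅, ∅)
  | j + 1 => do
      let p ← groupLoop S ε δ N v j
      if 2 ≤ (bucket S v (j + 1)).card then do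
        let θ ← forEach (bucket S v (j + 1)) (fun i => meanEst i (ε / 2) (δ / (9 * (N : ℝ))))
        pure (p.1 ∪ medianElim (bucket S v (j + 1)) θ, p.2)
      else pure (p.1, p.2 ∪ bucket S v (j + 1))

/-- `GroupElim(S, ε, δ)`: grouped median elimination. -/
def groupElim (S : Finset (Fin n)) (ε δ : ℝ) : Algo n (Finset (Fin n) × Finset (Fin n)) :=
  let N : ℕ := ⌈Real.logb 2 (2 / ε)⌉₊
  do
    let v ← forEach S (fun i => varEst i (δ / (2 * (N : ℝ) ^ 2)) ε)
    groupLoop S ε δ N v N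

/-- `β = √255 / 16 · e ^ 0.001`. -/
def beta : ℝ := Real.sqrt 255 / 16 * Real.exp 0.001

/-- The loop of `IterElim(·, ε, δ)`, from round `r` on with active set `T` and recycled set `R`, for
at most `fuel` rounds. -/
def iterLoop (ε δ : ℝ) : (fuel r : ℕ) → (T R : Finset (Fin n)) → Algo n (Finset (Fin n))
  | 0, _, T, R => pure (T ∪ R)
  | fuel + 1, r, T, R =>
      if 10 < T.card then do
        let p ← groupElim T (beta ^ r * (1 - beta) * ε)
          (Real.exp (-0.1 * (r : ℝ)) * (1 - Real.exp (-0.1)) * δ)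
        iterLoop ε δ fuel (r + 1) p.1 (R ∪ p.2)
      else pure (T ∪ R)

/-- `IterElim(S, ε, δ)`: iterative elimination. Every round removes at least one arm from a nonempty
active set, so the bound `|S|` on the number of rounds never interrupts the loop. -/
def iterElim (S : Finset (Fin n)) (ε δ : ℝ) : Algo n (Finset (Fin n)) :=
  iterLoop ε δ S.card 0 S ∅

open Classical in
/-- `BestArmEst(S, ε, δ)`. -/
def bestArmEst (S : Finset (Fin n)) (ε δ : ℝ) : Algo n (Fin n) := do
  let S₁ ← iterElim S (ε / 3) (δ / 3)
  let S₂ ← if 1 / ε ≤ Real.log (S.card : ℝ) then pure S₁ else iterElim S₁ (ε / 3) (δ / 3)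
  naiveBestArmEst S₂ (ε / 3) (δ / 3)

/-- The mean `θ` of a reward distribution. -/
def mean (μ : Measure ℝ) : ℝ := ∫ x, x ∂μ

end Bandit

end

noncomputable section

namespace Bandit

open scoped ENNReal

set_option linter.unusedSectionVars false

variable {n : ℕ}

/-! The sample bound contains no term in `ln |S|`. The reason is that confidences inside elimination
rounds are not divided by the number of arms: wrong estimates are counted in expectation, weighted
by what they cost, and Markov's inequality is applied to the total.

Variance estimates are powers of `1/2`. An estimate below a quarter of the variance is unlikely
(`whp_varEst`). Overestimates obey a stronger bound: the expectation of the estimate on the event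
that it exceeds `2(σ² + ε)` is a tiny multiple of `σ² + ε` (`expect_varEst_le`). With Bernstein's
inequality this gives a correct mean estimate (`whp_meanEst`) whose expected number of samples
beyond `meanCost` is small (`expect_meanEst_le`).

In `GroupElim` all arms of a bucket share one variance estimate, so halving a bucket removes a fixed
fraction of its weight `∑ (σ² + e)`, up to the total `excess` of wrong estimates (`sum_weight_le`).
A round therefore multiplies the weight by at most 255/256 and preserves a good arm
(`whp_groupElim`). In `IterElim` the squared accuracy shrinks only by `β² = 255/256 · e^0.002`. The
cost of round `r` thus decays like `(1 + r) e^(-0.002 r)`, which is summable, while the errors sum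
to `ε` and the failure probabilities to `δ`. Each round discards a third of the active arms and
recycles at most one arm per bucket, so only `O((1 + ln |S|)(1 + ln |S| + ln ε⁻¹))` arms are left
(`exists_whp_iterElim`).

The final selection costs an extra `ln |S₂|` (`whp_naiveBestArmEst`). If `1/ε ≤ ln |S|`, one
elimination leaves so few arms that even the crude cost is at most a multiple of `|S|/ε`
(`mul_log_le_of_one_div_le`). Otherwise two eliminations leave polylogarithmically many arms in
`1/ε`, and `ln |S₂|` is absorbed by `ln (e + ln ε⁻¹)` (`log_le_of_lt_one_div`).

The probabilistic argument uses upper expectations (`Algo.expect`, `Algo.WHP`), which compose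
without measurability. Measurability (`Algo.Meas`) is proved separately and enters only through
`Algo.WHP.le_law`. -/

/-! ### Upper integrals -/

/-- The upper integral of a function that need not be measurable. -/
def upperInt {X : Type*} [MeasurableSpace X] (μ : Measure X) (f : X → ℝ≥0∞) : ℝ≥0∞ :=
  ⨅ (g : X → ℝ≥0∞) (_ : Measurable g) (_ : f ≤ g), ∫⁻ x, g x ∂μ

section UpperInt

variable {X : Type*} [MeasurableSpace X] {μ : Measure X}

lemma upperInt_le {f g : X → ℝ≥0∞} (hg : Measurable g) (h : f ≤ g) :
    upperInt μ f ≤ ∫⁻ x, g x ∂μ :=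
  iInf_le_of_le g (iInf_le_of_le hg (iInf_le _ h))

lemma le_upperInt {f : X → ℝ≥0∞} {c : ℝ≥0∞}
    (h : ∀ g, Measurable g → f ≤ g → c ≤ ∫⁻ x, g x ∂μ) : c ≤ upperInt μ f :=
  le_iInf fun g => le_iInf fun hg => le_iInf fun hfg => h g hg hfg

lemma upperInt_mono {f g : X → ℝ≥0∞} (h : ∀ x, f x ≤ g x) : upperInt μ f ≤ upperInt μ g :=
  le_upperInt fun _ hk hgk => upperInt_le hk fun x => (h x).trans (hgk x)

lemma lintegral_le_upperInt (f : X → ℝ≥0∞) : ∫⁻ x, f x ∂μ ≤ upperInt μ f :=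
  le_upperInt fun _ _ h => lintegral_mono h

lemma upperInt_const_le [IsZeroOrProbabilityMeasure μ] (c : ℝ≥0∞) :
    upperInt μ (fun _ => c) ≤ c := by
  refine (upperInt_le measurable_const le_rfl).trans ?_
  rw [lintegral_const]
  exact mul_le_of_le_one_right' prob_le_one

lemma upperInt_const_le_zero : upperInt μ (fun _ => 0) ≤ 0 :=
  (upperInt_le measurable_const le_rfl).trans (by simp)

/-- Subadditivity is all that upper bounds on probabilities need. For non-measurable functions the
lower integral `∫⁻` is superadditive instead, which is why it is not used here. -/
lemma upperInt_add_le (f g : X → ℝ≥0∞) :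
    upperInt μ (fun x => f x + g x) ≤ upperInt μ f + upperInt μ g := by
  unfold upperInt
  simp only [ENNReal.iInf_add, ENNReal.add_iInf]
  refine le_iInf fun F => le_iInf fun hF => le_iInf fun hfF => le_iInf fun G => le_iInf fun hG =>
    le_iInf fun hgG => ?_
  rw [← lintegral_add_left hG]
  exact upperInt_le (hG.add hF) fun x => add_le_add (hgG x) (hfF x)

lemma upperInt_const_mul_le {c : ℝ≥0∞} (hc : c ≠ ⊤) (f : X → ℝ≥0∞) :
    upperInt μ (fun x => c * f x) ≤ c * upperInt μ f := by
  rcases eq_or_ne c 0 with rfl | h0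
  · simpa using upperInt_const_le_zero
  rw [mul_comm, ← ENNReal.div_le_iff h0 hc]
  refine le_upperInt fun g hg h => ?_
  rw [ENNReal.div_le_iff h0 hc, mul_comm, ← lintegral_const_mul _ hg]
  exact upperInt_le (hg.const_mul c) fun x => mul_le_mul_right (h x) c

lemma upperInt_indicator_le {s : Set X} (hs : MeasurableSet s) {f : X → ℝ≥0∞} {b : ℝ≥0∞}
    (hf : ∀ x, f x ≤ 1) (h : ∀ x ∉ s, f x ≤ b) [IsZeroOrProbabilityMeasure μ] :
    upperInt μ f ≤ μ s + b := by
  refine (upperInt_mono (g := fun x => s.indicator (fun _ => 1) x + b) fun x => ?_).trans ?_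
  · by_cases hx : x ∈ s
    · simpa [hx] using le_add_right (hf x)
    · simpa [hx] using h x hx
  · refine (upperInt_add_le _ _).trans (add_le_add ?_ (upperInt_const_le b))
    refine (upperInt_le (measurable_const.indicator hs) le_rfl).trans ?_
    simp [lintegral_indicator hs]

end UpperInt

/-! ### Upper expectations of algorithms -/

/-- The (upper) expectation of a function of the output and of the number of samples. -/
def Algo.expect (ν : Fin n → Measure ℝ) {α : Type} : Algo n α → (α → ℕ → ℝ≥0∞) → ℝ≥0∞
  | .done a, f => f a 0
  | .pull i m k, f =>
      upperInt (Measure.pi fun _ : Fin m => ν i) fun x => (k x).expect ν fun a t => f a (t + m)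
  | .choose s k, f => upperInt (uniformOn (s : Set (Fin n))) fun i => (k i).expect ν f

/-- A property of the output and of the number of samples which holds on every run. -/
def Algo.Sure {α : Type} : Algo n α → (α → ℕ → Prop) → Prop
  | .done a, Q => Q a 0
  | .pull _ m k, Q => ∀ x, (k x).Sure fun a t => Q a (t + m)
  | .choose s k, Q => ∀ i ∈ s, (k i).Sure Q

lemma bind_eq_andThen {α β : Type} (A : Algo n α) (g : α → Algo n β) : A >>= g = A.andThen g := rfl

lemma pure_eq_done {α : Type} (a : α) : (pure a : Algo n α) = .done a := rfl

section Expect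

variable {ν : Fin n → Measure ℝ} {α β : Type}

lemma Algo.expect_bind (A : Algo n α) (g : α → Algo n β) (f : β → ℕ → ℝ≥0∞) :
    (A >>= g).expect ν f = A.expect ν fun a t => (g a).expect ν fun b s => f b (s + t) := by
  rw [bind_eq_andThen]
  induction A generalizing f with
  | done a => simp [andThen, expect]
  | pull i m k ih => simp only [andThen, expect, ih, add_assoc]
  | choose s k ih => simp only [andThen, expect, ih]

lemma Algo.sure_bind {A : Algo n α} {g : α → Algo n β} {Q : α → ℕ → Prop} {R : β → ℕ → Prop}
    (hA : A.Sure Q) (hg : ∀ a t, Q a t → (g a).Sure fun b s => R b (s + t)) :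
    (A >>= g).Sure R := by
  rw [bind_eq_andThen]
  induction A generalizing Q R with
  | done a => simpa [andThen] using hg a 0 hA
  | pull i m k ih =>
    intro x
    exact ih x (hA x) fun a t h => by simpa only [add_assoc] using hg a (t + m) h
  | choose s k ih => exact fun i hi => ih i (hA i hi) hg

lemma Algo.Sure.mono {A : Algo n α} {Q R : α → ℕ → Prop} (hA : A.Sure Q)
    (h : ∀ a t, Q a t → R a t) : A.Sure R := by
  induction A generalizing Q R with
  | done a => exact h _ _ hA
  | pull i m k ih => exact fun x => ih x (hA x) fun a t => h a (t + m)
  | choose s k ih => exact fun i hi => ih i (hA i hi) h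

lemma Algo.sure_true (A : Algo n α) : A.Sure fun _ _ => True := by
  induction A with
  | done a => trivial
  | pull i m k ih => exact ih
  | choose s k ih => exact fun i _ => ih i

lemma ae_uniformOn_mem (s : Finset (Fin n)) : ∀ᵐ i ∂(uniformOn (s : Set (Fin n))), i ∈ s :=
  ae_cond_mem s.measurableSet

lemma Algo.expect_mono_of_sure {A : Algo n α} {Q : α → ℕ → Prop} (hA : A.Sure Q)
    {f g : α → ℕ → ℝ≥0∞} (h : ∀ a t, Q a t → f a t ≤ g a t) : A.expect ν f ≤ A.expect ν g := by
  induction A generalizing Q f g with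
  | done a => exact h _ _ hA
  | pull i m k ih => exact upperInt_mono fun x => ih x (hA x) fun a t => h a (t + m)
  | choose s k ih =>
    refine le_upperInt fun G _ hG => ?_
    -- Nothing is known about runs with `i ∉ s`, so the majorant is raised to `⊤` there; the uniform
    -- law does not charge these `i`.
    refine (upperInt_le (g := fun i => if i ∈ s then G i else ⊤) (measurable_of_finite _)
      fun i => ?_).trans (le_of_eq (lintegral_congr_ae ?_))
    · by_cases hi : i ∈ s
      · simpa [hi] using (ih i (hA i hi) h).trans (hG i)
      · simp [hi]
    · filter_upwards [ae_uniformOn_mem s] with i hi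
      simp [hi]

lemma Algo.expect_mono {A : Algo n α} {f g : α → ℕ → ℝ≥0∞} (h : ∀ a t, f a t ≤ g a t) :
    A.expect ν f ≤ A.expect ν g :=
  A.expect_mono_of_sure A.sure_true fun a t _ => h a t

lemma Algo.expect_add_le (A : Algo n α) (f g : α → ℕ → ℝ≥0∞) :
    A.expect ν (fun a t => f a t + g a t) ≤ A.expect ν f + A.expect ν g := by
  induction A generalizing f g with
  | done a => exact le_rfl
  | pull i m k ih => exact (upperInt_mono fun x => ih x _ _).trans (upperInt_add_le _ _)
  | choose s k ih => exact (upperInt_mono fun x => ih x _ _).trans (upperInt_add_le _ _)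

lemma Algo.expect_const_mul_le (A : Algo n α) {c : ℝ≥0∞} (hc : c ≠ ⊤) (f : α → ℕ → ℝ≥0∞) :
    A.expect ν (fun a t => c * f a t) ≤ c * A.expect ν f := by
  induction A generalizing f with
  | done a => exact le_rfl
  | pull i m k ih => exact (upperInt_mono fun x => ih x _).trans (upperInt_const_mul_le hc _)
  | choose s k ih => exact (upperInt_mono fun x => ih x _).trans (upperInt_const_mul_le hc _)

variable [∀ i, IsProbabilityMeasure (ν i)]

lemma Algo.expect_const_le (A : Algo n α) (c : ℝ≥0∞) : A.expect ν (fun _ _ => c) ≤ c := by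
  induction A with
  | done a => exact le_rfl
  | pull i m k ih => exact (upperInt_mono ih).trans (upperInt_const_le c)
  | choose s k ih => exact (upperInt_mono ih).trans (upperInt_const_le c)

/-! ### Statements with high probability -/

open Classical in
/-- `Q` holds for the output and the number of samples, up to an event of probability `p`. -/
def Algo.WHP (ν : Fin n → Measure ℝ) {α : Type} (A : Algo n α) (p : ℝ) (Q : α → ℕ → Prop) : Prop :=
  A.expect ν (fun a t => if Q a t then 0 else 1) ≤ ENNReal.ofReal p

lemma Algo.Sure.whp {A : Algo n α} {Q : α → ℕ → Prop} (hA : A.Sure Q) : A.WHP ν 0 Q := by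
  unfold WHP
  refine (A.expect_mono_of_sure hA (g := fun _ _ => 0) fun a t h => by simp [h]).trans ?_
  exact (A.expect_const_le 0).trans (by simp)

lemma Algo.WHP.mono_of_sure {A : Algo n α} {p q : ℝ} {Q R S : α → ℕ → Prop} (hA : A.WHP ν p Q)
    (hS : A.Sure S) (hpq : p ≤ q) (h : ∀ a t, S a t → Q a t → R a t) : A.WHP ν q R := by
  classical
  refine (A.expect_mono_of_sure hS fun a t hs => ?_).trans
    (le_trans hA (ENNReal.ofReal_le_ofReal hpq))
  by_cases hQ : Q a t
  · simp [hQ, h a t hs hQ]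
  · simp only [hQ, if_false]; split_ifs <;> simp

lemma Algo.WHP.mono {A : Algo n α} {p q : ℝ} {Q R : α → ℕ → Prop} (hA : A.WHP ν p Q)
    (hpq : p ≤ q) (h : ∀ a t, Q a t → R a t) : A.WHP ν q R :=
  hA.mono_of_sure A.sure_true hpq fun a t _ => h a t

lemma Algo.WHP.and {A : Algo n α} {p q : ℝ} {Q R : α → ℕ → Prop} (hp : 0 ≤ p) (hq : 0 ≤ q)
    (hQ : A.WHP ν p Q) (hR : A.WHP ν q R) : A.WHP ν (p + q) fun a t => Q a t ∧ R a t := by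
  classical
  unfold WHP
  rw [ENNReal.ofReal_add hp hq]
  refine (A.expect_mono fun a t => ?_).trans ((A.expect_add_le _ _).trans (add_le_add hQ hR))
  by_cases h1 : Q a t <;> by_cases h2 : R a t <;> simp [h1, h2]

lemma Algo.WHP.bind {A : Algo n α} {p q : ℝ} {Q : α → ℕ → Prop} {g : α → Algo n β}
    {R : β → ℕ → Prop} (hp : 0 ≤ p) (hq : 0 ≤ q) (hA : A.WHP ν p Q)
    (hg : ∀ a t, Q a t → (g a).WHP ν q fun b s => R b (s + t)) : (A >>= g).WHP ν (p + q) R := by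
  classical
  unfold WHP
  rw [ENNReal.ofReal_add hp hq, expect_bind]
  refine (A.expect_mono fun a t => ?_).trans
    ((A.expect_add_le _ _).trans (add_le_add hA (A.expect_const_le _)))
  by_cases h : Q a t
  · simp only [h, if_true, zero_add]
    exact hg a t h
  · simp only [h, if_false]
    refine le_add_right ?_
    refine ((g a).expect_mono fun b s => ?_).trans ((g a).expect_const_le 1)
    split_ifs <;> simp

/-- Markov's inequality. -/
lemma Algo.whp_of_expect {A : Algo n α} {f : α → ℕ → ℝ≥0∞} {Q : α → ℕ → Prop} {c p : ℝ}
    (hc : 0 < c) (hf : A.expect ν f ≤ ENNReal.ofReal (c * p))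
    (h : ∀ a t, ¬ Q a t → ENNReal.ofReal c ≤ f a t) : A.WHP ν p Q := by
  classical
  unfold WHP
  have h1 : ENNReal.ofReal c⁻¹ * ENNReal.ofReal c = 1 := by
    rw [← ENNReal.ofReal_mul (by positivity), inv_mul_cancel₀ hc.ne', ENNReal.ofReal_one]
  refine (A.expect_mono (g := fun a t => ENNReal.ofReal c⁻¹ * f a t) fun a t => ?_).trans ?_
  · by_cases hQ : Q a t
    · simp [hQ]
    · simp only [hQ, if_false]
      rw [← h1]
      gcongr
      exact h a t hQ
  · refine (A.expect_const_mul_le ENNReal.ofReal_ne_top _).trans ?_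
    refine (mul_le_mul_right hf _).trans ?_
    rw [← ENNReal.ofReal_mul (by positivity), inv_mul_cancel_left₀ hc.ne']

end Expect

/-! ### Measurability -/

/-- The continuations of the algorithm have measurable laws, so that its law is a probability
measure. -/
def Algo.Meas (ν : Fin n → Measure ℝ) {α : Type} [MeasurableSpace α] : Algo n α → Prop
  | .done _ => True
  | .pull _ _ k => (Measurable fun x => (k x).law ν) ∧ ∀ x, (k x).Meas ν
  | .choose s k => s.Nonempty ∧ ∀ i ∈ s, (k i).Meas ν

section Meas

variable {ν : Fin n → Measure ℝ} {α β : Type} [MeasurableSpace α] [MeasurableSpace β]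

lemma measurable_add_snd (m : ℕ) : Measurable fun p : α × ℕ => (p.1, p.2 + m) := by fun_prop

lemma measurable_law_shift {g : α → Algo n β} (hg : Measurable fun a => (g a).law ν) :
    Measurable fun p : α × ℕ => ((g p.1).law ν).map fun q => (q.1, q.2 + p.2) :=
  measurable_from_prod_countable_left fun t =>
    (Measure.measurable_map _ (measurable_add_snd t)).comp hg

lemma map_bind_eq {X Y Z : Type*} [MeasurableSpace X] [MeasurableSpace Y] [MeasurableSpace Z]
    (μ : Measure X) {G : X → Measure Y} (hG : Measurable G) {f : Y → Z} (hf : Measurable f) :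
    (μ.bind G).map f = μ.bind fun x => (G x).map f := by
  ext s hs
  have h : Measurable fun x => (G x).map f := (Measure.measurable_map f hf).comp hG
  rw [Measure.map_apply hf hs, Measure.bind_apply (hf hs) hG.aemeasurable,
    Measure.bind_apply hs h.aemeasurable]
  simp_rw [Measure.map_apply hf hs]

lemma bind_map_eq {X Y Z : Type*} [MeasurableSpace X] [MeasurableSpace Y] [MeasurableSpace Z]
    (μ : Measure X) {f : X → Y} (hf : Measurable f) {G : Y → Measure Z} (hG : Measurable G) :
    (μ.map f).bind G = μ.bind fun x => G (f x) := by
  rw [Measure.bind, Measure.bind, Measure.map_map hG hf, Function.comp_def]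

lemma Algo.law_bind {A : Algo n α} (hA : A.Meas ν) {g : α → Algo n β}
    (hg : Measurable fun a => (g a).law ν) :
    (A >>= g).law ν = (A.law ν).bind fun p => ((g p.1).law ν).map fun q => (q.1, q.2 + p.2) := by
  have hG := measurable_law_shift hg
  rw [bind_eq_andThen]
  induction A with
  | done a => simp [andThen, law, Measure.dirac_bind hG]
  | pull i m k ih =>
    have h1 : Measurable fun x => ((k x).law ν).map fun p => (p.1, p.2 + m) :=
      (Measure.measurable_map _ (measurable_add_snd m)).comp hA.1
    simp only [andThen, law]
    rw [Measure.bind_bind h1.aemeasurable hG.aemeasurable]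
    congr 1
    funext x
    rw [ih x (hA.2 x), map_bind_eq _ hG (measurable_add_snd m),
      bind_map_eq _ (measurable_add_snd m) hG]
    congr 1
    funext p
    rw [Measure.map_map (measurable_add_snd m) (measurable_add_snd _)]
    simp only [Function.comp_def, add_assoc]
  | choose s k ih =>
    simp only [andThen, law]
    rw [Measure.bind_bind (measurable_of_finite _).aemeasurable hG.aemeasurable]
    refine Measure.bind_congr_right ?_
    filter_upwards [ae_uniformOn_mem s] with i hi using ih i (hA.2 i hi)

/-- The sure property `Q` will be nonemptiness of a set of arms: a uniform draw from the empty set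
has law zero, so the continuation is admissible only for the outputs that can occur. -/
lemma Algo.Meas.bind {A : Algo n α} (hA : A.Meas ν) {Q : α → Prop} (hQ : A.Sure fun a _ => Q a)
    {g : α → Algo n β} (hg : Measurable fun a => (g a).law ν) (hm : ∀ a, Q a → (g a).Meas ν) :
    (A >>= g).Meas ν := by
  rw [bind_eq_andThen]
  induction A with
  | done a => exact hm a hQ
  | pull i m k ih =>
    refine ⟨?_, fun x => ih x (hA.2 x) (hQ x)⟩
    have : ∀ x, ((k x).andThen g).law ν = _ := fun x => Algo.law_bind (hA.2 x) hg
    simp_rw [this]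
    exact (Measure.measurable_bind' (measurable_law_shift hg)).comp hA.1
  | choose s k ih => exact ⟨hA.1, fun i hi => ih i (hA.2 i hi) (hQ i hi)⟩

/-- The bridge from upper expectations to the law: measurability turns each `bind` into an integral,
which is at most the upper integral. -/
lemma Algo.law_le_expect {A : Algo n α} (hA : A.Meas ν) {B : Set (α × ℕ)} (hB : MeasurableSet B) :
    A.law ν B ≤ A.expect ν fun a t => B.indicator 1 (a, t) := by
  induction A generalizing B with
  | done a => simp [law, expect, Measure.dirac_apply' _ hB]
  | pull i m k ih =>
    have h1 : Measurable fun x => ((k x).law ν).map fun p => (p.1, p.2 + m) :=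
      (Measure.measurable_map _ (measurable_add_snd m)).comp hA.1
    rw [law, Measure.bind_apply hB h1.aemeasurable]
    refine (lintegral_mono fun x => ?_).trans (lintegral_le_upperInt _)
    rw [Measure.map_apply (measurable_add_snd m) hB]
    exact ih x (hA.2 x) (measurable_add_snd m hB)
  | choose s k ih =>
    rw [law, Measure.bind_apply hB (measurable_of_finite _).aemeasurable]
    refine (lintegral_mono_ae ?_).trans (lintegral_le_upperInt _)
    filter_upwards [ae_uniformOn_mem s] with i hi using ih i (hA.2 i hi) hB

variable [∀ i, IsProbabilityMeasure (ν i)]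

lemma Algo.law_univ {A : Algo n α} (hA : A.Meas ν) : A.law ν Set.univ = 1 := by
  induction A with
  | done a => simp [law]
  | pull i m k ih =>
    have h1 : Measurable fun x => ((k x).law ν).map fun p => (p.1, p.2 + m) :=
      (Measure.measurable_map _ (measurable_add_snd m)).comp hA.1
    rw [law, Measure.bind_apply .univ h1.aemeasurable]
    simp [Measure.map_apply (measurable_add_snd m), fun x => ih x (hA.2 x)]
  | choose s k ih =>
    have := isProbabilityMeasure_uniformOn s.finite_toSet (Finset.coe_nonempty.2 hA.1)
    rw [law, Measure.bind_apply .univ (measurable_of_finite _).aemeasurable]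
    rw [lintegral_congr_ae (g := fun _ => 1)]
    · simp
    · filter_upwards [ae_uniformOn_mem s] with i hi using ih i (hA.2 i hi)

lemma Algo.WHP.le_law {A : Algo n α} (hA : A.Meas ν) {p : ℝ} (hp : 0 ≤ p) {Q : α → ℕ → Prop}
    (h : A.WHP ν p Q) (hQ : MeasurableSet {x : α × ℕ | Q x.1 x.2}) :
    ENNReal.ofReal (1 - p) ≤ A.law ν {x : α × ℕ | Q x.1 x.2} := by
  have h1 : A.law ν {x : α × ℕ | Q x.1 x.2}ᶜ ≤ ENNReal.ofReal p := by
    refine (Algo.law_le_expect hA hQ.compl).trans (le_trans (Algo.expect_mono fun a t => ?_) h)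
    by_cases hq : Q a t <;> simp [hq]
  have h2 := measure_add_measure_compl (μ := A.law ν) hQ
  rw [Algo.law_univ hA] at h2
  rw [ENNReal.ofReal_sub _ hp, ENNReal.ofReal_one, ← h2]
  exact tsub_le_iff_right.2 (by gcongr)

end Meas

/-! ### Concentration inequalities -/

/-- The Chernoff bound for a sum of independent copies. -/
lemma pi_sum_ge_le {X : Type*} [MeasurableSpace X] (μ : Measure X) [IsProbabilityMeasure μ]
    {g : X → ℝ} (hi : Integrable (fun x => Real.exp (g x)) μ) {c : ℝ}
    (h : ∫ x, Real.exp (g x) ∂μ ≤ Real.exp c) (m : ℕ) (s : ℝ) :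
    Measure.pi (fun _ : Fin m => μ) {x | s ≤ ∑ r, g (x r)} ≤
      ENNReal.ofReal (Real.exp (m * c - s)) := by
  have hprod : ∀ x : Fin m → X, Real.exp (1 * ∑ r, g (x r)) = ∏ r, Real.exp (g (x r)) := by
    intro x
    rw [one_mul, Real.exp_sum]
  have h1 := measure_ge_le_exp_mul_mgf (μ := Measure.pi fun _ : Fin m => μ)
    (X := fun x => ∑ r, g (x r)) s zero_le_one (by
      simp_rw [hprod]
      exact Integrable.fintype_prod (f := fun _ x => Real.exp (g x)) fun _ => hi)
  rw [mgf] at h1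
  simp_rw [hprod] at h1
  rw [integral_fintype_prod_eq_prod (fun _ x => Real.exp (g x))] at h1
  rw [← ofReal_measureReal]
  refine ENNReal.ofReal_le_ofReal (h1.trans ?_)
  have h2 : ∏ _i : Fin m, ∫ x, Real.exp (g x) ∂μ ≤ ∏ _i : Fin m, Real.exp c :=
    Finset.prod_le_prod (fun _ _ => integral_nonneg fun _ => (Real.exp_pos _).le) fun _ _ => h
  refine (mul_le_mul_of_nonneg_left h2 (Real.exp_pos _).le).trans (le_of_eq ?_)
  rw [Finset.prod_const, Finset.card_univ, Fintype.card_fin, ← Real.exp_nat_mul, ← Real.exp_add]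
  ring_nf

/-- Pairing the first half of a sample with the second half. -/
lemma measurePreserving_pair (μ : Measure ℝ) [IsProbabilityMeasure μ] (T : ℕ) :
    MeasurePreserving (fun (x : Fin (T + T) → ℝ) (r : Fin T) =>
      (x (Fin.castAdd T r), x (Fin.natAdd T r)))
      (Measure.pi fun _ => μ) (Measure.pi fun _ => μ.prod μ) := by
  have h1 := (measurePreserving_piCongrLeft (fun _ : Fin (T + T) => μ)
    (finSumFinEquiv (m := T) (n := T))).symm
  have h2 := measurePreserving_sumPiEquivProdPi (fun _ : Fin T ⊕ Fin T => μ)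
  have h3 := (measurePreserving_arrowProdEquivProdArrow ℝ ℝ (Fin T) (fun _ => μ)
    (fun _ => μ)).symm
  exact (h3.comp (h2.comp h1))

section Bounded

variable {μ : Measure ℝ} [IsProbabilityMeasure μ] (hμ : ∀ᵐ x ∂μ, x ∈ Set.Icc (0 : ℝ) 1)

include hμ

lemma memLp_id (p : ℝ≥0∞) : MemLp (id : ℝ → ℝ) p μ :=
  MemLp.of_bound measurable_id.aestronglyMeasurable 1 <| hμ.mono fun x hx => by
    simpa [abs_le] using ⟨by linarith [hx.1], hx.2⟩

lemma integrable_self : Integrable (fun x : ℝ => x) μ := (memLp_id hμ 1).integrable le_rfl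

lemma integrable_sq' : Integrable (fun x : ℝ => x ^ 2) μ := (memLp_id hμ 2).integrable_sq

lemma variance_id_eq : variance id μ = ∫ x, x ^ 2 ∂μ - mean μ ^ 2 := variance_eq_sub (memLp_id hμ 2)

lemma mean_mem : mean μ ∈ Set.Icc (0 : ℝ) 1 := by
  constructor
  · exact integral_nonneg_of_ae (hμ.mono fun x hx => hx.1)
  · refine (integral_mono_ae (integrable_self hμ) (integrable_const 1)
      (hμ.mono fun x hx => hx.2)).trans (by simp)

lemma variance_le_quarter : variance id μ ≤ 1 / 4 := by
  have h : ∫ x, x ^ 2 ∂μ ≤ mean μ := integral_mono_ae (integrable_sq' hμ) (integrable_self hμ)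
    (hμ.mono fun x hx => by nlinarith [hx.1, hx.2])
  rw [variance_id_eq hμ]
  nlinarith [sq_nonneg (mean μ - 1 / 2)]

lemma ae_prod_mem : ∀ᵐ p ∂(μ.prod μ), p.1 ∈ Set.Icc (0 : ℝ) 1 ∧ p.2 ∈ Set.Icc (0 : ℝ) 1 :=
  (Measure.quasiMeasurePreserving_fst.ae hμ).and (Measure.quasiMeasurePreserving_snd.ae hμ)

lemma integral_half_sq_sub : ∫ p, (p.1 - p.2) ^ 2 / 2 ∂(μ.prod μ) = variance id μ := by
  have h1 : Integrable (fun p : ℝ × ℝ => p.1 ^ 2) (μ.prod μ) := (integrable_sq' hμ).comp_fst μ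
  have h2 : Integrable (fun p : ℝ × ℝ => p.2 ^ 2) (μ.prod μ) := (integrable_sq' hμ).comp_snd μ
  have h3 : Integrable (fun p : ℝ × ℝ => p.1 * p.2) (μ.prod μ) :=
    (integrable_self hμ).mul_prod (integrable_self hμ)
  have h4 : ∀ p : ℝ × ℝ, (p.1 - p.2) ^ 2 / 2 = (p.1 ^ 2 + p.2 ^ 2) / 2 - p.1 * p.2 :=
    fun p => by ring
  simp_rw [h4]
  have h5 : Integrable (fun p : ℝ × ℝ => (p.1 ^ 2 + p.2 ^ 2) / 2) (μ.prod μ) :=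
    (h1.add h2).div_const 2
  rw [integral_sub h5 h3, integral_div, integral_add h1 h2,
    integral_fun_fst (fun x : ℝ => x ^ 2), integral_fun_snd (fun x : ℝ => x ^ 2),
    integral_prod_mul (fun x : ℝ => x) (fun x : ℝ => x), variance_id_eq hμ]
  simp [mean]
  ring

-- Convexity of `exp` on the segment from `0` to `l / 2`, with weight `(x - y)² ≤ 1`. The bound is
-- affine in `(x - y)² / 2`, so its expectation involves only the variance, for either sign of `l`.
omit hμ in
lemma exp_half_sq_sub_le (l : ℝ) {p : ℝ × ℝ}
    (h : p.1 ∈ Set.Icc (0 : ℝ) 1 ∧ p.2 ∈ Set.Icc (0 : ℝ) 1) :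
    Real.exp (l * ((p.1 - p.2) ^ 2 / 2)) ≤
      1 + 2 * (Real.exp (l / 2) - 1) * ((p.1 - p.2) ^ 2 / 2) := by
  obtain ⟨⟨ha, hb⟩, hc, hd⟩ := h
  have h1 : (p.1 - p.2) ^ 2 ≤ 1 := by nlinarith
  have h2 := convexOn_exp.2 (Set.mem_univ 0) (Set.mem_univ (l / 2)) (sub_nonneg.2 h1)
    (sq_nonneg (p.1 - p.2)) (by ring)
  simp only [smul_eq_mul, mul_zero, zero_add, Real.exp_zero, mul_one] at h2
  calc _ = Real.exp ((p.1 - p.2) ^ 2 * (l / 2)) := by ring_nf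
    _ ≤ _ := h2
    _ = _ := by ring

lemma integrable_exp_half_sq_sub (l : ℝ) :
    Integrable (fun p : ℝ × ℝ => Real.exp (l * ((p.1 - p.2) ^ 2 / 2))) (μ.prod μ) := by
  refine Integrable.of_bound (by fun_prop) (Real.exp |l|) ((ae_prod_mem hμ).mono fun p hp => ?_)
  obtain ⟨⟨ha, hb⟩, hc, hd⟩ := hp
  rw [Real.norm_eq_abs, Real.abs_exp]
  refine Real.exp_le_exp.2 ((le_abs_self _).trans ?_)
  rw [abs_mul, abs_of_nonneg (by positivity : 0 ≤ (p.1 - p.2) ^ 2 / 2)]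
  exact mul_le_of_le_one_right (abs_nonneg _) (by nlinarith)

lemma integral_exp_half_sq_sub_le (l : ℝ) :
    ∫ p, Real.exp (l * ((p.1 - p.2) ^ 2 / 2)) ∂(μ.prod μ) ≤
      Real.exp (2 * (Real.exp (l / 2) - 1) * variance id μ) := by
  have hi : Integrable (fun p : ℝ × ℝ => (p.1 - p.2) ^ 2 / 2) (μ.prod μ) := by
    refine Integrable.of_bound (by fun_prop) 1 ((ae_prod_mem hμ).mono fun p hp => ?_)
    obtain ⟨⟨ha, hb⟩, hc, hd⟩ := hp
    rw [Real.norm_eq_abs, abs_of_nonneg (by positivity)]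
    nlinarith
  refine (integral_mono_ae (integrable_exp_half_sq_sub hμ l)
    ((integrable_const 1).add (hi.const_mul (2 * (Real.exp (l / 2) - 1))))
    ((ae_prod_mem hμ).mono fun p hp => exp_half_sq_sub_le l hp)).trans ?_
  simp only [Pi.add_apply]
  rw [integral_add (integrable_const 1) (hi.const_mul _), integral_const_mul,
    integral_half_sq_sub hμ]
  simp only [integral_const, probReal_univ, smul_eq_mul, mul_one]
  linarith [Real.add_one_le_exp (2 * (Real.exp (l / 2) - 1) * variance id μ)]

/-- A Chernoff bound for the variance estimate; `l` may be negative. -/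
lemma pi_varEst_le (l s : ℝ) (T : ℕ) :
    Measure.pi (fun _ : Fin (T + T) => μ)
      {x | s ≤ l * ∑ r : Fin T, (x (Fin.castAdd T r) - x (Fin.natAdd T r)) ^ 2 / 2} ≤
      ENNReal.ofReal (Real.exp (T * (2 * (Real.exp (l / 2) - 1) * variance id μ) - s)) := by
  have h := pi_sum_ge_le (μ.prod μ) (integrable_exp_half_sq_sub hμ l)
    (integral_exp_half_sq_sub_le hμ l) T s
  rw [← (measurePreserving_pair μ T).measure_preimage] at h
  · simpa only [Set.preimage_ofPred_eq, Finset.mul_sum] using h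
  · exact (measurableSet_le measurable_const (by fun_prop)).nullMeasurableSet

end Bounded

/-- Invert `1 - y + y²/2 ≤ exp (-y)`, using `(1 + y + y²/2)(1 - y + y²/2) = 1 + y⁴/4`. -/
lemma exp_le_quadratic_of_nonpos {y : ℝ} (hy : y ≤ 0) : Real.exp y ≤ 1 + y + y ^ 2 / 2 := by
  have h1 := Real.quadratic_le_exp_of_nonneg (neg_nonneg.2 hy)
  have h2 : Real.exp y * Real.exp (-y) = 1 := by rw [← Real.exp_add]; simp
  have h3 : 0 < Real.exp y := Real.exp_pos y
  have h4 : Real.exp y * (1 - y + y ^ 2 / 2) ≤ 1 := by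
    rw [← h2]; gcongr; linarith [neg_sq y]
  have h5 : 1 ≤ (1 + y + y ^ 2 / 2) * (1 - y + y ^ 2 / 2) := by nlinarith [sq_nonneg (y ^ 2)]
  have h6 : 0 < 1 - y + y ^ 2 / 2 := by nlinarith
  exact le_of_mul_le_mul_right (h4.trans h5) h6

lemma two_mul_three_pow_le_factorial (k : ℕ) : 2 * 3 ^ k ≤ (k + 2).factorial := by
  induction k with
  | zero => norm_num [Nat.factorial]
  | succ k ih =>
    rw [show k + 1 + 2 = (k + 2) + 1 from rfl, Nat.factorial_succ, pow_succ]
    nlinarith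

/-- Since `(k + 2)! ≥ 2 · 3 ^ k`, the Taylor tail from degree two on is dominated by a geometric
series of ratio `y / 3`. -/
lemma exp_le_bernstein_of_nonneg {y : ℝ} (h0 : 0 ≤ y) (h3 : y < 3) :
    Real.exp y ≤ 1 + y + y ^ 2 / (2 * (1 - y / 3)) := by
  have h1 : HasSum (fun k : ℕ => y ^ k / (k.factorial : ℝ)) (Real.exp y) := by
    rw [Real.exp_eq_exp_ℝ]; exact NormedSpace.expSeries_div_hasSum_exp y
  have h2 := (hasSum_nat_add_iff' 2).2 h1
  have hg := (hasSum_geometric_of_lt_one (r := y / 3) (by positivity) (by linarith)).mul_left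
    (y ^ 2 / 2)
  have h4 := hasSum_le (fun k => ?_) h2 hg
  · simp only [Finset.sum_range_succ, Finset.range_zero, Finset.sum_empty, pow_zero, pow_one,
      Nat.factorial_zero, Nat.factorial_one, Nat.cast_one, div_one, zero_add] at h4
    have h5 : y ^ 2 / (2 * (1 - y / 3)) = y ^ 2 / 2 * (1 - y / 3)⁻¹ := by
      rw [← div_div, div_eq_mul_inv (y ^ 2 / 2)]
    linarith
  · have h5 : (2 * 3 ^ k : ℝ) ≤ ((k + 2).factorial : ℝ) := by
      exact_mod_cast two_mul_three_pow_le_factorial k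
    calc y ^ (k + 2) / ((k + 2).factorial : ℝ) ≤ y ^ (k + 2) / (2 * 3 ^ k) := by gcongr
      _ = y ^ 2 / 2 * (y / 3) ^ k := by rw [div_pow]; field_simp; ring

lemma exp_mul_le_bernstein {l x : ℝ} (h0 : 0 ≤ l) (h3 : l < 3) (hx : x ≤ 1) :
    Real.exp (l * x) ≤ 1 + l * x + x ^ 2 * (l ^ 2 / (2 * (1 - l / 3))) := by
  have hpos : 0 < 2 * (1 - l / 3) := by linarith
  rcases le_total 0 x with h | h
  · have h1 : l * x ≤ l := mul_le_of_le_one_right h0 hx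
    refine (exp_le_bernstein_of_nonneg (mul_nonneg h0 h) (h1.trans_lt h3)).trans ?_
    have : (l * x) ^ 2 / (2 * (1 - l * x / 3)) ≤ (l * x) ^ 2 / (2 * (1 - l / 3)) := by gcongr
    calc _ ≤ 1 + l * x + (l * x) ^ 2 / (2 * (1 - l / 3)) := by linarith
      _ = _ := by ring
  · refine (exp_le_quadratic_of_nonpos (mul_nonpos_of_nonneg_of_nonpos h0 h)).trans ?_
    have : (l * x) ^ 2 / 2 ≤ (l * x) ^ 2 / (2 * (1 - l / 3)) := by
      gcongr; linarith
    calc _ ≤ 1 + l * x + (l * x) ^ 2 / (2 * (1 - l / 3)) := by linarith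
      _ = _ := by ring

section Bernstein

variable {μ : Measure ℝ} [IsProbabilityMeasure μ]

/-- Bernstein's inequality, with an upper bound `v` on the variance. -/
lemma pi_bernstein {b v ε : ℝ} (hb : ∀ᵐ x ∂μ, |x - b| ≤ 1) (hm : ∫ x, x - b ∂μ = 0)
    (hv : ∫ x, (x - b) ^ 2 ∂μ ≤ v) (hv0 : 0 < v) (hε : 0 < ε) {c : ℝ} (hc : |c| = 1) (m : ℕ) :
    Measure.pi (fun _ : Fin m => μ) {x | m * ε ≤ ∑ r, c * (x r - b)} ≤
      ENNReal.ofReal (Real.exp (-(m * ε ^ 2 / (2 * v + 2 / 3 * ε)))) := by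
  -- For this `l` one has `1 - l/3 = v / (v + ε/3)`, so the moment term `v K` equals half of `l ε`
  -- and the exponent collapses to `-m ε² / (2v + 2ε/3)`.
  set l : ℝ := ε / (v + ε / 3) with hl
  have hpos : 0 < v + ε / 3 := by positivity
  have hl0 : 0 ≤ l := by positivity
  have hl3 : l < 3 := by rw [hl, div_lt_iff₀ hpos]; linarith
  have hc1 : c ^ 2 = 1 := by rw [← sq_abs, hc, one_pow]
  have hI1 : Integrable (fun x => x - b) μ :=
    Integrable.of_bound (by fun_prop) 1 hb
  have hI2 : Integrable (fun x => (x - b) ^ 2) μ := by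
    refine Integrable.of_bound (by fun_prop) 1 (hb.mono fun x hx => ?_)
    rw [norm_pow]; exact pow_le_one₀ (norm_nonneg _) hx
  have hcx : ∀ x, |x - b| ≤ 1 → |c * (x - b)| ≤ 1 := fun x hx => by rw [abs_mul, hc, one_mul]; exact hx
  have hIe : Integrable (fun x => Real.exp (l * (c * (x - b)))) μ := by
    refine Integrable.of_bound (by fun_prop) (Real.exp l) (hb.mono fun x hx => ?_)
    rw [Real.norm_eq_abs, Real.abs_exp]
    exact Real.exp_le_exp.2 (mul_le_of_le_one_right hl0 (le_of_abs_le (hcx x hx)))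
  set K := l ^ 2 / (2 * (1 - l / 3)) with hK
  have hK0 : 0 ≤ K := div_nonneg (sq_nonneg _) (by linarith)
  have hmgf : ∫ x, Real.exp (l * (c * (x - b))) ∂μ ≤ Real.exp (v * K) := by
    have h1 : ∫ x, Real.exp (l * (c * (x - b))) ∂μ ≤
        ∫ x, (1 + l * c * (x - b)) + (x - b) ^ 2 * K ∂μ := by
      refine integral_mono_ae hIe (((integrable_const 1).add (hI1.const_mul _)).add
        (hI2.mul_const _)) (hb.mono fun x hx => ?_)
      have := exp_mul_le_bernstein hl0 hl3 (le_of_abs_le (hcx x hx))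
      rw [mul_pow, hc1, one_mul] at this
      simpa only [mul_assoc] using this
    rw [integral_add (f := fun x => 1 + l * c * (x - b)) ((integrable_const 1).add (hI1.const_mul _)) (hI2.mul_const _),
      integral_add (integrable_const 1) (hI1.const_mul _), integral_const_mul, hm,
      integral_mul_const] at h1
    simp only [integral_const, probReal_univ, smul_eq_mul, mul_one, mul_zero, add_zero] at h1
    have h2 := mul_le_mul_of_nonneg_right hv hK0
    linarith [Real.add_one_le_exp (v * K)]
  have h := pi_sum_ge_le μ hIe hmgf m (l * (m * ε))
  refine (measure_mono fun x hx => ?_).trans (h.trans (ENNReal.ofReal_le_ofReal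
    (Real.exp_le_exp.2 (le_of_eq ?_))))
  · rw [Set.mem_ofPred_eq] at hx ⊢
    rw [← Finset.mul_sum]
    exact mul_le_mul_of_nonneg_left hx hl0
  · have h1 : 1 - l / 3 = v / (v + ε / 3) := by rw [hl]; field_simp; ring
    rw [hK, h1, hl]
    field_simp
    ring

end Bernstein

/-! ### Variance estimation -/

section VarEst

variable {ν : Fin n → Measure ℝ} [∀ i, IsProbabilityMeasure (ν i)]
  (hν : ∀ i, ∀ᵐ x ∂(ν i), x ∈ Set.Icc (0 : ℝ) 1)

/-- Running the tests at level `δ / e` makes the logarithm `1 + ln δ⁻¹`, which leaves a spare factor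
`e⁻²⁰`. -/
lemma exp_neg_twenty_mul_log_le {δ : ℝ} (h0 : 0 < δ) (h1 : δ ≤ 1) :
    Real.exp (-20 * Real.log (1 / (δ / Real.exp 1))) ≤ δ / 1000 := by
  have hL : Real.log (1 / (δ / Real.exp 1)) = 1 - Real.log δ := by
    rw [one_div_div, Real.log_div (Real.exp_pos 1).ne' h0.ne', Real.log_exp]
  have hlog : Real.log δ ≤ 0 := Real.log_nonpos h0.le h1
  have h2 : (2 : ℝ) ^ 20 ≤ Real.exp 20 := by
    have h3 : (2 : ℝ) ≤ Real.exp 1 := by linarith [Real.add_one_le_exp (1 : ℝ)]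
    calc (2 : ℝ) ^ 20 ≤ Real.exp 1 ^ 20 := by gcongr
      _ = Real.exp 20 := by rw [← Real.exp_nat_mul]; norm_num
  calc Real.exp (-20 * Real.log (1 / (δ / Real.exp 1))) ≤ Real.exp (Real.log δ + -20) := by
        rw [hL]; apply Real.exp_le_exp.2; linarith
    _ = δ / Real.exp 20 := by rw [Real.exp_add, Real.exp_log h0, Real.exp_neg]; rfl
    _ ≤ δ / 1000 := by gcongr; linarith

lemma one_le_log_div_exp {δ : ℝ} (h0 : 0 < δ) (h1 : δ ≤ 1) :
    1 ≤ Real.log (1 / (δ / Real.exp 1)) := by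
  rw [one_div_div, Real.log_div (Real.exp_pos 1).ne' h0.ne', Real.log_exp]
  linarith [Real.log_nonpos h0.le h1]

lemma le_ceil_mul {τ L : ℝ} (hτ : 0 < τ) : 80 * L ≤ (⌈80 / τ * L⌉₊ : ℝ) * τ := by
  have := mul_le_mul_of_nonneg_right (Nat.le_ceil (80 / τ * L)) hτ.le
  calc 80 * L = 80 / τ * L * τ := by field_simp
    _ ≤ _ := this

include hν

open Classical in
lemma expect_varTest_false_le (i : Fin n) {τ δ : ℝ} (hτ : 0 < τ)
    (hL : 1 ≤ Real.log (1 / δ)) (h : 2 * τ ≤ variance id (ν i)) :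
    (varTest i τ δ 80).WHP ν (Real.exp (-20 * Real.log (1 / δ))) fun b _ => b = true := by
  set L := Real.log (1 / δ)
  have hT := le_ceil_mul (τ := τ) (L := L) hτ
  set T : ℕ := ⌈80 / τ * L⌉₊ with hTdef
  have hT0 : (0 : ℝ) < T := by
    by_contra hc
    have : (T : ℝ) * τ ≤ 0 := mul_nonpos_of_nonpos_of_nonneg (not_lt.1 hc) hτ.le
    linarith
  unfold Algo.WHP
  simp only [varTest, Algo.expect]
  -- Here `exp (l / 2) = 1/2`, so the exponent is `T (2 ln 2 · τ - σ²) ≤ -(2 - 2 ln 2) T τ`, about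
  -- `-0.61 T τ`, while `T τ ≥ 80 L`.
  have hb := pi_varEst_le (hν i) (-2 * Real.log 2) (-2 * Real.log 2 * (T * τ)) T
  refine (upperInt_indicator_le (s := {x : Fin (T + T) → ℝ | -2 * Real.log 2 * (T * τ) ≤
    -2 * Real.log 2 * ∑ r : Fin T, (x (Fin.castAdd T r) - x (Fin.natAdd T r)) ^ 2 / 2})
    (b := 0) (measurableSet_le (by fun_prop) (by fun_prop)) (fun x => ?_) fun x hx => ?_).trans ?_
  · split_ifs <;> simp
  · rw [Set.mem_ofPred_eq, not_le] at hx
    have hx' := lt_of_mul_lt_mul_of_nonpos_left hx (by nlinarith [Real.log_two_gt_d9])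
    have : τ < 1 / (T : ℝ) * ∑ r : Fin T, (x (Fin.castAdd T r) - x (Fin.natAdd T r)) ^ 2 / 2 := by
      rw [one_div, ← div_eq_inv_mul, lt_div_iff₀ hT0, mul_comm]; exact hx'
    exact le_of_eq (if_pos (decide_eq_true this))
  · rw [add_zero]
    refine hb.trans (ENNReal.ofReal_le_ofReal (Real.exp_le_exp.2 ?_))
    have h2 : Real.exp (-2 * Real.log 2 / 2) = 1 / 2 := by
      rw [show -2 * Real.log 2 / 2 = -Real.log 2 by ring, Real.exp_neg, Real.exp_log two_pos]
      norm_num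
    rw [h2]
    have h3 := mul_le_mul_of_nonneg_left h hT0.le
    nlinarith [Real.log_two_lt_d9, mul_pos hT0 hτ]

-- The factor `a⁻²` is the point: a false positive at a threshold `a` times too large costs in
-- proportion to `a`, so its weighted probability is of order `1/a`, which still sums geometrically
-- over the rounds of `varEstLoop`.
open Classical in
lemma expect_varTest_true_le (i : Fin n) {τ δ a : ℝ} (hτ : 0 < τ)
    (hL : 1 ≤ Real.log (1 / δ)) (ha : 2 ≤ a) (h : a * variance id (ν i) ≤ τ) :
    (varTest i τ δ 80).expect ν (fun b _ => if b = true then 1 else 0) ≤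
      ENNReal.ofReal (Real.exp (-20 * Real.log (1 / δ)) / a ^ 2) := by
  set L := Real.log (1 / δ)
  have hT := le_ceil_mul (τ := τ) (L := L) hτ
  set T : ℕ := ⌈80 / τ * L⌉₊ with hTdef
  have hT0 : (0 : ℝ) < T := by
    by_contra hc
    have : (T : ℝ) * τ ≤ 0 := mul_nonpos_of_nonpos_of_nonneg (not_lt.1 hc) hτ.le
    linarith
  have ha0 : 0 < a := by linarith
  have hlog2 : Real.log 2 ≤ Real.log a := Real.log_le_log two_pos ha
  have hl2 := Real.log_two_gt_d9
  simp only [varTest, Algo.expect]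
  -- The optimal exponent when `τ = a σ²`: then `exp (l / 2) = a`, and the bound becomes `exp (-2 T
  -- τ κ)` with `κ = ln a - 1 + 1/a`.
  have hb := pi_varEst_le (hν i) (2 * Real.log a) (2 * Real.log a * (T * τ)) T
  refine (upperInt_indicator_le (s := {x : Fin (T + T) → ℝ | 2 * Real.log a * (T * τ) ≤
    2 * Real.log a * ∑ r : Fin T, (x (Fin.castAdd T r) - x (Fin.natAdd T r)) ^ 2 / 2})
    (b := 0) (measurableSet_le (by fun_prop) (by fun_prop)) (fun x => ?_) fun x hx => ?_).trans ?_
  · split_ifs <;> simp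
  · rw [Set.mem_ofPred_eq, not_le] at hx
    have hx' := lt_of_mul_lt_mul_left hx (by linarith)
    have : ¬ τ < 1 / (T : ℝ) *
        ∑ r : Fin T, (x (Fin.castAdd T r) - x (Fin.natAdd T r)) ^ 2 / 2 := by
      rw [one_div, ← div_eq_inv_mul, lt_div_iff₀ hT0, mul_comm, not_lt]; exact hx'.le
    exact le_of_eq (if_neg fun hd => this (of_decide_eq_true hd))
  · rw [add_zero]
    refine hb.trans (ENNReal.ofReal_le_ofReal ?_)
    have h2 : Real.exp (2 * Real.log a / 2) = a := by
      rw [mul_div_cancel_left₀ _ two_ne_zero, Real.exp_log ha0]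
    have h3 : Real.exp (-20 * L) / a ^ 2 = Real.exp (-20 * L - 2 * Real.log a) := by
      rw [Real.exp_sub, mul_comm 2, Real.exp_mul (Real.log a), Real.exp_log ha0, Real.rpow_two]
    rw [h2, h3]
    apply Real.exp_le_exp.2
    have h4 : 1 - 2 / a ≤ Real.log a - Real.log 2 := by
      rw [← Real.log_div ha0.ne' two_ne_zero]
      have := Real.one_sub_inv_le_log_of_pos (x := a / 2) (by positivity)
      rwa [inv_div] at this
    have h5 : 2 / a ≤ 1 := by rw [div_le_one ha0]; exact ha
    have h6 : (a - 1) * variance id (ν i) ≤ (1 - 1 / a) * τ := by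
      have : (a - 1) * variance id (ν i) = (1 - 1 / a) * (a * variance id (ν i)) := by
        field_simp
      rw [this]
      refine mul_le_mul_of_nonneg_left h ?_
      have : 1 / a = 2 / a / 2 := by ring
      linarith
    have h7 : T * ((a - 1) * variance id (ν i)) ≤ T * ((1 - 1 / a) * τ) :=
      mul_le_mul_of_nonneg_left h6 hT0.le
    set κ := Real.log a - 1 + 1 / a with hκ
    have h8 : 20 + 2 * Real.log a ≤ 160 * κ := by
      have : 1 / a = 2 / a / 2 := by ring
      rw [hκ]; linarith
    have hκ0 : 0 ≤ κ := by linarith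
    have h9 : 80 * L * κ ≤ T * τ * κ := mul_le_mul_of_nonneg_right hT hκ0
    have h10 : 20 * L + 2 * Real.log a ≤ 160 * κ * L := by
      have := mul_le_mul_of_nonneg_right h8 (by linarith : 0 ≤ L)
      nlinarith
    have h11 : T * (2 * (a - 1) * variance id (ν i)) - 2 * Real.log a * (T * τ) ≤
        -2 * (T * τ * κ) := by rw [hκ]; linarith
    linarith

-- Round `r` takes at most `160 · 2^r L + 2 ≤ 162 · 2^r L` samples, and these add up geometrically.
-- The disjunction holds because the loop moves on only while its threshold exceeds `ℓ`, so the next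
-- threshold exceeds `ℓ / 2`.
omit hν in
lemma sure_varEstLoop (i : Fin n) {δ ℓ : ℝ} (hL : 1 ≤ Real.log (1 / (δ / Real.exp 1)))
    (fuel r : ℕ) :
    (varEstLoop i δ ℓ fuel r).Sure fun v t => ∃ s, r ≤ s ∧ v = 1 / 2 ^ s ∧
      (s = r ∨ ℓ < 2 / 2 ^ s) ∧
      (t : ℝ) ≤ 162 * Real.log (1 / (δ / Real.exp 1)) * (2 ^ (s + 1) - 2 ^ r) := by
  set L := Real.log (1 / (δ / Real.exp 1)) with hLdef
  have hhalt : ∀ r : ℕ, ∃ s, r ≤ s ∧ (1 / 2 ^ r : ℝ) = 1 / 2 ^ s ∧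
      (s = r ∨ ℓ < 2 / 2 ^ s) ∧ ((0 : ℕ) : ℝ) ≤ 162 * L * (2 ^ (s + 1) - 2 ^ r) := fun r =>
    ⟨r, le_rfl, rfl, Or.inl rfl, by
      have : (2 : ℝ) ^ r ≤ 2 ^ (r + 1) := pow_le_pow_right₀ one_le_two (Nat.le_succ r)
      rw [Nat.cast_zero]
      exact mul_nonneg (by linarith) (by linarith)⟩
  induction fuel generalizing r with
  | zero => exact hhalt r
  | succ k ih =>
    unfold varEstLoop
    split_ifs with hr
    · exact hhalt r
    · have hr2 : (0 : ℝ) < 2 ^ r := by positivity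
      have hr1 : (1 : ℝ) ≤ 2 ^ r := one_le_pow₀ one_le_two
      refine Algo.sure_bind (Q := fun _ t => (t : ℝ) ≤ 162 * 2 ^ r * L) (fun x => ?_) ?_
      · simp only [Algo.Sure, ← hLdef]
        have := Nat.ceil_lt_add_one (a := 80 / (1 / 2 ^ r) * L) (by positivity)
        rw [div_div_eq_mul_div, div_one] at this ⊢
        push_cast
        nlinarith
      · intro b t ht
        rw [not_le] at hr
        split_ifs
        · refine ⟨r, le_rfl, rfl, Or.inl rfl, ?_⟩
          push_cast
          rw [pow_succ]
          linarith
        · refine (ih (r + 1)).mono ?_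
          rintro v u ⟨s, hs, hv, hl, hu⟩
          refine ⟨s, by omega, hv, Or.inr ?_, ?_⟩
          · rcases hl with rfl | hl
            · rw [pow_succ]
              calc ℓ < 1 / 2 ^ r := hr
                _ = 2 / (2 ^ r * 2) := by field_simp
            · exact hl
          · push_cast
            rw [pow_succ 2 r] at hu
            linarith

/-- No union bound over rounds is needed. Stopping is harmless as long as the threshold is at least
`σ²/4`; only the test at the last such threshold has to succeed, and that threshold is below `σ²/2`.
-/
lemma whp_varEstLoop (i : Fin n) {δ ℓ : ℝ} (hL : 1 ≤ Real.log (1 / (δ / Real.exp 1)))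
    (fuel r : ℕ) (h : variance id (ν i) ≤ 4 * (1 / 2 ^ r)) :
    (varEstLoop i δ ℓ fuel r).WHP ν (Real.exp (-20 * Real.log (1 / (δ / Real.exp 1))))
      fun v _ => variance id (ν i) ≤ 4 * v := by
  have hpos := (Real.exp_pos (-20 * Real.log (1 / (δ / Real.exp 1)))).le
  have hhalt : ∀ r : ℕ, variance id (ν i) ≤ 4 * (1 / 2 ^ r) → (pure (1 / 2 ^ r) : Algo n ℝ).WHP ν
      (Real.exp (-20 * Real.log (1 / (δ / Real.exp 1)))) fun v _ => variance id (ν i) ≤ 4 * v :=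
    fun r hr => Algo.WHP.mono (Algo.Sure.whp (Q := fun v _ => variance id (ν i) ≤ 4 * v) hr)
      hpos fun _ _ h => h
  induction fuel generalizing r with
  | zero => exact hhalt r h
  | succ k ih =>
    unfold varEstLoop
    split_ifs with hr
    · exact hhalt r h
    · by_cases h2 : variance id (ν i) ≤ 4 * (1 / 2 ^ (r + 1))
      · refine (Algo.WHP.bind le_rfl hpos (Algo.Sure.whp (Algo.sure_true _))
          fun b t _ => ?_).mono (zero_add _).le fun _ _ h => h
        split_ifs
        · exact hhalt r h
        · exact ih (r + 1) h2
      · refine (Algo.WHP.bind hpos le_rfl (expect_varTest_false_le hν i (τ := 1 / 2 ^ r)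
          (by positivity) hL ?_) fun b t hb => ?_).mono (add_zero _).le fun _ _ h => h
        · rw [not_le, pow_succ] at h2
          calc 2 * (1 / 2 ^ r : ℝ) = 4 * (1 / (2 ^ r * 2)) := by field_simp; norm_num
            _ ≤ _ := h2.le
        · rw [if_pos hb]
          exact Algo.Sure.whp (Q := fun v _ => variance id (ν i) ≤ 4 * v) h

-- The bound telescopes. With `a = 2^(-r) / M`, a false positive in round `r` contributes at most `a
-- · p / a² = p M 2^r`, and `p M 2^r + p (1 - M 2^(r+1)) = p (1 - M 2^r)`. The hypothesis `hf`
-- ensures that the fuel outlasts the thresholds above `ℓ ≤ M`.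
open Classical in
lemma expect_varEstLoop_le (i : Fin n) {δ ℓ M : ℝ} (hL : 1 ≤ Real.log (1 / (δ / Real.exp 1)))
    (hM : 0 < M) (hℓ : ℓ ≤ M) (hσ : variance id (ν i) ≤ M) (fuel r : ℕ)
    (hf : 1 / 2 ^ (r + fuel) ≤ ℓ) (hr : M * 2 ^ r ≤ 1) :
    (varEstLoop i δ ℓ fuel r).expect ν (fun v _ => if 2 * M < v then ENNReal.ofReal (v / M) else 0) ≤
      ENNReal.ofReal
        (Real.exp (-20 * Real.log (1 / (δ / Real.exp 1))) * (1 - M * 2 ^ r)) := by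
  set p := Real.exp (-20 * Real.log (1 / (δ / Real.exp 1))) with hp
  have hp0 : 0 ≤ p := (Real.exp_pos _).le
  have hzero : ∀ fuel r : ℕ, (1 / 2 ^ r : ℝ) ≤ 2 * M → (varEstLoop i δ ℓ fuel r).expect ν
      (fun v _ => if 2 * M < v then ENNReal.ofReal (v / M) else 0) ≤ 0 := fun fuel r hr => by
    refine ((varEstLoop i δ ℓ fuel r).expect_mono_of_sure (sure_varEstLoop i hL fuel r)
      (g := fun _ _ => 0) ?_).trans ((varEstLoop i δ ℓ fuel r).expect_const_le 0)
    rintro v t ⟨s, hs, rfl, -⟩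
    have : (1 / 2 ^ s : ℝ) ≤ 1 / 2 ^ r :=
      one_div_le_one_div_of_le (by positivity) (pow_le_pow_right₀ one_le_two hs)
    rw [if_neg (by linarith)]
  induction fuel generalizing r with
  | zero => exact (hzero 0 r (by rw [add_zero] at hf; linarith)).trans bot_le
  | succ k ih =>
    by_cases h2 : (1 / 2 ^ r : ℝ) ≤ 2 * M
    · exact (hzero _ r h2).trans bot_le
    · rw [not_le] at h2
      have hr0 : (0 : ℝ) < 2 ^ r := by positivity
      have h3 : M * 2 ^ (r + 1) ≤ 1 := by
        rw [lt_div_iff₀ hr0] at h2; rw [pow_succ]; linarith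
      unfold varEstLoop
      rw [if_neg (by linarith), Algo.expect_bind]
      have ih' := ih (r + 1) (by rwa [add_right_comm, add_assoc]) h3
      refine (Algo.expect_mono (g := fun b _ => ENNReal.ofReal (1 / 2 ^ r / M) *
        (if b = true then 1 else 0) + ENNReal.ofReal (p * (1 - M * 2 ^ (r + 1)))) fun b t => ?_).trans ?_
      · split_ifs with hb
        · rw [mul_one]
          refine le_add_right (le_of_eq ?_)
          simp only [pure_eq_done, Algo.expect, if_pos h2]
        · exact ih'.trans le_add_self
      · refine (Algo.expect_add_le _ _ _).trans (le_trans (add_le_add ((Algo.expect_const_mul_le _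
          ENNReal.ofReal_ne_top _).trans (mul_le_mul_right (expect_varTest_true_le hν i
            (a := 1 / 2 ^ r / M) (by positivity) hL ?_ ?_) _)) (Algo.expect_const_le _ _)) ?_)
        · rw [le_div_iff₀ hM]; exact h2.le
        · rw [div_mul_eq_mul_div, mul_div_assoc]
          exact mul_le_of_le_one_right (by positivity) ((div_le_one hM).2 hσ)
        · rw [← hp, ← ENNReal.ofReal_mul (by positivity), ← ENNReal.ofReal_add (by positivity)
            (mul_nonneg hp0 (by linarith))]
          apply ENNReal.ofReal_le_ofReal
          rw [pow_succ]
          apply le_of_eq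
          field_simp
          ring

omit hν in
lemma sure_varEst (i : Fin n) {δ ℓ : ℝ} (hδ0 : 0 < δ) (hδ1 : δ ≤ 1) (hℓ0 : 0 < ℓ) (hℓ1 : ℓ < 1) :
    (varEst i δ ℓ).Sure fun v t => (∃ s, 1 ≤ s ∧ v = 1 / 2 ^ s) ∧ ℓ < 2 * v ∧
      (t : ℝ) ≤ 648 * Real.log (1 / (δ / Real.exp 1)) / ℓ := by
  have hL := one_le_log_div_exp hδ0 hδ1
  refine (sure_varEstLoop i hL _ 1).mono ?_
  rintro v t ⟨s, hs, rfl, h, ht⟩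
  have hs0 : (0 : ℝ) < 2 ^ s := by positivity
  have h1 : ℓ < 2 / 2 ^ s := by
    rcases h with rfl | h
    · norm_num; exact hℓ1
    · exact h
  refine ⟨⟨s, hs, rfl⟩, by rwa [mul_one_div], ht.trans ?_⟩
  rw [lt_div_iff₀ hs0] at h1
  rw [le_div_iff₀ hℓ0, pow_succ]
  nlinarith

lemma whp_varEst (i : Fin n) {δ ℓ : ℝ} (hδ0 : 0 < δ) (hδ1 : δ ≤ 1) :
    (varEst i δ ℓ).WHP ν (δ / 1000) fun v _ => variance id (ν i) ≤ 4 * v :=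
  (whp_varEstLoop hν i (one_le_log_div_exp hδ0 hδ1) _ 1
    (by linarith [variance_le_quarter (hν i)])).mono (exp_neg_twenty_mul_log_le hδ0 hδ1)
    fun _ _ h => h

open Classical in
lemma expect_varEst_le (i : Fin n) {δ ℓ M : ℝ} (hδ0 : 0 < δ) (hδ1 : δ ≤ 1) (hℓ0 : 0 < ℓ)
    (hℓ1 : ℓ < 1) (hℓ : ℓ ≤ M) (hσ : variance id (ν i) ≤ M) :
    (varEst i δ ℓ).expect ν (fun v _ => if 2 * M < v then ENNReal.ofReal v else 0) ≤
      ENNReal.ofReal (M * (δ / 1000)) := by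
  have hM : 0 < M := hℓ0.trans_le hℓ
  -- Otherwise the event is empty, as all outputs are at most `1/2`.
  by_cases h2 : 2 * M < 1 / 2
  · have hL := one_le_log_div_exp hδ0 hδ1
    have h1 : (varEst i δ ℓ).expect ν
        (fun v _ => if 2 * M < v then ENNReal.ofReal (v / M) else 0) ≤ ENNReal.ofReal (δ / 1000) := by
      refine (expect_varEstLoop_le hν i hL hM hℓ hσ ⌈1 / ℓ⌉₊ 1 ?_ (by linarith)).trans
        (ENNReal.ofReal_le_ofReal ?_)
      · have h3 : (1 / ℓ : ℝ) ≤ 2 ^ (1 + ⌈1 / ℓ⌉₊) := by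
          refine (Nat.le_ceil _).trans ?_
          have := (Nat.lt_two_pow_self (n := 1 + ⌈1 / ℓ⌉₊)).le
          calc ((⌈1 / ℓ⌉₊ : ℕ) : ℝ) ≤ ((1 + ⌈1 / ℓ⌉₊ : ℕ) : ℝ) := by push_cast; linarith
            _ ≤ ((2 ^ (1 + ⌈1 / ℓ⌉₊) : ℕ) : ℝ) := by exact_mod_cast this
            _ = _ := by push_cast; rfl
        exact (one_div_le hℓ0 (by positivity)).1 h3
      · refine le_trans (mul_le_of_le_one_right (Real.exp_pos _).le (by nlinarith)) 
          (exp_neg_twenty_mul_log_le hδ0 hδ1)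
    rw [ENNReal.ofReal_mul hM.le]
    refine le_trans ?_ (mul_le_mul_right h1 _)
    refine le_trans (Algo.expect_mono fun v t => ?_)
      (Algo.expect_const_mul_le _ ENNReal.ofReal_ne_top _)
    split_ifs
    · rw [← ENNReal.ofReal_mul hM.le, mul_div_cancel₀ _ hM.ne']
    · simp
  · refine ((varEst i δ ℓ).expect_mono_of_sure (sure_varEst i hδ0 hδ1 hℓ0 hℓ1)
      (g := fun _ _ => 0) ?_).trans (((varEst i δ ℓ).expect_const_le 0).trans bot_le)
    rintro v t ⟨⟨s, hs, rfl⟩, -⟩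
    have : (1 / 2 ^ s : ℝ) ≤ 1 / 2 ^ 1 :=
      one_div_le_one_div_of_le (by positivity) (pow_le_pow_right₀ one_le_two hs)
    rw [if_neg (by linarith)]

end VarEst

/-! ### Mean estimation -/

/-- The number of samples that the estimation of the mean of arm `i` typically takes. -/
def meanCost (ν : Fin n → Measure ℝ) (ε δ : ℝ) (i : Fin n) : ℝ :=
  1320 * Real.log (4 / δ) * ((variance id (ν i) + ε) / ε ^ 2)

section MeanEst

variable {ν : Fin n → Measure ℝ} [∀ i, IsProbabilityMeasure (ν i)]
  (hν : ∀ i, ∀ᵐ x ∂(ν i), x ∈ Set.Icc (0 : ℝ) 1)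

lemma one_le_log_four_div {δ : ℝ} (h0 : 0 < δ) (h1 : δ ≤ 1) : 1 ≤ Real.log (4 / δ) := by
  have h : Real.log 4 ≤ Real.log (4 / δ) := by
    apply Real.log_le_log (by norm_num)
    rw [le_div_iff₀ h0]; linarith
  have h2 : Real.log 4 = 2 * Real.log 2 := by
    rw [show (4 : ℝ) = 2 ^ 2 by norm_num, Real.log_pow]; norm_num
  linarith [Real.log_two_gt_d9]

lemma meanCost_pos {ε δ : ℝ} (hε : 0 < ε) (h0 : 0 < δ) (h1 : δ ≤ 1) (i : Fin n) :
    0 < meanCost ν ε δ i := by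
  have := one_le_log_four_div h0 h1
  have := variance_nonneg id (ν i)
  unfold meanCost
  positivity

include hν

lemma pi_mean_sub_le (i : Fin n) {ε δ v : ℝ} (hε0 : 0 < ε) (hδ0 : 0 < δ) (hv0 : 0 < v)
    (hv : variance id (ν i) ≤ 4 * v) {m : ℕ}
    (hm : (8 * v / ε ^ 2 + 2 / (3 * ε)) * Real.log (4 / δ) ≤ m) {c : ℝ} (hc : |c| = 1) :
    Measure.pi (fun _ : Fin m => ν i) {x | m * ε ≤ ∑ r, c * (x r - mean (ν i))} ≤
      ENNReal.ofReal (δ / 4) := by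
  have hmean := mean_mem (hν i)
  have hb : ∀ᵐ x ∂(ν i), |x - mean (ν i)| ≤ 1 := (hν i).mono fun x hx => by
    rw [abs_le]; constructor <;> linarith [hx.1, hx.2, hmean.1, hmean.2]
  have h0 : ∫ x, x - mean (ν i) ∂(ν i) = 0 := by
    rw [integral_sub (integrable_self (hν i)) (integrable_const _)]
    simp [mean]
  have hvar : ∫ x, (x - mean (ν i)) ^ 2 ∂(ν i) ≤ 4 * v := by
    refine le_trans (le_of_eq ?_) hv
    rw [variance_eq_integral measurable_id.aemeasurable]
    rfl
  refine (pi_bernstein hb h0 hvar (by linarith) hε0 hc m).trans (ENNReal.ofReal_le_ofReal ?_)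
  have h1 : Real.log (4 / δ) ≤ m * ε ^ 2 / (2 * (4 * v) + 2 / 3 * ε) := by
    rw [le_div_iff₀ (by positivity)]
    have h2 := mul_le_mul_of_nonneg_right hm (sq_nonneg ε)
    refine le_trans (le_of_eq ?_) h2
    field_simp
    ring
  calc _ ≤ Real.exp (-Real.log (4 / δ)) := Real.exp_le_exp.2 (neg_le_neg h1)
    _ = δ / 4 := by rw [Real.exp_neg, Real.exp_log (by positivity), inv_div]

lemma whp_meanEst (i : Fin n) {ε δ : ℝ} (hε0 : 0 < ε) (hε1 : ε < 1) (hδ0 : 0 < δ) (hδ1 : δ ≤ 1) :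
    (meanEst i ε δ).WHP ν (3 / 4 * δ) fun θ _ => |θ - mean (ν i)| ≤ ε := by
  classical
  have hA : (varEst i (δ / 2) ε).WHP ν (δ / 2 / 1000)
      fun v _ => 0 < v ∧ variance id (ν i) ≤ 4 * v :=
    (whp_varEst hν i (by linarith) (by linarith)).mono_of_sure
      (sure_varEst i (by linarith) (by linarith) hε0 hε1) le_rfl fun v t h h' =>
        ⟨by linarith [h.2.1], h'⟩
  refine (Algo.WHP.bind (q := δ / 4 + δ / 4) (by positivity) (by positivity) hA ?_).mono
    (by linarith) fun _ _ h => h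
  rintro v t ⟨hv0, hv⟩
  have hm := Nat.le_ceil ((8 * v / ε ^ 2 + 2 / (3 * ε)) * Real.log (4 / δ))
  have hm0 : 0 < (8 * v / ε ^ 2 + 2 / (3 * ε)) * Real.log (4 / δ) := by
    have := one_le_log_four_div hδ0 hδ1
    positivity
  simp only [Algo.WHP, Algo.expect]
  set m : ℕ := ⌈(8 * v / ε ^ 2 + 2 / (3 * ε)) * Real.log (4 / δ)⌉₊
  have hm0' : (0 : ℝ) < m := hm0.trans_le hm
  set b := mean (ν i)
  refine (upperInt_indicator_le (b := 0) (s := {x : Fin m → ℝ | m * ε ≤ ∑ r, 1 * (x r - b)} ∪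
    {x : Fin m → ℝ | m * ε ≤ ∑ r, -1 * (x r - b)})
    ((measurableSet_le (by fun_prop) (by fun_prop)).union
      (measurableSet_le (by fun_prop) (by fun_prop))) (fun x => ?_) fun x hx => ?_).trans ?_
  · split_ifs <;> simp
  · refine le_of_eq (if_pos ?_)
    simp only [Set.mem_union, Set.mem_ofPred_eq, not_or, not_le, ← Finset.mul_sum,
      Finset.sum_sub_distrib, Finset.sum_const, Finset.card_univ, Fintype.card_fin,
      nsmul_eq_mul] at hx
    rw [show (∑ r, x r) / m - b = (∑ r, x r - m * b) / m by field_simp, abs_div,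
      abs_of_pos hm0', div_le_iff₀ hm0', abs_le]
    constructor <;> linarith [hx.1, hx.2]
  · rw [add_zero, ENNReal.ofReal_add (by positivity) (by positivity)]
    exact (measure_union_le _ _).trans (add_le_add
      (pi_mean_sub_le hν i hε0 hδ0 hv0 hv hm (by simp))
      (pi_mean_sub_le hν i hε0 hδ0 hv0 hv hm (by simp)))

/-- Subtraction in `ℝ≥0∞` is truncated, so this bounds the expected number of samples in excess of
`meanCost`. An excess occurs only if the variance estimate `v` is above `2 (σ² + ε)`, and it is then
at most `8 v ln (4/δ) / ε²`. -/
lemma expect_meanEst_le (i : Fin n) {ε δ : ℝ} (hε0 : 0 < ε) (hε1 : ε < 1) (hδ0 : 0 < δ)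
    (hδ1 : δ ≤ 1) :
    (meanEst i ε δ).expect ν (fun _ t => (t : ℝ≥0∞) - ENNReal.ofReal (meanCost ν ε δ i)) ≤
      ENNReal.ofReal (meanCost ν ε δ i * (δ / 1000)) := by
  classical
  have hΛ := one_le_log_four_div hδ0 hδ1
  have hσ := variance_nonneg id (ν i)
  have hv := expect_varEst_le hν i (δ := δ / 2) (M := variance id (ν i) + ε) (by linarith)
    (by linarith) hε0 hε1 (by linarith) (by linarith)
  set G := meanCost ν ε δ i with hG
  have hL : Real.log (1 / (δ / 2 / Real.exp 1)) ≤ 2 * Real.log (4 / δ) := by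
    rw [one_div_div, div_div_eq_mul_div, Real.log_div (by positivity) hδ0.ne',
      Real.log_mul (Real.exp_pos 1).ne' two_ne_zero, Real.log_exp]
    rw [Real.log_div (by norm_num) hδ0.ne', show (4 : ℝ) = 2 ^ 2 by norm_num, Real.log_pow] at hΛ ⊢
    push_cast at hΛ ⊢
    linarith [Real.log_two_gt_d9]
  set Λ := Real.log (4 / δ) with hΛdef
  set M := variance id (ν i) + ε with hM
  have hMε : 1 / ε ≤ M / ε ^ 2 := by
    rw [div_le_div_iff₀ hε0 (by positivity)]; nlinarith
  set K := M / ε ^ 2 with hK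
  have hε1' : 1 ≤ 1 / ε := by rw [le_div_iff₀ hε0]; linarith
  -- In units of `Λ K` the terms are at most `1296`, `2/3`, `1` and `16`, together below the `1320`
  -- of `meanCost`.
  have hrest : 648 * (2 * Λ) / ε + 2 / (3 * ε) * Λ + 1 + 16 * Λ * K ≤ G := by
    have h1 : Λ * (1 / ε) ≤ Λ * K := mul_le_mul_of_nonneg_left hMε (by linarith)
    have h2 : 648 * (2 * Λ) / ε = 1296 * (Λ * (1 / ε)) := by ring
    have h3 : 2 / (3 * ε) * Λ = 2 / 3 * (Λ * (1 / ε)) := by field_simp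
    have h4 : G = 1320 * (Λ * K) := by rw [hG, meanCost, ← hM, ← hΛdef, ← hK]; ring
    have h5 : 1 ≤ Λ * K := by nlinarith
    rw [h2, h3, h4]
    linarith
  have key : (meanEst i ε δ).expect ν (fun _ t => (t : ℝ≥0∞) - ENNReal.ofReal G) ≤
      ENNReal.ofReal (8 * Λ / ε ^ 2) * ENNReal.ofReal (M * (δ / 2 / 1000)) := by
    unfold meanEst
    rw [Algo.expect_bind]
    refine le_trans (Algo.expect_mono_of_sure (sure_varEst i (δ := δ / 2) (by linarith)
      (by linarith) hε0 hε1) (g := fun v _ => ENNReal.ofReal (8 * Λ / ε ^ 2) *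
        (if 2 * M < v then ENNReal.ofReal v else 0)) ?_) ((Algo.expect_const_mul_le _
          ENNReal.ofReal_ne_top _).trans (mul_le_mul_right hv _))
    rintro v t ⟨-, hv1, ht⟩
    have hv0 : 0 < v := by linarith
    simp only [Algo.expect]
    refine (upperInt_const_le _).trans ?_
    set m : ℕ := ⌈(8 * v / ε ^ 2 + 2 / (3 * ε)) * Λ⌉₊ with hm
    have hm1 : (m : ℝ) ≤ (8 * v / ε ^ 2 + 2 / (3 * ε)) * Λ + 1 :=
      (Nat.ceil_lt_add_one (by positivity)).le
    have ht' : (t : ℝ) ≤ 648 * (2 * Λ) / ε := ht.trans (by gcongr)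
    have htot : ((0 + m + t : ℕ) : ℝ) ≤ G - 16 * Λ * K + 8 * Λ / ε ^ 2 * v := by
      have : 8 * Λ / ε ^ 2 * v = 8 * v / ε ^ 2 * Λ := by ring
      push_cast
      linarith
    rw [← ENNReal.ofReal_natCast]
    split_ifs with hc
    · rw [tsub_le_iff_right, ← ENNReal.ofReal_mul (by positivity)]
      refine le_trans (ENNReal.ofReal_le_ofReal ?_) ENNReal.ofReal_add_le
      have : 0 ≤ 16 * Λ * K := by positivity
      linarith
    · rw [mul_zero, tsub_le_iff_right, zero_add (ENNReal.ofReal G)]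
      apply ENNReal.ofReal_le_ofReal
      have : 8 * Λ / ε ^ 2 * v ≤ 8 * Λ / ε ^ 2 * (2 * M) := by
        rw [not_lt] at hc; gcongr
      have h2 : 8 * Λ / ε ^ 2 * (2 * M) = 16 * Λ * K := by rw [hK]; ring
      linarith
  refine key.trans ?_
  rw [← ENNReal.ofReal_mul (by positivity)]
  apply ENNReal.ofReal_le_ofReal
  have h4 : G = 1320 * (Λ * K) := by rw [hG, meanCost, ← hM, ← hΛdef, ← hK]; ring
  have h5 : 8 * Λ / ε ^ 2 * (M * (δ / 2 / 1000)) = 4 * (Λ * K) * (δ / 1000) := by rw [hK]; ring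
  have h6 : 0 ≤ Λ * K := by positivity
  rw [h4, h5]
  gcongr
  norm_num

end MeanEst

/-! ### Loops over arms -/

section ForEach

variable {ν : Fin n → Measure ℝ} [∀ i, IsProbabilityMeasure (ν i)] {f : Fin n → Algo n ℝ}

lemma map_update_eq {γ : Type*} {i : Fin n} {l : List (Fin n)} (hi : i ∉ l)
    (φ : Fin n → ℝ → γ) (g : Fin n → ℝ) (v : ℝ) :
    l.map (fun j => φ j (Function.update g i v j)) = l.map fun j => φ j (g j) :=
  List.map_congr_left fun j hj => by
    rw [Function.update_of_ne (ne_of_mem_of_not_mem hj hi)]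

lemma expect_forList_sum_le {φ : Fin n → ℝ → ℝ≥0∞} {c : Fin n → ℝ≥0∞} {l : List (Fin n)}
    (hl : l.Nodup) (h : ∀ i ∈ l, (f i).expect ν (fun v _ => φ i v) ≤ c i) :
    (forList f l).expect ν (fun θ _ => (l.map fun i => φ i (θ i)).sum) ≤ (l.map c).sum := by
  induction l with
  | nil => simp [forList, pure_eq_done, Algo.expect]
  | cons i l ih =>
    rw [List.nodup_cons] at hl
    simp only [forList, Algo.expect_bind, pure_eq_done, Algo.expect, List.map_cons, List.sum_cons,
      Function.update_self, map_update_eq hl.1]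
    refine (Algo.expect_mono fun v t => (Algo.expect_add_le _ _ _).trans (add_le_add
      (Algo.expect_const_le _ _) (ih hl.2 fun j hj => h j (List.mem_cons_of_mem i hj)))).trans ?_
    exact (Algo.expect_add_le _ _ _).trans (add_le_add (h i List.mem_cons_self)
      (Algo.expect_const_le _ _))

lemma expect_forList_count_le {G c : Fin n → ℝ≥0∞} {l : List (Fin n)}
    (h : ∀ i ∈ l, (f i).expect ν (fun _ t => (t : ℝ≥0∞) - G i) ≤ c i) :
    (forList f l).expect ν (fun _ t => (t : ℝ≥0∞) - (l.map G).sum) ≤ (l.map c).sum := by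
  induction l with
  | nil => simp [forList, pure_eq_done, Algo.expect]
  | cons i l ih =>
    simp only [forList, Algo.expect_bind, pure_eq_done, Algo.expect, List.map_cons, List.sum_cons]
    refine (Algo.expect_mono (g := fun v t => ((t : ℝ≥0∞) - G i) + (l.map c).sum)
      fun v t => ?_).trans ((Algo.expect_add_le _ _ _).trans (add_le_add (h i List.mem_cons_self)
        (Algo.expect_const_le _ _)))
    refine (Algo.expect_mono (g := fun g s => ((t : ℝ≥0∞) - G i) + ((s : ℝ≥0∞) - (l.map G).sum))
      fun g s => ?_).trans ((Algo.expect_add_le _ _ _).trans (add_le_add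
        (Algo.expect_const_le _ _) (ih fun j hj => h j (List.mem_cons_of_mem i hj))))
    rw [zero_add, Nat.cast_add, add_comm]
    exact add_tsub_add_le_tsub_add_tsub

lemma sure_forList {Q : Fin n → ℝ → Prop} {G : Fin n → ℝ} {l : List (Fin n)} (hl : l.Nodup)
    (h : ∀ i ∈ l, (f i).Sure fun v t => Q i v ∧ (t : ℝ) ≤ G i) :
    (forList f l).Sure fun θ t => (∀ i ∈ l, Q i (θ i)) ∧ (t : ℝ) ≤ (l.map G).sum := by
  induction l with
  | nil => simp [forList, pure_eq_done, Algo.Sure]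
  | cons i l ih =>
    rw [List.nodup_cons] at hl
    unfold forList
    refine Algo.sure_bind (h i List.mem_cons_self) fun v t hv => ?_
    refine Algo.sure_bind (ih hl.2 fun j hj => h j (List.mem_cons_of_mem i hj)) fun g s hg => ?_
    simp only [pure_eq_done, Algo.Sure]
    refine ⟨fun j hj => ?_, ?_⟩
    · rcases eq_or_ne j i with rfl | hji
      · rw [Function.update_self]; exact hv.1
      · rw [Function.update_of_ne hji]
        exact hg.1 j ((List.mem_cons.1 hj).resolve_left hji)
    · rw [List.map_cons, List.sum_cons]
      push_cast
      linarith [hv.2, hg.2]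

lemma sum_map_sort {γ : Type*} [AddCommMonoid γ] (S : Finset (Fin n)) (g : Fin n → γ) :
    ((S.sort (· ≤ ·)).map g).sum = ∑ i ∈ S, g i := by
  rw [← Multiset.sum_coe, ← Multiset.map_coe, Finset.sort_eq]; rfl

variable {S : Finset (Fin n)}

lemma expect_forEach_sum_le {φ : Fin n → ℝ → ℝ≥0∞} {c : Fin n → ℝ≥0∞}
    (h : ∀ i ∈ S, (f i).expect ν (fun v _ => φ i v) ≤ c i) :
    (forEach S f).expect ν (fun θ _ => ∑ i ∈ S, φ i (θ i)) ≤ ∑ i ∈ S, c i := by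
  have := expect_forList_sum_le (ν := ν) (S.sort_nodup (· ≤ ·)) fun i hi =>
    h i ((Finset.mem_sort _).1 hi)
  simpa only [forEach, sum_map_sort] using this

lemma expect_forEach_count_le {G c : Fin n → ℝ≥0∞}
    (h : ∀ i ∈ S, (f i).expect ν (fun _ t => (t : ℝ≥0∞) - G i) ≤ c i) :
    (forEach S f).expect ν (fun _ t => (t : ℝ≥0∞) - ∑ i ∈ S, G i) ≤ ∑ i ∈ S, c i := by
  have := expect_forList_count_le (ν := ν) (l := S.sort (· ≤ ·)) fun i hi =>
    h i ((Finset.mem_sort _).1 hi)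
  simpa only [forEach, sum_map_sort] using this

lemma sure_forEach {Q : Fin n → ℝ → Prop} {G : Fin n → ℝ}
    (h : ∀ i ∈ S, (f i).Sure fun v t => Q i v ∧ (t : ℝ) ≤ G i) :
    (forEach S f).Sure fun θ t => (∀ i ∈ S, Q i (θ i)) ∧ (t : ℝ) ≤ ∑ i ∈ S, G i := by
  have := sure_forList (S.sort_nodup (· ≤ ·)) fun i hi => h i ((Finset.mem_sort _).1 hi)
  simpa only [forEach, sum_map_sort, Finset.mem_sort] using this

variable (hν : ∀ i, ∀ᵐ x ∂(ν i), x ∈ Set.Icc (0 : ℝ) 1)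

include hν

/-- Markov's inequality for the total excess over all arms; `δ` is not divided by the number of
arms. -/
lemma whp_forEach_meanEst_count (hS : S.Nonempty) {ε δ : ℝ} (hε0 : 0 < ε) (hε1 : ε < 1)
    (hδ0 : 0 < δ) (hδ1 : δ ≤ 1) :
    (forEach S fun i => meanEst i ε δ).WHP ν (δ / 1000)
      fun _ t => (t : ℝ) ≤ 2 * ∑ i ∈ S, meanCost ν ε δ i := by
  have hpos : ∀ i, 0 < meanCost ν ε δ i := meanCost_pos hε0 hδ0 hδ1
  have h := expect_forEach_count_le (S := S) fun i _ => expect_meanEst_le hν i hε0 hε1 hδ0 hδ1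
  rw [← ENNReal.ofReal_sum_of_nonneg fun i _ => (hpos i).le,
    ← ENNReal.ofReal_sum_of_nonneg fun i _ => mul_nonneg (hpos i).le (by linarith),
    ← Finset.sum_mul] at h
  refine Algo.whp_of_expect (Finset.sum_pos (fun i _ => hpos i) hS) h fun _ t ht => ?_
  have h0 : 0 ≤ ∑ i ∈ S, meanCost ν ε δ i := Finset.sum_nonneg fun i _ => (hpos i).le
  rw [← ENNReal.ofReal_natCast, ← ENNReal.ofReal_sub _ h0]
  exact ENNReal.ofReal_le_ofReal (by linarith)

open Classical in
lemma expect_forEach_meanEst_le {ε δ : ℝ} (hε0 : 0 < ε) (hε1 : ε < 1)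
    (hδ0 : 0 < δ) (hδ1 : δ ≤ 1) {B : Finset (Fin n)} (hB : B ⊆ S) :
    (forEach S fun i => meanEst i ε δ).expect ν
      (fun θ _ => ∑ i ∈ B, if |θ i - mean (ν i)| ≤ ε then 0 else 1) ≤
      ENNReal.ofReal (B.card * (3 / 4 * δ)) := by
  have h := expect_forEach_sum_le (S := S) (ν := ν) (f := fun i => meanEst i ε δ)
    (φ := fun i v => if i ∈ B then (if |v - mean (ν i)| ≤ ε then 0 else 1) else 0)
    (c := fun i => if i ∈ B then ENNReal.ofReal (3 / 4 * δ) else 0) fun i _ => by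
      split_ifs
      · exact whp_meanEst hν i hε0 hε1 hδ0 hδ1
      · exact Algo.expect_const_le _ 0
  simp only [← Finset.sum_filter, Finset.filter_mem_eq_inter, Finset.inter_eq_right.2 hB] at h
  rw [Finset.sum_const, nsmul_eq_mul] at h
  rwa [ENNReal.ofReal_mul (by positivity), ENNReal.ofReal_natCast]

end ForEach

/-! ### Median elimination -/

section Median

variable {B : Finset (Fin n)} {θ : Fin n → ℝ}

/-- `a` precedes `i`: it has a larger empirical mean, or the same one and a smaller index. -/
def Precedes (θ : Fin n → ℝ) (a i : Fin n) : Prop := θ i < θ a ∨ (θ a = θ i ∧ a < i)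

open Classical in
/-- The number of arms of `B` that precede `i`. -/
def medianRank (B : Finset (Fin n)) (θ : Fin n → ℝ) (i : Fin n) : ℕ :=
  (B.filter fun a => Precedes θ a i).card

lemma mem_medianElim {i : Fin n} :
    i ∈ medianElim B θ ↔ i ∈ B ∧ 2 * medianRank B θ i < B.card := by
  have key : ∀ s t : Finset (Fin n), (∀ a, a ∈ s ↔ a ∈ t) →
      (2 * s.card < B.card ↔ 2 * t.card < B.card) := fun s t h => by rw [Finset.ext h]
  rw [medianElim, medianRank, Finset.mem_filter]
  exact and_congr_right fun _ => key _ _ fun a => by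
    simp only [Finset.mem_filter]; rfl

lemma medianElim_subset : medianElim B θ ⊆ B := fun _ hi => (mem_medianElim.1 hi).1

lemma Precedes.trans {a b c : Fin n} (h1 : Precedes θ a b) (h2 : Precedes θ b c) :
    Precedes θ a c := by
  unfold Precedes at *
  grind

lemma Precedes.irrefl (a : Fin n) : ¬ Precedes θ a a := by simp [Precedes]

lemma Precedes.trichotomy {a b : Fin n} (h : a ≠ b) : Precedes θ a b ∨ Precedes θ b a := by
  unfold Precedes
  grind

lemma Precedes.medianRank_lt {a b : Fin n} (ha : a ∈ B) (h : Precedes θ a b) :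
    medianRank B θ a < medianRank B θ b := by
  classical
  refine Finset.card_lt_card (Finset.ssubset_iff_of_subset (fun c hc => ?_) |>.2 ⟨a, ?_, ?_⟩)
  · rw [Finset.mem_filter] at hc ⊢
    exact ⟨hc.1, hc.2.trans h⟩
  · exact Finset.mem_filter.2 ⟨ha, h⟩
  · exact fun hc => Precedes.irrefl a (Finset.mem_filter.1 hc).2

lemma medianRank_injOn : Set.InjOn (medianRank B θ) B := by
  intro a ha b hb h
  by_contra hab
  rcases Precedes.trichotomy (θ := θ) hab with h' | h'
  · exact (h'.medianRank_lt ha).ne h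
  · exact (h'.medianRank_lt hb).ne' h

lemma medianRank_lt_card {a : Fin n} (ha : a ∈ B) : medianRank B θ a < B.card := by
  classical
  exact Finset.card_lt_card (Finset.ssubset_iff_of_subset (Finset.filter_subset _ _) |>.2
    ⟨a, ha, fun hc => Precedes.irrefl a (Finset.mem_filter.1 hc).2⟩)

/-- `Precedes` is a strict total order, so `medianRank` maps `B` bijectively onto `0, …, |B| - 1`,
and the arms that stay are those of rank below `|B| / 2`. -/
lemma card_medianElim : (medianElim B θ).card = (B.card + 1) / 2 := by
  classical
  have himg : B.image (medianRank B θ) = Finset.range B.card := by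
    apply Finset.eq_of_subset_of_card_le
    · intro k hk
      obtain ⟨a, ha, rfl⟩ := Finset.mem_image.1 hk
      exact Finset.mem_range.2 (medianRank_lt_card ha)
    · rw [Finset.card_image_of_injOn medianRank_injOn, Finset.card_range]
  have h2 : (medianElim B θ).image (medianRank B θ) = Finset.range ((B.card + 1) / 2) := by
    ext k
    simp only [Finset.mem_image, mem_medianElim, Finset.mem_range]
    constructor
    · rintro ⟨a, ⟨-, ha⟩, rfl⟩; omega
    · intro hk
      obtain ⟨a, ha, rfl⟩ := Finset.mem_image.1
        (himg ▸ Finset.mem_range.2 (by omega) : k ∈ B.image (medianRank B θ))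
      exact ⟨a, ⟨ha, by omega⟩, rfl⟩
  rw [← Finset.card_range ((B.card + 1) / 2), ← h2, Finset.card_image_of_injOn
    (medianRank_injOn.mono (Finset.coe_subset.2 medianElim_subset))]

lemma le_of_mem_medianElim {i b : Fin n} (hi : i ∈ medianElim B θ) (hb : b ∈ B)
    (hb' : b ∉ medianElim B θ) : θ b ≤ θ i := by
  by_contra h
  have h1 : Precedes θ b i := Or.inl (not_le.1 h)
  have h2 := h1.medianRank_lt hb
  have h3 := (mem_medianElim.1 hi).2
  exact hb' (mem_medianElim.2 ⟨hb, by omega⟩)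

/-- Keeping at most two thirds of the arms shrinks the total weight, if the weights are
comparable up to an excess `x`. -/
lemma sum_weight_le {A : Finset (Fin n)} (hA : A ⊆ B) (hc : A.card ≤ 2 * (B.card - A.card))
    {w x : Fin n → ℝ} {q : ℝ} (hx : ∀ i ∈ B, 0 ≤ x i) (hq : 0 ≤ q)
    (h1 : ∀ i ∈ B, q ≤ 3 * w i + x i) (h2 : ∀ i ∈ B, w i ≤ 4 * q + x i) :
    25 * ∑ i ∈ A, w i ≤ ∑ i ∈ B, (24 * w i + 8 * x i) := by
  classical
  -- The chain is `∑_A w ≤ 4 q |A| + ∑_A x ≤ 8 q |B \ A| + ∑_A x ≤ 24 ∑_(B \ A) w + 8 ∑_B x`; adding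
  -- `24 ∑_A w` to both ends gives the claim.
  have e1 : ∑ i ∈ A, w i ≤ A.card * (4 * q) + ∑ i ∈ A, x i := by
    rw [← nsmul_eq_mul, ← Finset.sum_const, ← Finset.sum_add_distrib]
    exact Finset.sum_le_sum fun i hi => h2 i (hA hi)
  have e2 : ((B \ A).card : ℝ) * q ≤ 3 * ∑ i ∈ B \ A, w i + ∑ i ∈ B \ A, x i := by
    rw [← nsmul_eq_mul, ← Finset.sum_const, Finset.mul_sum, ← Finset.sum_add_distrib]
    exact Finset.sum_le_sum fun i hi => h1 i (Finset.sdiff_subset hi)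
  have e3 : (A.card : ℝ) ≤ 2 * (B \ A).card := by
    rw [Finset.card_sdiff_of_subset hA]; exact_mod_cast hc
  have e4 := Finset.sum_sdiff (f := w) hA
  have e5 := Finset.sum_sdiff (f := x) hA
  have e6 : 0 ≤ ∑ i ∈ A, x i := Finset.sum_nonneg fun i hi => hx i (hA hi)
  have e7 := mul_le_mul_of_nonneg_right e3 hq
  rw [Finset.sum_add_distrib, ← Finset.mul_sum, ← Finset.mul_sum]
  linarith

end Median

section Bucket

variable {ν : Fin n → Measure ℝ} [∀ i, IsProbabilityMeasure (ν i)]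
  (hν : ∀ i, ∀ᵐ x ∂(ν i), x ∈ Set.Icc (0 : ℝ) 1)

include hν

/-- If `b` is estimated well but discarded, every kept arm has an empirical mean at least that of
`b`. Were all kept arms worse than `b` by more than `ε`, all of them would be misestimated, i.e. at
least half of `B`, which is unlikely by Markov's inequality. -/
lemma whp_medianElim (b : Fin n) {B : Finset (Fin n)} (hB : B.Nonempty) {ε δ : ℝ} (hε0 : 0 < ε)
    (hε1 : ε < 1) (hδ0 : 0 < δ) (hδ1 : δ ≤ 1) :
    (forEach B fun i => meanEst i (ε / 2) δ).WHP ν (9 / 2 * δ) fun θ t =>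
      (b ∈ B → ∃ i ∈ medianElim B θ, mean (ν b) - ε ≤ mean (ν i)) ∧
        (t : ℝ) ≤ 2 * ∑ i ∈ B, meanCost ν (ε / 2) δ i := by
  classical
  have hcost := whp_forEach_meanEst_count hν hB (ε := ε / 2) (by linarith) (by linarith) hδ0 hδ1
  by_cases hb : b ∈ B
  swap
  · exact hcost.mono (by linarith) fun θ t h => ⟨fun h' => absurd h' hb, h⟩
  have hcard : 0 < (B.card : ℝ) := by exact_mod_cast hB.card_pos
  have h1 : (forEach B fun i => meanEst i (ε / 2) δ).WHP ν (3 / 2 * δ) fun θ _ =>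
      2 * (B.filter fun i => ¬ |θ i - mean (ν i)| ≤ ε / 2).card < B.card := by
    refine Algo.whp_of_expect (c := B.card / 2) (by positivity)
      ((expect_forEach_meanEst_le hν (by linarith) (by linarith) hδ0 hδ1 subset_rfl).trans
        (ENNReal.ofReal_le_ofReal (le_of_eq (by ring)))) fun θ _ h => ?_
    have : ∑ i ∈ B, (if |θ i - mean (ν i)| ≤ ε / 2 then (0 : ℝ≥0∞) else 1) =
        ((B.filter fun i => ¬ |θ i - mean (ν i)| ≤ ε / 2).card : ℝ≥0∞) := by
      rw [Finset.card_filter]; push_cast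
      exact Finset.sum_congr rfl fun i _ => by split_ifs <;> simp_all
    rw [this, ← ENNReal.ofReal_natCast]
    apply ENNReal.ofReal_le_ofReal
    rw [not_lt] at h
    have : (B.card : ℝ) ≤ 2 * ((B.filter fun i => ¬ |θ i - mean (ν i)| ≤ ε / 2).card : ℝ) := by
      exact_mod_cast h
    linarith
  have h2 : (forEach B fun i => meanEst i (ε / 2) δ).WHP ν (3 / 4 * δ) fun θ _ =>
      |θ b - mean (ν b)| ≤ ε / 2 := by
    refine Algo.whp_of_expect (c := 1) one_pos
      ((expect_forEach_meanEst_le hν (by linarith) (by linarith) hδ0 hδ1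
        (Finset.singleton_subset_iff.2 hb)).trans
        (ENNReal.ofReal_le_ofReal (le_of_eq (by simp)))) fun θ _ h => ?_
    simp [h]
  refine (((h1.and (by positivity) (by positivity) h2).and (by positivity) (by positivity)
    hcost)).mono (by linarith) ?_
  rintro θ t ⟨⟨hF, hgood⟩, ht⟩
  refine ⟨fun _ => ?_, ht⟩
  by_cases hbk : b ∈ medianElim B θ
  · exact ⟨b, hbk, by linarith⟩
  by_contra hcon
  push Not at hcon
  have hsub : medianElim B θ ⊆ B.filter fun i => ¬ |θ i - mean (ν i)| ≤ ε / 2 := by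
    intro i hi
    refine Finset.mem_filter.2 ⟨medianElim_subset hi, fun habs => ?_⟩
    have h3 := le_of_mem_medianElim hi hb hbk
    have h4 := hcon i hi
    rw [abs_le] at habs hgood
    linarith [habs.2, hgood.1]
  have := Finset.card_le_card hsub
  rw [card_medianElim] at this
  omega

end Bucket

/-! ### Grouped median elimination -/

/-- The excess of a variance estimate `v`, measured against the weight `σ² + e` of arm `i`. -/
def excess (ν : Fin n → Measure ℝ) (e : ℝ) (i : Fin n) (v : ℝ) : ℝ :=
  max (v + e - 3 * (variance id (ν i) + e)) 0 + max (variance id (ν i) + e - 4 * (v + e)) 0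

lemma excess_nonneg (ν : Fin n → Measure ℝ) (e : ℝ) (i : Fin n) (v : ℝ) : 0 ≤ excess ν e i v :=
  add_nonneg (le_max_right _ _) (le_max_right _ _)

lemma le_three_mul_add_excess (ν : Fin n → Measure ℝ) (e : ℝ) (i : Fin n) (v : ℝ) :
    v + e ≤ 3 * (variance id (ν i) + e) + excess ν e i v := by
  unfold excess
  linarith [le_max_left (v + e - 3 * (variance id (ν i) + e)) 0,
    le_max_right (variance id (ν i) + e - 4 * (v + e)) 0]

lemma le_four_mul_add_excess (ν : Fin n → Measure ℝ) (e : ℝ) (i : Fin n) (v : ℝ) :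
    variance id (ν i) + e ≤ 4 * (v + e) + excess ν e i v := by
  unfold excess
  linarith [le_max_right (v + e - 3 * (variance id (ν i) + e)) 0,
    le_max_left (variance id (ν i) + e - 4 * (v + e)) 0]

lemma bucket_subset (S : Finset (Fin n)) (v : Fin n → ℝ) (j : ℕ) : bucket S v j ⊆ S :=
  Finset.filter_subset _ _

lemma eq_of_mem_bucket {S : Finset (Fin n)} {v : Fin n → ℝ} {j : ℕ} {i : Fin n}
    (hi : i ∈ bucket S v j) {s : ℕ} (hs : v i = 1 / 2 ^ s) : v i = 2 / 2 ^ j := by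
  classical
  obtain ⟨-, h1, h2⟩ := Finset.mem_filter.1 hi
  rw [hs] at h1 h2 ⊢
  have h1' : s < j := by
    rw [one_div_lt_one_div (by positivity) (by positivity)] at h1
    exact (pow_lt_pow_iff_right₀ one_lt_two).1 h1
  have h2' : j ≤ s + 1 := by
    rw [div_le_div_iff₀ (by positivity) (by positivity), one_mul, mul_comm, ← pow_succ] at h2
    exact (pow_le_pow_iff_right₀ one_lt_two).1 h2
  obtain rfl : j = s + 1 := by omega
  rw [pow_succ]; field_simp

lemma mem_bucket_of_eq {S : Finset (Fin n)} {v : Fin n → ℝ} {i : Fin n} (hi : i ∈ S) {s : ℕ}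
    (hs : v i = 1 / 2 ^ s) {ε : ℝ} (hε0 : 0 < ε) (hvε : ε < 2 * v i) :
    s < ⌈Real.logb 2 (2 / ε)⌉₊ ∧ i ∈ bucket S v (s + 1) := by
  classical
  have h2s : (0 : ℝ) < 2 ^ s := by positivity
  refine ⟨Nat.lt_ceil.2 ?_, Finset.mem_filter.2 ⟨hi, ?_, ?_⟩⟩
  · rw [Real.lt_logb_iff_rpow_lt one_lt_two (by positivity), Real.rpow_natCast, lt_div_iff₀ hε0]
    rw [hs, mul_one_div, lt_div_iff₀ h2s] at hvε
    linarith
  · rw [hs]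
    exact one_div_lt_one_div_of_lt (by positivity)
      (pow_lt_pow_right₀ one_lt_two (Nat.lt_succ_self s))
  · rw [hs, pow_succ]
    exact le_of_eq (by field_simp)

lemma sum_bucket_le (S : Finset (Fin n)) (v : Fin n → ℝ) {y : Fin n → ℝ} (hy : ∀ i, 0 ≤ y i)
    (N : ℕ) : ∑ k ∈ Finset.range N, ∑ i ∈ bucket S v (k + 1), y i ≤ ∑ i ∈ S, y i := by
  classical
  rw [← Finset.sum_biUnion]
  · exact Finset.sum_le_sum_of_subset_of_nonneg
      (Finset.biUnion_subset.2 fun k _ => bucket_subset S v _) fun i _ _ => hy i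
  · have key : ∀ k l : ℕ, k < l → Disjoint (bucket S v (k + 1)) (bucket S v (l + 1)) := by
      intro k l hkl
      refine Finset.disjoint_left.2 fun i hi hi' => ?_
      obtain ⟨-, h1, -⟩ := Finset.mem_filter.1 hi
      obtain ⟨-, -, h2⟩ := Finset.mem_filter.1 hi'
      have h3 : (2 : ℝ) / 2 ^ (l + 1) = 1 / 2 ^ l := by rw [pow_succ]; field_simp
      have h4 : (1 : ℝ) / 2 ^ l ≤ 1 / 2 ^ (k + 1) :=
        one_div_le_one_div_of_le (by positivity) (pow_le_pow_right₀ one_le_two hkl)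
      linarith
    intro k _ l _ hkl
    rcases lt_or_gt_of_ne hkl with h | h
    · exact key k l h
    · exact (key l k h).symm

section Group

variable {ν : Fin n → Measure ℝ} [∀ i, IsProbabilityMeasure (ν i)]
  (hν : ∀ i, ∀ᵐ x ∂(ν i), x ∈ Set.Icc (0 : ℝ) 1)

include hν

lemma whp_groupLoop (b : Fin n) (S : Finset (Fin n)) {ε δ e : ℝ} (hε0 : 0 < ε) (hε1 : ε < 1)
    (hδ0 : 0 < δ) (hδ1 : δ ≤ 1) (he : 0 ≤ e) {N : ℕ} (hN : 1 ≤ N) {v : Fin n → ℝ}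
    (hv : ∀ i ∈ S, ∃ s : ℕ, v i = 1 / 2 ^ s) (j : ℕ) :
    (groupLoop S ε δ N v j).WHP ν (j * (δ / (2 * N))) fun p t =>
      (p.1 ⊆ S ∧ p.2 ⊆ S) ∧
      (∀ k < j, b ∈ bucket S v (k + 1) → ∃ i ∈ p.1 ∪ p.2, mean (ν b) - ε ≤ mean (ν i)) ∧
      (3 * (p.1.card : ℝ) ≤ ∑ k ∈ Finset.range j, ∑ _i ∈ bucket S v (k + 1), 2) ∧
      p.2.card ≤ j ∧
      25 * ∑ i ∈ p.1, (variance id (ν i) + e) ≤ ∑ k ∈ Finset.range j, ∑ i ∈ bucket S v (k + 1),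
        (24 * (variance id (ν i) + e) + 8 * excess ν e i (v i)) ∧
      (t : ℝ) ≤ ∑ k ∈ Finset.range j, ∑ i ∈ bucket S v (k + 1),
        2 * meanCost ν (ε / 2) (δ / (9 * N)) i := by
  classical
  have hN' : (1 : ℝ) ≤ N := by exact_mod_cast hN
  have hw : ∀ i, 0 ≤ variance id (ν i) + e := fun i => add_nonneg (variance_nonneg _ _) he
  have hδN0 : 0 < δ / (9 * N) := by positivity
  have hδN1 : δ / (9 * N) ≤ 1 := by rw [div_le_one (by positivity)]; linarith
  have hcost : ∀ i, 0 ≤ meanCost ν (ε / 2) (δ / (9 * N)) i := fun i =>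
    (meanCost_pos (by linarith) hδN0 hδN1 i).le
  induction j with
  | zero =>
    refine (Algo.Sure.whp ?_).mono (by simp) fun _ _ h => h
    simp [groupLoop, pure_eq_done, Algo.Sure]
  | succ j ih =>
    unfold groupLoop
    refine (Algo.WHP.bind (q := δ / (2 * N)) (by positivity) (by positivity) ih ?_).mono
      (by push_cast; linarith) fun _ _ h => h
    rintro ⟨P, R⟩ t ⟨⟨hPS, hRS⟩, hbest, hcard, hR, hW, ht⟩
    dsimp only at hPS hRS hbest hcard hR hW ht ⊢
    set B := bucket S v (j + 1) with hBdef
    have hBS : B ⊆ S := bucket_subset S v _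
    split_ifs with hB
    · have hBne : B.Nonempty := Finset.card_pos.1 (by omega)
      have hmed := whp_medianElim hν b hBne hε0 hε1 hδN0 hδN1
      -- The level `δ / (9N)` of `MeanEst` gives failure `9/2 · δ / (9N) = δ / (2N)` per bucket.
      refine (Algo.WHP.bind (q := 0) (by positivity) le_rfl hmed ?_).mono
        (le_of_eq (by field_simp; norm_num)) fun _ _ h => h
      rintro θ u ⟨hθ, hu⟩
      refine Algo.Sure.whp ?_
      simp only [pure_eq_done, Algo.Sure]
      have hAc := card_medianElim (B := B) (θ := θ)
      refine ⟨⟨Finset.union_subset hPS (medianElim_subset.trans hBS), hRS⟩, ?_, ?_, by omega, ?_, ?_⟩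
      · intro k hk hbk
        rcases Nat.lt_succ_iff_lt_or_eq.1 hk with hk | rfl
        · obtain ⟨i, hi, hi'⟩ := hbest k hk hbk
          exact ⟨i, by simp only [Finset.mem_union] at hi ⊢; tauto, hi'⟩
        · obtain ⟨i, hi, hi'⟩ := hθ hbk
          exact ⟨i, by simp only [Finset.mem_union]; tauto, hi'⟩
      · rw [Finset.sum_range_succ, ← hBdef, Finset.sum_const, nsmul_eq_mul]
        have h1 : ((P ∪ medianElim B θ).card : ℝ) ≤ P.card + (medianElim B θ).card := by
          exact_mod_cast Finset.card_union_le _ _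
        have h2 : (3 * (medianElim B θ).card : ℝ) ≤ B.card * 2 := by
          rw [hAc]; exact_mod_cast (by omega : 3 * ((B.card + 1) / 2) ≤ B.card * 2)
        linarith
      · rw [Finset.sum_range_succ, ← hBdef]
        have h1 : ∑ i ∈ P ∪ medianElim B θ, (variance id (ν i) + e) ≤
            ∑ i ∈ P, (variance id (ν i) + e) + ∑ i ∈ medianElim B θ, (variance id (ν i) + e) := by
          rw [← Finset.sum_union_inter]
          exact le_add_of_nonneg_right (Finset.sum_nonneg fun i _ => hw i)
        have hvB : ∀ i ∈ B, v i = 2 / 2 ^ (j + 1) := fun i hi => by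
          obtain ⟨s, hs⟩ := hv i (hBS hi)
          exact eq_of_mem_bucket hi hs
        -- Estimates being powers of `1/2`, the whole bucket has the same one, so a single `q` is
        -- comparable with all the weights. A bucket of at least two arms loses enough of them for
        -- the cardinality hypothesis.
        have h2 := sum_weight_le (B := B) (A := medianElim B θ)
          (w := fun i => variance id (ν i) + e) (x := fun i => excess ν e i (v i))
          (q := 2 / 2 ^ (j + 1) + e) medianElim_subset (by omega)
          (fun i _ => excess_nonneg _ _ _ _) (by positivity)
          (fun i hi => by rw [← hvB i hi]; exact le_three_mul_add_excess _ _ _ _)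
          (fun i hi => by rw [← hvB i hi]; exact le_four_mul_add_excess _ _ _ _)
        linarith
      · rw [Finset.sum_range_succ, ← hBdef, ← Finset.mul_sum]
        push_cast
        linarith
    · refine (Algo.Sure.whp ?_).mono (q := δ / (2 * N)) (by positivity) fun _ _ h => h
      simp only [pure_eq_done, Algo.Sure, zero_add]
      refine ⟨⟨hPS, Finset.union_subset hRS hBS⟩, ?_, ?_, ?_, ?_, ?_⟩
      · intro k hk hbk
        rcases Nat.lt_succ_iff_lt_or_eq.1 hk with hk | rfl
        · obtain ⟨i, hi, hi'⟩ := hbest k hk hbk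
          exact ⟨i, by simp only [Finset.mem_union] at hi ⊢; tauto, hi'⟩
        · exact ⟨b, by simp only [Finset.mem_union]; tauto, by linarith⟩
      · rw [Finset.sum_range_succ, ← hBdef, Finset.sum_const, nsmul_eq_mul]
        have : (0 : ℝ) ≤ B.card * 2 := by positivity
        linarith
      · have := Finset.card_union_le R B
        omega
      · rw [Finset.sum_range_succ, ← hBdef]
        have : 0 ≤ ∑ i ∈ B, (24 * (variance id (ν i) + e) + 8 * excess ν e i (v i)) :=
          Finset.sum_nonneg fun i _ => by
            linarith [hw i, excess_nonneg ν e i (v i)]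
        linarith
      · rw [Finset.sum_range_succ, ← hBdef]
        have : 0 ≤ ∑ i ∈ B, 2 * meanCost ν (ε / 2) (δ / (9 * N)) i :=
          Finset.sum_nonneg fun i _ => by linarith [hcost i]
        linarith

/-- The first part of `excess` is nonzero only for `v > 2 (σ² + ε)` and is at most `v`; the second
is nonzero only for `σ² > 4 v` and is at most `σ² + e`. Each expectation is at most `(σ² + e) δ /
1000`. -/
lemma expect_excess_le (i : Fin n) {ε δ e : ℝ} (hε0 : 0 < ε) (hε1 : ε < 1)
    (hδ0 : 0 < δ) (hδ1 : δ ≤ 1) (he : ε ≤ e) :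
    (varEst i δ ε).expect ν (fun v _ => ENNReal.ofReal (excess ν e i v)) ≤
      ENNReal.ofReal ((variance id (ν i) + e) * (δ / 500)) := by
  classical
  have hσ := variance_nonneg id (ν i)
  set M := variance id (ν i) + ε with hM
  have hMw : M ≤ variance id (ν i) + e := by linarith
  set w := variance id (ν i) + e with hw
  have hw0 : 0 < w := by linarith
  have h1 := expect_varEst_le hν i hδ0 hδ1 hε0 hε1 (M := M) (by linarith) (by linarith)
  have h2 := whp_varEst hν i (ℓ := ε) hδ0 hδ1
  unfold Algo.WHP at h2
  refine (Algo.expect_mono_of_sure (sure_varEst i hδ0 hδ1 hε0 hε1)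
    (g := fun v _ => (if 2 * M < v then ENNReal.ofReal v else 0) +
      ENNReal.ofReal w * (if variance id (ν i) ≤ 4 * v then 0 else 1)) ?_).trans
    ((Algo.expect_add_le _ _ _).trans (le_trans (add_le_add h1
      ((Algo.expect_const_mul_le _ ENNReal.ofReal_ne_top _).trans (mul_le_mul_right h2 _))) ?_))
  · rintro v t ⟨-, hv, -⟩
    unfold excess
    refine ENNReal.ofReal_add_le.trans (add_le_add ?_ ?_)
    · split_ifs with h
      · exact ENNReal.ofReal_le_ofReal (max_le (by linarith) (by linarith))
      · rw [max_eq_right (by linarith)]; simp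
    · split_ifs with h
      · rw [max_eq_right (by linarith)]; simp
      · rw [mul_one]
        exact ENNReal.ofReal_le_ofReal (max_le (by linarith) hw0.le)
  · rw [← ENNReal.ofReal_mul hw0.le, ← ENNReal.ofReal_add (by positivity) (by positivity)]
    apply ENNReal.ofReal_le_ofReal
    have := mul_le_mul_of_nonneg_right hMw (by positivity : 0 ≤ δ / 1000)
    linarith

/-- `GroupElim` keeps an arm which is almost as good as `b`, and shrinks the active set. -/
lemma whp_groupElim (b : Fin n) {S : Finset (Fin n)} (hb : b ∈ S) {ε δ e : ℝ} (hε0 : 0 < ε)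
    (hε1 : ε < 1) (hδ0 : 0 < δ) (hδ1 : δ ≤ 1) (he : ε ≤ e) :
    (groupElim S ε δ).WHP ν δ fun p t =>
      (p.1 ⊆ S ∧ p.2 ⊆ S) ∧ (∃ i ∈ p.1 ∪ p.2, mean (ν b) - ε ≤ mean (ν i)) ∧
      3 * p.1.card ≤ 2 * S.card ∧ p.2.card ≤ ⌈Real.logb 2 (2 / ε)⌉₊ ∧
      ∑ i ∈ p.1, (variance id (ν i) + e) ≤ 255 / 256 * ∑ i ∈ S, (variance id (ν i) + e) ∧
      (t : ℝ) ≤ 12000 * Real.log (36 * (⌈Real.logb 2 (2 / ε)⌉₊ : ℝ) ^ 2 / δ) *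
        ((∑ i ∈ S, (variance id (ν i) + e)) / ε ^ 2) := by
  classical
  have he0 : 0 < e := hε0.trans_le he
  unfold groupElim
  set N : ℕ := ⌈Real.logb 2 (2 / ε)⌉₊ with hNdef
  have hN : 1 ≤ N := by
    rw [hNdef, Nat.one_le_ceil_iff]
    exact Real.logb_pos one_lt_two (by rw [lt_div_iff₀ hε0]; linarith)
  have hN' : (1 : ℝ) ≤ N := by exact_mod_cast hN
  have hN2 : (1 : ℝ) ≤ (N : ℝ) ^ 2 := one_le_pow₀ hN'
  have hNN2 : (N : ℝ) ≤ (N : ℝ) ^ 2 := by nlinarith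
  have hw : ∀ i, 0 < variance id (ν i) + e := fun i =>
    add_pos_of_nonneg_of_pos (variance_nonneg _ _) he0
  set W := ∑ i ∈ S, (variance id (ν i) + e) with hWdef
  have hW0 : 0 < W := Finset.sum_pos (fun i _ => hw i) ⟨b, hb⟩
  set δ' := δ / (2 * (N : ℝ) ^ 2) with hδ'
  have hδ'0 : 0 < δ' := by positivity
  have hδ'δ : δ' ≤ δ := div_le_self hδ0.le (by linarith)
  set L := Real.log (1 / (δ' / Real.exp 1)) with hLdef
  have hsure : (forEach S fun i => varEst i δ' ε).Sure fun v t =>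
      (∀ i ∈ S, (∃ s : ℕ, 1 ≤ s ∧ v i = 1 / 2 ^ s) ∧ ε < 2 * v i) ∧
        (t : ℝ) ≤ ∑ i ∈ S, 648 * L / ε :=
    sure_forEach (Q := fun _ v => (∃ s : ℕ, 1 ≤ s ∧ v = 1 / 2 ^ s) ∧ ε < 2 * v)
      fun i _ => (sure_varEst i hδ'0 (hδ'δ.trans hδ1) hε0 hε1).mono
        fun v t h => ⟨⟨h.1, h.2.1⟩, h.2.2⟩
  have hX : (forEach S fun i => varEst i δ' ε).WHP ν (δ / 2) fun v _ =>
      ∑ i ∈ S, excess ν e i (v i) ≤ W / 16 := by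
    have h1 := expect_forEach_sum_le (S := S) fun i _ =>
      expect_excess_le hν i hε0 hε1 hδ'0 (hδ'δ.trans hδ1) he
    rw [← ENNReal.ofReal_sum_of_nonneg fun i _ => mul_nonneg (hw i).le (by positivity),
      ← Finset.sum_mul, ← hWdef] at h1
    -- Total expected excess `W δ' / 500` against the tolerance `W / 16`.
    refine (Algo.whp_of_expect (c := W / 16) (p := δ' * (16 / 500)) (by positivity)
      (h1.trans (ENNReal.ofReal_le_ofReal (le_of_eq (by ring)))) fun v _ h => ?_).mono
      (by linarith) fun _ _ h => h
    rw [← ENNReal.ofReal_sum_of_nonneg fun i _ => excess_nonneg _ _ _ _]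
    exact ENNReal.ofReal_le_ofReal (not_le.1 h).le
  have hstep1 := hX.mono_of_sure (q := δ / 2) hsure le_rfl
    (R := fun v t => ((∀ i ∈ S, (∃ s : ℕ, 1 ≤ s ∧ v i = 1 / 2 ^ s) ∧ ε < 2 * v i) ∧
        (t : ℝ) ≤ ∑ i ∈ S, 648 * L / ε) ∧ ∑ i ∈ S, excess ν e i (v i) ≤ W / 16)
    fun v t h1 h2 => ⟨h1, h2⟩
  refine (Algo.WHP.bind (q := δ / 2) (by positivity) (by positivity) hstep1 ?_).mono
    (by linarith) fun _ _ h => h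
  rintro v t ⟨⟨hv, ht⟩, hXv⟩
  have hloop := whp_groupLoop hν b S hε0 hε1 hδ0 hδ1 he0.le hN
    (fun i hi => (hv i hi).1.imp fun s hs => hs.2) N
  refine hloop.mono (le_of_eq (by field_simp)) ?_
  rintro ⟨P, R⟩ u ⟨hsub, hbest, hcard, hR, hWP, hu⟩
  dsimp only at *
  refine ⟨hsub, ?_, ?_, hR, ?_, ?_⟩
  · obtain ⟨⟨s, hs1, hs⟩, hvε⟩ := hv b hb
    obtain ⟨hsN, hs'⟩ := mem_bucket_of_eq hb hs hε0 hvε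
    exact hbest s hsN hs'
  · have h1 := hcard.trans (sum_bucket_le S v (y := fun _ => 2) (fun _ => zero_le_two) N)
    rw [Finset.sum_const, nsmul_eq_mul, mul_comm (S.card : ℝ)] at h1
    exact_mod_cast h1
  · have h1 := hWP.trans (sum_bucket_le S v (fun i => by
      linarith [hw i, excess_nonneg ν e i (v i)]) N)
    have h2 : ∑ i ∈ S, (24 * (variance id (ν i) + e) + 8 * excess ν e i (v i)) =
        24 * W + 8 * ∑ i ∈ S, excess ν e i (v i) := by
      rw [Finset.sum_add_distrib, ← Finset.mul_sum, ← Finset.mul_sum]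
    linarith
  · have hδN0 : 0 < δ / (9 * N) := by positivity
    have hδN1 : δ / (9 * N) ≤ 1 := by rw [div_le_one (by positivity)]; linarith
    have h1 := hu.trans (sum_bucket_le S v (fun i => by
      linarith [meanCost_pos (ν := ν) (ε := ε / 2) (by linarith) hδN0 hδN1 i]) N)
    -- The argument dominates both `2 e N² / δ` from the variance tests and `36 N / δ` from the mean
    -- estimates.
    set Λ := Real.log (36 * (N : ℝ) ^ 2 / δ) with hΛ
    have hΛL : L ≤ Λ := by
      apply Real.log_le_log (by positivity)
      rw [hδ', one_div_div, div_div_eq_mul_div]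
      refine div_le_div_of_nonneg_right ?_ hδ0.le
      nlinarith [Real.exp_one_lt_d9]
    have hΛ4 : Real.log (4 / (δ / (9 * N))) ≤ Λ := by
      apply Real.log_le_log (by positivity)
      rw [div_div_eq_mul_div]
      refine div_le_div_of_nonneg_right ?_ hδ0.le
      linarith
    have hΛ1 : 1 ≤ Λ := (one_le_log_four_div hδN0 hδN1).trans hΛ4
    have h2 : ∑ i ∈ S, 2 * meanCost ν (ε / 2) (δ / (9 * N)) i ≤ 10560 * Λ * (W / ε ^ 2) := by
      rw [hWdef, Finset.sum_div, Finset.mul_sum]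
      refine Finset.sum_le_sum fun i _ => ?_
      unfold meanCost
      have hσ := variance_nonneg id (ν i)
      have h3 : (variance id (ν i) + ε / 2) / (ε / 2) ^ 2 ≤ 4 * ((variance id (ν i) + e) / ε ^ 2) := by
        rw [← mul_div_assoc, div_le_div_iff₀ (by positivity) (by positivity)]
        nlinarith [sq_nonneg ε, mul_nonneg (sq_nonneg ε) hσ,
          mul_nonneg (sq_nonneg ε) (by linarith : 0 ≤ e - ε / 2)]
      have h5 : 0 ≤ (variance id (ν i) + ε / 2) / (ε / 2) ^ 2 := by positivity
      have h4 := mul_le_mul hΛ4 h3 h5 (by linarith)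
      linarith
    have h3 : ∑ i ∈ S, 648 * L / ε ≤ 648 * Λ * (W / ε ^ 2) := by
      rw [hWdef, Finset.sum_div, Finset.mul_sum]
      refine Finset.sum_le_sum fun i _ => ?_
      have h4 : 1 / ε ≤ (variance id (ν i) + e) / ε ^ 2 := by
        have hσ := variance_nonneg id (ν i)
        rw [div_le_div_iff₀ hε0 (by positivity)]
        nlinarith
      have h5 : L * (1 / ε) ≤ Λ * ((variance id (ν i) + e) / ε ^ 2) :=
        mul_le_mul hΛL h4 (by positivity) (by linarith)
      calc 648 * L / ε = 648 * (L * (1 / ε)) := by ring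
        _ ≤ 648 * (Λ * ((variance id (ν i) + e) / ε ^ 2)) := by linarith
        _ = _ := by ring
    have h6 : 0 ≤ Λ * (W / ε ^ 2) := by positivity
    push_cast
    nlinarith

end Group

/-! ### Iterative elimination -/

/-- Dividing the weight factor `255/256` of one round by the factor `β²` of the squared accuracy
leaves `e^(-0.002) < 1`, the decay rate of the cost. -/
lemma beta_sq : beta ^ 2 = 255 / 256 * Real.exp 0.002 := by
  rw [beta, mul_pow, div_pow, Real.sq_sqrt (by norm_num), ← Real.exp_nat_mul]
  norm_num

lemma beta_pos : 0 < beta := by unfold beta; positivity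

lemma beta_lt_one : beta < 1 := by
  have h1 : Real.exp 0.002 * Real.exp (-0.002) = 1 := by rw [← Real.exp_add]; norm_num
  have h2 : (0.998 : ℝ) ≤ Real.exp (-0.002) := by
    linarith [Real.add_one_le_exp (-0.002 : ℝ)]
  have h3 : beta ^ 2 < 1 := by
    rw [beta_sq]
    nlinarith [Real.exp_pos 0.002]
  nlinarith [beta_pos]

lemma half_le_beta : 1 / 2 ≤ beta := by
  have h3 : (1 / 2) ^ 2 ≤ beta ^ 2 := by
    rw [beta_sq]
    linarith [Real.add_one_le_exp (0.002 : ℝ)]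
  exact le_of_sq_le_sq h3 beta_pos.le

/-- The number of buckets in round `r` grows only linearly in `r`, as the accuracy decreases
geometrically. -/
lemma exists_ceil_logb_le : ∃ c : ℝ, 1 ≤ c ∧ ∀ (ε : ℝ) (r : ℕ), 0 < ε → ε ≤ 1 →
    (⌈Real.logb 2 (2 / (beta ^ r * (1 - beta) * ε))⌉₊ : ℝ) ≤ c * (1 + r + Real.log (1 / ε)) := by
  have hβ1 : 0 < 1 - beta := sub_pos.2 beta_lt_one
  have hκ : 0 ≤ -Real.log (1 - beta) := by
    linarith [Real.log_nonpos hβ1.le (by linarith [beta_pos])]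
  refine ⟨3 + 2 * -Real.log (1 - beta), by linarith, fun ε r h0 h1 => ?_⟩
  have hβr := pow_pos beta_pos r
  have hβr1 : beta ^ r ≤ 1 := pow_le_one₀ beta_pos.le beta_lt_one.le
  have ha : 0 ≤ -Real.log ε := by linarith [Real.log_nonpos h0.le h1]
  have hlogβ : -Real.log beta ≤ 1 := by
    have := Real.log_le_log (by norm_num) half_le_beta
    rw [one_div, Real.log_inv] at this
    linarith [Real.log_two_lt_d9]
  have hx : Real.log (2 / (beta ^ r * (1 - beta) * ε)) =
      Real.log 2 + r * -Real.log beta + -Real.log (1 - beta) + -Real.log ε := by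
    rw [Real.log_div two_ne_zero (by positivity), Real.log_mul (by positivity) h0.ne',
      Real.log_mul hβr.ne' hβ1.ne', Real.log_pow]
    ring
  have hx1 : Real.log (2 / (beta ^ r * (1 - beta) * ε)) ≤
      1 + r + -Real.log (1 - beta) + -Real.log ε := by
    rw [hx]
    have : (r : ℝ) * -Real.log beta ≤ r * 1 := by gcongr
    linarith [Real.log_two_lt_d9]
  have hx0 : 0 ≤ Real.log (2 / (beta ^ r * (1 - beta) * ε)) := by
    apply Real.log_nonneg
    rw [le_div_iff₀ (by positivity)]
    have := mul_le_one₀ hβr1 hβ1.le (by linarith [beta_pos])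
    have := mul_le_one₀ this h0.le h1
    linarith
  have hlb : Real.logb 2 (2 / (beta ^ r * (1 - beta) * ε)) ≤
      2 * Real.log (2 / (beta ^ r * (1 - beta) * ε)) := by
    rw [Real.logb, div_le_iff₀ (Real.log_pos one_lt_two)]
    nlinarith [Real.log_two_gt_d9]
  have hlb0 : 0 ≤ Real.logb 2 (2 / (beta ^ r * (1 - beta) * ε)) :=
    div_nonneg hx0 (Real.log_pos one_lt_two).le
  have := Nat.ceil_lt_add_one hlb0
  rw [one_div, Real.log_inv]
  have hr : (0 : ℝ) ≤ r := Nat.cast_nonneg r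
  nlinarith [mul_nonneg hκ ha, mul_nonneg hκ hr]

lemma one_le_log_exp_add {a : ℝ} (ha : 0 ≤ a) : 1 ≤ Real.log (Real.exp 1 + a) := by
  rw [Real.le_log_iff_exp_le (by positivity)]
  linarith

/-- The confidence of round `r` contributes `0.1 r`; the number of buckets is at most `c (1 + r)(e +
a)`, whose logarithm is at most `ln c + r + ln (e + a)`. The resulting factor `1 + r` is harmless
against the geometric decay. -/
lemma exists_log_le {c : ℝ} (hc : 1 ≤ c) : ∃ C : ℝ, 0 < C ∧
    ∀ (δ a N : ℝ) (r : ℕ), 0 < δ → δ ≤ 1 → 0 ≤ a → 0 ≤ N → N ≤ c * (1 + r + a) →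
    Real.log (36 * N ^ 2 / (Real.exp (-0.1 * (r : ℝ)) * (1 - Real.exp (-0.1)) * δ)) ≤
      C * (1 + r) * (Real.log (1 / δ) + Real.log (Real.exp 1 + a)) := by
  have hq : 0 < 1 - Real.exp (-0.1) := by
    rw [sub_pos, Real.exp_lt_one_iff]; norm_num
  have hq' : 0 ≤ -Real.log (1 - Real.exp (-0.1)) := by
    linarith [Real.log_nonpos hq.le (by linarith [Real.exp_pos (-0.1)])]
  have hlogc := Real.log_nonneg hc
  have h36 : 0 ≤ Real.log 36 := Real.log_nonneg (by norm_num)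
  refine ⟨Real.log 36 + 2 * Real.log c + 5 + -Real.log (1 - Real.exp (-0.1)), by linarith,
    fun δ a N r h0 h1 ha hN0 hN => ?_⟩
  have hδ : 0 ≤ -Real.log δ := by linarith [Real.log_nonpos h0.le h1]
  have hA := one_le_log_exp_add ha
  have hr : (0 : ℝ) ≤ r := Nat.cast_nonneg r
  set A := Real.log (Real.exp 1 + a) with hAdef
  rw [one_div, Real.log_inv]
  -- For `N = 0` the left side is `Real.log 0 = 0`.
  rcases hN0.eq_or_lt with rfl | hNpos
  · rw [zero_pow two_ne_zero, mul_zero, zero_div, Real.log_zero]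
    positivity
  have hlogN : Real.log N ≤ Real.log c + r + A := by
    have h2 : 1 + (r : ℝ) + a ≤ (1 + r) * (Real.exp 1 + a) := by
      nlinarith [Real.add_one_le_exp (1 : ℝ)]
    calc Real.log N ≤ Real.log (c * ((1 + r) * (Real.exp 1 + a))) := by
          apply Real.log_le_log hNpos
          exact hN.trans (mul_le_mul_of_nonneg_left h2 (by linarith))
      _ = Real.log c + (Real.log (1 + r) + A) := by
          rw [Real.log_mul (by positivity) (by positivity),
            Real.log_mul (by positivity) (by positivity)]
      _ ≤ _ := by
          have := Real.log_le_sub_one_of_pos (x := 1 + (r : ℝ)) (by positivity)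
          linarith
  have heq : Real.log (36 * N ^ 2 / (Real.exp (-0.1 * (r : ℝ)) * (1 - Real.exp (-0.1)) * δ)) =
      Real.log 36 + 2 * Real.log N + 0.1 * r + -Real.log (1 - Real.exp (-0.1)) + -Real.log δ := by
    rw [Real.log_div (by positivity) (by positivity), Real.log_mul (by positivity) (by positivity),
      Real.log_pow, Real.log_mul (by positivity) h0.ne', Real.log_mul (by positivity) hq.ne',
      Real.log_exp]
    push_cast
    ring
  rw [heq]
  set κ := Real.log 36 + 2 * Real.log c + -Real.log (1 - Real.exp (-0.1)) with hκ
  set D := -Real.log δ + A with hD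
  have hD1 : 1 ≤ D := by linarith
  have e1 : κ * 1 ≤ κ * ((1 + r) * D) :=
    mul_le_mul_of_nonneg_left (by nlinarith) (by linarith)
  have e2 : (1 + r) * 1 ≤ (1 + r) * D := mul_le_mul_of_nonneg_left hD1 (by linarith)
  have e3 : 0 ≤ r * D := by positivity
  nlinarith

/-- The sum that bounds the number of samples over all rounds. -/
lemma summable_round : Summable fun s : ℕ => (1 + (s : ℝ)) * Real.exp (-0.002) ^ s := by
  have h1 : ‖Real.exp (-0.002)‖ < 1 := by
    rw [Real.norm_eq_abs, Real.abs_exp, Real.exp_lt_one_iff]; norm_num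
  have h2 := summable_pow_mul_geometric_of_norm_lt_one 1 h1
  have h3 := summable_geometric_of_norm_lt_one h1
  refine (h3.add h2).congr fun s => ?_
  ring

section Iter

variable {ν : Fin n → Measure ℝ} [∀ i, IsProbabilityMeasure (ν i)]
  (hν : ∀ i, ∀ᵐ x ∂(ν i), x ∈ Set.Icc (0 : ℝ) 1)

include hν

/-- Here `m` and `W` stand for the initial number of arms and the initial weight. The remaining
budgets `β^r ε` and `e^(-0.1 r) δ` split exactly into the share of round `r` and the budget of round
`r + 1`. The inequality `3^r ≤ 2^r m` records that at most `log_(3/2) m` rounds take place, hence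
that few arms are recycled. -/
lemma whp_iterLoop {ε δ c C : ℝ} (hε0 : 0 < ε) (hε1 : ε ≤ 1) (hδ0 : 0 < δ) (hδ1 : δ ≤ 1)
    (hc : 1 ≤ c) (hC0 : 0 ≤ C) (hN : ∀ r : ℕ, (⌈Real.logb 2 (2 / (beta ^ r * (1 - beta) * ε))⌉₊ : ℝ) ≤
      c * (1 + r + Real.log (1 / ε)))
    (hC : ∀ (N : ℝ) (r : ℕ), 0 ≤ N → N ≤ c * (1 + r + Real.log (1 / ε)) →
      Real.log (36 * N ^ 2 / (Real.exp (-0.1 * (r : ℝ)) * (1 - Real.exp (-0.1)) * δ)) ≤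
      C * (1 + r) * (Real.log (1 / δ) + Real.log (Real.exp 1 + Real.log (1 / ε))))
    (W : ℝ) (hW0 : 0 ≤ W) (m fuel r : ℕ) (b : Fin n) (T R : Finset (Fin n)) (hb : b ∈ T ∪ R)
    (hfuel : T.card ≤ fuel) (hm : 3 ^ r ≤ 2 ^ r * m) (hT : 3 ^ r * T.card ≤ 2 ^ r * m)
    (hR : (R.card : ℝ) ≤ r * (c * (1 + r + Real.log (1 / ε))))
    (hW : ∑ i ∈ T, (variance id (ν i) + ε) ≤ (255 / 256) ^ r * W) :
    (iterLoop ε δ fuel r T R).WHP ν (Real.exp (-0.1 * (r : ℝ)) * δ) fun O t =>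
      O ⊆ T ∪ R ∧ (∃ i ∈ O, mean (ν b) - beta ^ r * ε ≤ mean (ν i)) ∧
      (∃ ρ : ℕ, 3 ^ ρ ≤ 2 ^ ρ * m ∧
        (O.card : ℝ) ≤ 10 + ρ * (c * (1 + ρ + Real.log (1 / ε)))) ∧
      (t : ℝ) ≤ 12000 * C * (Real.log (1 / δ) + Real.log (Real.exp 1 + Real.log (1 / ε))) *
        (W / ((1 - beta) ^ 2 * ε ^ 2)) *
        ∑ s ∈ Finset.range fuel, (1 + ((r + s : ℕ) : ℝ)) * Real.exp (-0.002) ^ (r + s) := by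
  classical
  have hβ1 : 0 < 1 - beta := sub_pos.2 beta_lt_one
  have hq : 0 < 1 - Real.exp (-0.1) := by
    rw [sub_pos, Real.exp_lt_one_iff]; norm_num
  have ha : 0 ≤ Real.log (1 / ε) := Real.log_nonneg (by rw [le_div_iff₀ hε0]; linarith)
  have hδlog : 0 ≤ Real.log (1 / δ) := Real.log_nonneg (by rw [le_div_iff₀ hδ0]; linarith)
  set a := Real.log (1 / ε) with hadef
  set A := Real.log (1 / δ) + Real.log (Real.exp 1 + a) with hAdef
  have hA1 : 1 ≤ A := by linarith [one_le_log_exp_add ha]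
  have hhalt : ∀ (r : ℕ) (b : Fin n) (T R : Finset (Fin n)) (fuel : ℕ), b ∈ T ∪ R →
      3 ^ r ≤ 2 ^ r * m → (R.card : ℝ) ≤ r * (c * (1 + r + a)) → T.card ≤ 10 →
      (0 : ℝ) ≤ 12000 * C * A * (W / ((1 - beta) ^ 2 * ε ^ 2)) *
        ∑ s ∈ Finset.range fuel, (1 + ((r + s : ℕ) : ℝ)) * Real.exp (-0.002) ^ (r + s) →
      (pure (T ∪ R) : Algo n (Finset (Fin n))).WHP ν (Real.exp (-0.1 * (r : ℝ)) * δ) fun O t =>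
      O ⊆ T ∪ R ∧ (∃ i ∈ O, mean (ν b) - beta ^ r * ε ≤ mean (ν i)) ∧
      (∃ ρ : ℕ, 3 ^ ρ ≤ 2 ^ ρ * m ∧ (O.card : ℝ) ≤ 10 + ρ * (c * (1 + ρ + a))) ∧
      (t : ℝ) ≤ 12000 * C * A * (W / ((1 - beta) ^ 2 * ε ^ 2)) *
        ∑ s ∈ Finset.range fuel, (1 + ((r + s : ℕ) : ℝ)) * Real.exp (-0.002) ^ (r + s) := by
    intro r b T R fuel hb hm hR hT10 hcost
    refine Algo.WHP.mono (Algo.Sure.whp (Q := fun O t => O = T ∪ R ∧ t = 0) ⟨rfl, rfl⟩)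
      (by positivity) ?_
    rintro O t ⟨rfl, rfl⟩
    refine ⟨subset_rfl, ⟨b, hb, ?_⟩, ⟨r, hm, ?_⟩, by exact_mod_cast hcost⟩
    · have := mul_pos (pow_pos beta_pos r) hε0
      linarith
    · have h1 : ((T ∪ R).card : ℝ) ≤ T.card + R.card := by exact_mod_cast Finset.card_union_le _ _
      have h2 : (T.card : ℝ) ≤ 10 := by exact_mod_cast hT10
      linarith
  have hpre : 0 ≤ 12000 * C * A * (W / ((1 - beta) ^ 2 * ε ^ 2)) := by positivity
  induction fuel generalizing r b T R with
  | zero =>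
    exact hhalt r b T R 0 hb hm hR (by omega) (mul_nonneg hpre (Finset.sum_nonneg fun s _ => by
      positivity))
  | succ k ih =>
    unfold iterLoop
    split_ifs with hT10
    swap
    · exact hhalt r b T R (k + 1) hb hm hR (by omega)
        (mul_nonneg hpre (Finset.sum_nonneg fun s _ => by positivity))
    have hTne : T.Nonempty := Finset.card_pos.1 (by omega)
    -- `GroupElim` needs a reference arm in `T`; if `b` has already been recycled it is safe in `R`,
    -- and any arm of `T` will do.
    obtain ⟨b', hb', hbb'⟩ : ∃ b' ∈ T, b ∈ T → b' = b := by
      by_cases h : b ∈ T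
      · exact ⟨b, h, fun _ => rfl⟩
      · exact ⟨_, hTne.choose_spec, fun h' => absurd h' h⟩
    have hβr := pow_pos beta_pos r
    have hβr1 : beta ^ r ≤ 1 := pow_le_one₀ beta_pos.le beta_lt_one.le
    set εr := beta ^ r * (1 - beta) * ε with hεr
    have hβ11 : beta ^ r * (1 - beta) < 1 :=
      lt_of_le_of_lt (mul_le_of_le_one_left hβ1.le hβr1) (by linarith [beta_pos])
    have hεr0 : 0 < εr := by positivity
    have hεrε : εr ≤ ε := mul_le_of_le_one_left hε0.le hβ11.le
    have hεr1 : εr < 1 := lt_of_lt_of_le (mul_lt_of_lt_one_left hε0 hβ11) hε1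
    set δr := Real.exp (-0.1 * (r : ℝ)) * (1 - Real.exp (-0.1)) * δ with hδr
    have hδr0 : 0 < δr := by positivity
    have hexp1 : Real.exp (-0.1 * (r : ℝ)) ≤ 1 := by
      rw [Real.exp_le_one_iff]
      have : (0 : ℝ) ≤ r := Nat.cast_nonneg r
      linarith
    have hδr1 : δr ≤ 1 :=
      mul_le_one₀ (mul_le_one₀ hexp1 hq.le (by linarith [Real.exp_pos (-0.1)])) hδ0.le hδ1
    -- The accuracy is `εr`, but the weights keep the fixed `ε`, so that the decay factors of
    -- successive rounds multiply.
    have hg := whp_groupElim hν b' hb' hεr0 hεr1 hδr0 hδr1 hεrε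
    have hsplit : Real.exp (-0.1 * ((r + 1 : ℕ) : ℝ)) =
        Real.exp (-0.1 * (r : ℝ)) * Real.exp (-0.1) := by
      rw [← Real.exp_add]; congr 1; push_cast; ring
    refine (Algo.WHP.bind (q := Real.exp (-0.1 * ((r + 1 : ℕ) : ℝ)) * δ) hδr0.le (by positivity)
      hg ?_).mono (le_of_eq (by rw [hsplit, hδr]; ring)) fun _ _ h => h
    rintro ⟨P, R'⟩ t ⟨⟨hPT, hRT⟩, ⟨i, hi, hi'⟩, hPc, hRc, hPW, ht⟩
    dsimp only at *
    obtain ⟨b₂, hb₂, hbb₂⟩ : ∃ b₂ ∈ P ∪ (R ∪ R'), mean (ν b) - εr ≤ mean (ν b₂) := by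
      by_cases h : b ∈ T
      · rw [hbb' h] at hi'
        exact ⟨i, by simp only [Finset.mem_union] at hi ⊢; tauto, hi'⟩
      · exact ⟨b, by simp only [Finset.mem_union] at hb ⊢; tauto, by linarith⟩
    have hpow3 : 3 ^ (r + 1) = 3 * 3 ^ r := by rw [pow_succ, mul_comm]
    have hpow2 : 2 ^ (r + 1) = 2 * 2 ^ r := by rw [pow_succ, mul_comm]
    have hNr := hN r
    refine (ih (r + 1) b₂ P (R ∪ R') hb₂ (by omega) ?_ ?_ ?_ ?_).mono le_rfl ?_
    · have : 3 ^ r * 11 ≤ 3 ^ r * T.card := Nat.mul_le_mul_left _ (by omega)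
      rw [hpow3, hpow2, mul_assoc]; omega
    · calc 3 ^ (r + 1) * P.card = 3 ^ r * (3 * P.card) := by rw [hpow3]; ring
        _ ≤ 3 ^ r * (2 * T.card) := Nat.mul_le_mul_left _ hPc
        _ = 2 * (3 ^ r * T.card) := by ring
        _ ≤ 2 * (2 ^ r * m) := Nat.mul_le_mul_left _ hT
        _ = _ := by rw [hpow2]; ring
    · rw [pow_succ]
      linarith
    · have h1 : ((R ∪ R').card : ℝ) ≤ R.card + R'.card := by
        exact_mod_cast Finset.card_union_le _ _
      have h2 : (R'.card : ℝ) ≤ c * (1 + r + a) := le_trans (by exact_mod_cast hRc) hNr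
      have hr0 : (0 : ℝ) ≤ r := Nat.cast_nonneg r
      have hc0 : 0 ≤ c := by linarith
      push_cast
      nlinarith [mul_nonneg hc0 hr0]
    · rintro O u ⟨hO, ⟨j, hj, hj'⟩, hρ, hu⟩
      refine ⟨fun x hx => ?_, ⟨j, hj, ?_⟩, hρ, ?_⟩
      · have := hO hx
        simp only [Finset.mem_union] at this ⊢
        rcases this with h | h | h
        · exact Or.inl (hPT h)
        · exact Or.inr h
        · exact Or.inl (hRT h)
      · have : beta ^ (r + 1) * ε + εr = beta ^ r * ε := by rw [hεr]; ring
        linarith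
      · have hΛ := hC _ r (Nat.cast_nonneg _) hNr
        have hWε : (∑ i ∈ T, (variance id (ν i) + ε)) / εr ^ 2 ≤
            Real.exp (-0.002) ^ r * (W / ((1 - beta) ^ 2 * ε ^ 2)) := by
          -- The powers of `β²` in the weight cancel against those in `εr²`.
          have hb2 : (255 / 256 : ℝ) = beta ^ 2 * Real.exp (-0.002) := by
            rw [beta_sq, mul_assoc, ← Real.exp_add]; norm_num
          rw [hb2, mul_pow, ← pow_mul, mul_comm 2 r, pow_mul] at hW
          rw [hεr, div_le_iff₀ (by positivity)]
          refine hW.trans (le_of_eq ?_)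
          field_simp
        have hsum0 : 0 ≤ (∑ i ∈ T, (variance id (ν i) + ε)) / εr ^ 2 :=
          div_nonneg (Finset.sum_nonneg fun i _ => add_nonneg (variance_nonneg _ _) hε0.le)
            (sq_nonneg _)
        have hround : (t : ℝ) ≤ 12000 * C * A * (W / ((1 - beta) ^ 2 * ε ^ 2)) *
            ((1 + (r : ℝ)) * Real.exp (-0.002) ^ r) := by
          have h2 := mul_le_mul hΛ hWε hsum0 (by positivity)
          calc (t : ℝ) ≤ _ := ht
            _ ≤ 12000 * ((C * (1 + ↑r) * A) *
              (Real.exp (-0.002) ^ r * (W / ((1 - beta) ^ 2 * ε ^ 2)))) := by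
                rw [mul_assoc]; exact mul_le_mul_of_nonneg_left h2 (by norm_num)
            _ = _ := by ring
        rw [Finset.sum_range_succ', mul_add, add_zero]
        have hshift : ∑ s ∈ Finset.range k,
            (1 + ((r + (s + 1) : ℕ) : ℝ)) * Real.exp (-0.002) ^ (r + (s + 1)) =
            ∑ s ∈ Finset.range k, (1 + ((r + 1 + s : ℕ) : ℝ)) * Real.exp (-0.002) ^ (r + 1 + s) :=
          Finset.sum_congr rfl fun s _ => by rw [show r + (s + 1) = r + 1 + s by ring]
        rw [hshift, Nat.cast_add u t]
        linarith

end Iter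

/-- `IterElim` keeps an arm which is almost as good as `b`, and only few arms altogether. -/
lemma exists_whp_iterElim : ∃ C : ℝ, 1 ≤ C ∧ ∀ (n : ℕ) (ν : Fin n → Measure ℝ),
    (∀ i, IsProbabilityMeasure (ν i)) → (∀ i, ∀ᵐ x ∂(ν i), x ∈ Set.Icc (0 : ℝ) 1) →
    ∀ (S : Finset (Fin n)) (b : Fin n) (ε δ : ℝ), b ∈ S → 0 < ε → ε ≤ 1 → 0 < δ → δ ≤ 1 →
      (iterElim S ε δ).WHP ν δ fun O t => O ⊆ S ∧ (∃ i ∈ O, mean (ν b) - ε ≤ mean (ν i)) ∧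
        (O.card : ℝ) ≤
          C * (1 + Real.log S.card) * (1 + Real.log S.card + Real.log (1 / ε)) ∧
        (t : ℝ) ≤ C * ((∑ i ∈ S, (variance id (ν i) / ε ^ 2 + 1 / ε)) *
          (Real.log (1 / δ) + Real.log (Real.exp 1 + Real.log (1 / ε)))) := by
  obtain ⟨c, hc, hN⟩ := exists_ceil_logb_le
  obtain ⟨C, hC0, hC⟩ := exists_log_le hc
  have hβ1 : 0 < 1 - beta := sub_pos.2 beta_lt_one
  set K := ∑' s : ℕ, (1 + (s : ℝ)) * Real.exp (-0.002) ^ s with hK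
  have hK0 : 0 ≤ K := tsum_nonneg fun s => by positivity
  have hCK : 0 ≤ 12000 * C * K / (1 - beta) ^ 2 := by positivity
  refine ⟨10 + 9 * c + 12000 * C * K / (1 - beta) ^ 2, by linarith, ?_⟩
  intro n ν hprob hν S b ε δ hb hε0 hε1 hδ0 hδ1
  have ha : 0 ≤ Real.log (1 / ε) := Real.log_nonneg (by rw [le_div_iff₀ hε0]; linarith)
  have hδlog : 0 ≤ Real.log (1 / δ) := Real.log_nonneg (by rw [le_div_iff₀ hδ0]; linarith)
  have hA1 := one_le_log_exp_add ha
  have hcard : 1 ≤ S.card := Finset.card_pos.2 ⟨b, hb⟩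
  have hcard' : (1 : ℝ) ≤ S.card := by exact_mod_cast hcard
  have hlogS := Real.log_nonneg hcard'
  set W := ∑ i ∈ S, (variance id (ν i) + ε) with hW
  have hW0 : 0 ≤ W := Finset.sum_nonneg fun i _ => add_nonneg (variance_nonneg _ _) hε0.le
  have h := whp_iterLoop hν hε0 hε1 hδ0 hδ1 hc hC0.le (fun r => hN ε r hε0 hε1)
    (fun N r => hC δ _ N r hδ0 hδ1 ha) W hW0 S.card S.card 0 b S ∅ (by simpa using hb) le_rfl
    (by simpa using hcard) (by simp) (by simp)
    (by rw [pow_zero, one_mul])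
  rw [Nat.cast_zero, mul_zero, Real.exp_zero, one_mul] at h
  refine h.mono le_rfl ?_
  rintro O t ⟨hO, ⟨i, hi, hi'⟩, ⟨ρ, hρ, hOc⟩, ht⟩
  refine ⟨by simpa using hO, ⟨i, hi, by simpa using hi'⟩, ?_, ?_⟩
  -- From `ρ ln (3/2) ≤ ln |S|` and `ln (3/2) ≥ 1 - 2/3`.
  · have hρ3 : (ρ : ℝ) ≤ 3 * Real.log S.card := by
      have h1 : (3 : ℝ) ^ ρ ≤ 2 ^ ρ * S.card := by exact_mod_cast hρ
      have h2 := Real.log_le_log (by positivity) h1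
      rw [Real.log_mul (by positivity) (by positivity), Real.log_pow, Real.log_pow] at h2
      have h3 := Real.one_sub_inv_le_log_of_pos (x := 3 / 2) (by norm_num)
      rw [Real.log_div (by norm_num) (by norm_num)] at h3
      norm_num at h3
      have hρ0 : (0 : ℝ) ≤ ρ := Nat.cast_nonneg ρ
      nlinarith
    set l := Real.log (S.card : ℝ) with hl
    set a := Real.log (1 / ε) with hadef
    have hρ0 : (0 : ℝ) ≤ ρ := Nat.cast_nonneg ρ
    have h1 : (1 : ℝ) ≤ (1 + l) * (1 + l + a) := by nlinarith
    have h2 : ρ * (c * (1 + ρ + a)) ≤ (3 * l) * (c * (1 + 3 * l + a)) := by gcongr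
    have h3 : (3 * l) * (c * (1 + 3 * l + a)) ≤ 9 * c * ((1 + l) * (1 + l + a)) := by
      have : (3 * l) * (1 + 3 * l + a) ≤ 9 * ((1 + l) * (1 + l + a)) := by nlinarith
      nlinarith
    have h4 : 0 ≤ 12000 * C * K / (1 - beta) ^ 2 * ((1 + l) * (1 + l + a)) := by positivity
    nlinarith
  · set A := Real.log (1 / δ) + Real.log (Real.exp 1 + Real.log (1 / ε)) with hAdef
    have hsum : ∑ i ∈ S, (variance id (ν i) / ε ^ 2 + 1 / ε) = W / ε ^ 2 := by
      rw [hW, Finset.sum_div]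
      exact Finset.sum_congr rfl fun i _ => by field_simp
    have hKs : ∑ s ∈ Finset.range S.card,
        (1 + ((0 + s : ℕ) : ℝ)) * Real.exp (-0.002) ^ (0 + s) ≤ K := by
      simp only [zero_add]
      exact summable_round.sum_le_tsum _ fun s _ => by positivity
    have hA0 : 0 ≤ A := by linarith
    have h1 : (t : ℝ) ≤ 12000 * C * A * (W / ((1 - beta) ^ 2 * ε ^ 2)) * K :=
      ht.trans (mul_le_mul_of_nonneg_left hKs (by positivity))
    rw [hsum]
    have h2 : 12000 * C * A * (W / ((1 - beta) ^ 2 * ε ^ 2)) * K =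
        12000 * C * K / (1 - beta) ^ 2 * (W / ε ^ 2 * A) := by field_simp
    have h3 : 0 ≤ W / ε ^ 2 * A := by positivity
    nlinarith

/-! ### The final selection -/

section Naive

variable {ν : Fin n → Measure ℝ} [∀ i, IsProbabilityMeasure (ν i)]
  (hν : ∀ i, ∀ᵐ x ∂(ν i), x ∈ Set.Icc (0 : ℝ) 1)

/-- The order of the number of samples of all rounds before round `u`. -/
def roundCost (ν : Fin n → Measure ℝ) (S : Finset (Fin n)) (u : ℕ) : ℝ :=
  ∑ i ∈ S, (variance id (ν i) * 4 ^ (u + 1) + 2 ^ (u + 1))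

omit [∀ i, IsProbabilityMeasure (ν i)] in
lemma roundCost_nonneg (S : Finset (Fin n)) (u : ℕ) : 0 ≤ roundCost ν S u :=
  Finset.sum_nonneg fun i _ => by have := variance_nonneg id (ν i); positivity

-- Doubling means that the cost of round `u` is at most the increment `roundCost (u + 1) - roundCost
-- u`, so the costs telescope.
omit [∀ i, IsProbabilityMeasure (ν i)] in
lemma two_mul_roundCost_le (S : Finset (Fin n)) (u : ℕ) :
    2 * roundCost ν S u ≤ roundCost ν S (u + 1) := by
  unfold roundCost
  rw [Finset.mul_sum]
  refine Finset.sum_le_sum fun i _ => ?_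
  have h1 : 0 ≤ variance id (ν i) * 4 ^ (u + 1) := mul_nonneg (variance_nonneg _ _) (by positivity)
  rw [pow_succ 4 (u + 1), pow_succ 2 (u + 1), ← mul_assoc]
  linarith

omit [∀ i, IsProbabilityMeasure (ν i)] in
lemma roundCost_mono (S : Finset (Fin n)) (u k : ℕ) :
    roundCost ν S u ≤ roundCost ν S (u + k) := by
  induction k with
  | zero => exact le_rfl
  | succ k ih =>
    rw [← add_assoc]
    linarith [two_mul_roundCost_le (ν := ν) S (u + k), roundCost_nonneg (ν := ν) S (u + k)]

include hν

lemma whp_forEach_meanEst {S : Finset (Fin n)} (hS : S.Nonempty) {ε δ : ℝ} (hε0 : 0 < ε)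
    (hε1 : ε < 1) (hδ0 : 0 < δ) (hδ1 : δ ≤ 1) :
    (forEach S fun i => meanEst i ε (δ / S.card)).WHP ν δ fun θ t =>
      (∀ i ∈ S, |θ i - mean (ν i)| ≤ ε) ∧ (t : ℝ) ≤ 2 * ∑ i ∈ S, meanCost ν ε (δ / S.card) i := by
  classical
  have hc : (1 : ℝ) ≤ S.card := by exact_mod_cast hS.card_pos
  have h0 : 0 < δ / S.card := by positivity
  have hle : δ / S.card ≤ δ := div_le_self hδ0.le hc
  have h1 : (forEach S fun i => meanEst i ε (δ / S.card)).WHP ν (3 / 4 * δ) fun θ _ =>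
      ∀ i ∈ S, |θ i - mean (ν i)| ≤ ε := by
    refine Algo.whp_of_expect one_pos ((expect_forEach_meanEst_le hν hε0 hε1 h0 (hle.trans hδ1)
      subset_rfl).trans (ENNReal.ofReal_le_ofReal (le_of_eq (by field_simp)))) fun θ _ h => ?_
    push Not at h
    obtain ⟨i, hi, hi'⟩ := h
    refine le_trans ?_ (Finset.single_le_sum
      (f := fun i => if |θ i - mean (ν i)| ≤ ε then (0 : ℝ≥0∞) else 1) (fun _ _ => bot_le) hi)
    rw [if_neg (not_le.2 hi'), ENNReal.ofReal_one]
  exact (h1.and (by positivity) (by positivity)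
    (whp_forEach_meanEst_count hν hS hε0 hε1 h0 (hle.trans hδ1))).mono (by linarith) fun _ _ h => h

/-- The failure bound telescopes: `1 / (2r²) ≤ 1 / (2r - 1) - 1 / (2r + 1)`. With errors of `2^(-r)
/ 2`, the best arm survives round `r` and every survivor is within `2 · 2^(-r) = 4 / 2^(r+1)` of it.
The fixed `S₀` and `N` give one logarithm for all rounds. -/
lemma whp_naiveLoop {δ : ℝ} (hδ0 : 0 < δ) (hδ1 : δ ≤ 1) (b : Fin n) (S₀ : Finset (Fin n)) (N : ℕ)
    (k r : ℕ) (hr : 1 ≤ r) (hN : r + k ≤ N + 1) (S : Finset (Fin n)) (hSS : S ⊆ S₀) (hb : b ∈ S)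
    (hbest : ∀ i ∈ S, mean (ν i) ≤ mean (ν b))
    (hclose : ∀ i ∈ S, mean (ν b) - 4 / 2 ^ r ≤ mean (ν i)) :
    (naiveLoop δ k r S).WHP ν (δ / (2 * r - 1)) fun a t =>
      a ∈ S ∧ mean (ν b) - 4 / 2 ^ (r + k) ≤ mean (ν a) ∧
      (t : ℝ) ≤ 2640 * Real.log (8 * N ^ 2 * S₀.card / δ) *
        (roundCost ν S₀ (r + k) - roundCost ν S₀ r) := by
  classical
  induction k generalizing r S with
  | zero =>
    have hr' : (1 : ℝ) ≤ r := by exact_mod_cast hr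
    unfold naiveLoop
    refine (Algo.Sure.whp (fun i hi => ?_)).mono (div_nonneg hδ0.le (by linarith)) fun _ _ h => h
    exact ⟨hi, hclose i hi, by simp⟩
  | succ k ih =>
    have hr' : (1 : ℝ) ≤ r := by exact_mod_cast hr
    have hNr : (r : ℝ) ≤ N := by exact_mod_cast (by omega : r ≤ N)
    have hScard : 1 ≤ S.card := Finset.card_pos.2 ⟨b, hb⟩
    have hScard' : (1 : ℝ) ≤ S.card := by exact_mod_cast hScard
    have hSS' : (S.card : ℝ) ≤ S₀.card := by exact_mod_cast Finset.card_le_card hSS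
    set Λ := Real.log (8 * N ^ 2 * S₀.card / δ) with hΛ
    have hΛ0 : 0 ≤ Λ := by
      apply Real.log_nonneg
      rw [le_div_iff₀ hδ0]
      have h1 : (1 : ℝ) ≤ N ^ 2 := one_le_pow₀ (by linarith)
      nlinarith
    unfold naiveLoop
    split_ifs with hcard
    · refine (Algo.Sure.whp (fun i hi => ?_)).mono (div_nonneg hδ0.le (by linarith)) fun _ _ h => h
      have hib : i = b := Finset.card_le_one.1 hcard i hi b hb
      refine ⟨hi, ?_, ?_⟩
      · rw [hib]
        have : (0 : ℝ) ≤ 4 / 2 ^ (r + (k + 1)) := by positivity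
        linarith
      · have := roundCost_mono (ν := ν) S₀ r (k + 1)
        rw [Nat.cast_zero]
        exact mul_nonneg (by linarith) (by linarith)
    · have hr2 : (1 : ℝ) ≤ (r : ℝ) ^ 2 := one_le_pow₀ hr'
      set δr := 1 / (2 * (r : ℝ) ^ 2) * δ with hδr
      have hδr0 : 0 < δr := by positivity
      have hδr1 : δr ≤ 1 :=
        mul_le_one₀ (by rw [div_le_one (by positivity)]; linarith) hδ0.le hδ1
      have he1 : (1 / 2 ^ r / 2 : ℝ) < 1 := by
        have : (1 / 2 ^ r : ℝ) ≤ 1 := by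
          rw [div_le_one (by positivity)]; exact one_le_pow₀ one_le_two
        linarith
      have hround := whp_forEach_meanEst hν ⟨b, hb⟩ (ε := 1 / 2 ^ r / 2) (by positivity) he1
        hδr0 hδr1
      refine (Algo.WHP.bind (q := δ / (2 * ((r + 1 : ℕ) : ℝ) - 1)) hδr0.le
        (div_nonneg hδ0.le (by push_cast; linarith)) hround ?_).mono ?_ fun _ _ h => h
      · rintro θ t ⟨hθ, ht⟩
        have hθ' : ∀ i ∈ S, mean (ν i) - 1 / 2 ^ r / 2 ≤ θ i ∧ θ i ≤ mean (ν i) + 1 / 2 ^ r / 2 :=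
          fun i hi => by
            have := abs_le.1 (hθ i hi)
            constructor <;> linarith [this.1, this.2]
        refine (ih (r + 1) (by omega) (by omega) _ ((Finset.filter_subset _ _).trans hSS)
          (Finset.mem_filter.2 ⟨hb, fun a ha => ?_⟩)
          (fun i hi => hbest i (Finset.filter_subset _ _ hi)) fun i hi => ?_).mono le_rfl ?_
        · linarith [(hθ' a ha).2, (hθ' b hb).1, hbest a ha]
        · obtain ⟨hiS, hi'⟩ := Finset.mem_filter.1 hi
          have h4 : (4 : ℝ) / 2 ^ (r + 1) = 2 * (1 / 2 ^ r) := by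
            rw [pow_succ]; field_simp; norm_num
          rw [h4]
          linarith [(hθ' i hiS).2, (hθ' b hb).1, hi' b hb]
        · rintro a s ⟨ha, ha', hs⟩
          have hshift : r + 1 + k = r + (k + 1) := by ring
          rw [hshift] at ha' hs
          refine ⟨Finset.filter_subset _ _ ha, ha', ?_⟩
          have hcost : ∑ i ∈ S, meanCost ν (1 / 2 ^ r / 2) (δr / S.card) i ≤
              1320 * Λ * roundCost ν S₀ r := by
            have hlog : Real.log (4 / (δr / S.card)) ≤ Λ := by
              apply Real.log_le_log (by positivity)
              have : 4 / (δr / S.card) = 8 * (r : ℝ) ^ 2 * S.card / δ := by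
                rw [hδr]; field_simp; norm_num
              rw [this]
              gcongr
            unfold roundCost
            rw [Finset.mul_sum]
            refine (Finset.sum_le_sum_of_subset_of_nonneg hSS fun i _ _ => ?_).trans
              (Finset.sum_le_sum fun i _ => ?_)
            · exact (meanCost_pos (by positivity) (by positivity)
                ((div_le_self hδr0.le hScard').trans hδr1) i).le
            · unfold meanCost
              have h5 : (variance id (ν i) + 1 / 2 ^ r / 2) / (1 / 2 ^ r / 2) ^ 2 =
                  variance id (ν i) * 4 ^ (r + 1) + 2 ^ (r + 1) := by
                rw [show (4 : ℝ) = 2 ^ 2 by norm_num, ← pow_mul, mul_comm 2 (r + 1), pow_mul,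
                  pow_succ]
                field_simp
                ring
              have h6 : 0 ≤ variance id (ν i) * 4 ^ (r + 1) + 2 ^ (r + 1) := by
                have := variance_nonneg id (ν i)
                positivity
              rw [h5]
              gcongr
          have h2 := mul_le_mul_of_nonneg_left (two_mul_roundCost_le (ν := ν) S₀ r)
            (by linarith : 0 ≤ 2640 * Λ)
          push_cast
          linarith
      · have h1 : (0 : ℝ) < 2 * r - 1 := by linarith
        have h2 : (0 : ℝ) < 2 * r + 1 := by linarith
        have h3 : 1 / (2 * (r : ℝ) ^ 2) + 1 / (2 * r + 1) ≤ 1 / (2 * r - 1) := by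
          rw [div_add_div _ _ (by positivity) h2.ne', div_le_div_iff₀ (by positivity) h1]
          nlinarith
        have h4 : (2 * ((r + 1 : ℕ) : ℝ) - 1) = 2 * r + 1 := by push_cast; ring
        rw [h4, hδr]
        have := mul_le_mul_of_nonneg_right h3 hδ0.le
        calc _ = (1 / (2 * (r : ℝ) ^ 2) + 1 / (2 * r + 1)) * δ := by ring
          _ ≤ _ := this
          _ = _ := by ring

/-- `NaiveBestArmEst` finds an almost best arm. -/
lemma whp_naiveBestArmEst {ε δ : ℝ} (hε0 : 0 < ε) (hε1 : ε ≤ 1) (hδ0 : 0 < δ) (hδ1 : δ ≤ 1)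
    {S : Finset (Fin n)} {b : Fin n} (hb : b ∈ S) (hbest : ∀ i ∈ S, mean (ν i) ≤ mean (ν b)) :
    (naiveBestArmEst S ε δ).WHP ν δ fun a t => a ∈ S ∧ mean (ν b) - ε ≤ mean (ν a) ∧
      (t : ℝ) ≤ 5000000 * ((∑ i ∈ S, (variance id (ν i) / ε ^ 2 + 1 / ε)) *
        (Real.log (1 / δ) + Real.log (Real.exp 1 + Real.log (1 / ε)) + Real.log S.card)) := by
  unfold naiveBestArmEst
  have hlogε : 0 ≤ Real.log (1 / ε) := Real.log_nonneg (by rw [le_div_iff₀ hε0]; linarith)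
  have hδlog : 0 ≤ Real.log (1 / δ) := Real.log_nonneg (by rw [le_div_iff₀ hδ0]; linarith)
  have hA1 := one_le_log_exp_add hlogε
  have h2ε : (2 : ℝ) ≤ 2 / ε := by rw [le_div_iff₀ hε0]; linarith
  have hlb0 : 0 < Real.logb 2 (2 / ε) := Real.logb_pos one_lt_two (by linarith)
  have hceil := Nat.le_ceil (Real.logb 2 (2 / ε))
  have hceil' := Nat.ceil_lt_add_one hlb0.le
  have hNpos : 0 < ⌈Real.logb 2 (2 / ε)⌉₊ := Nat.ceil_pos.2 hlb0
  set N : ℕ := ⌈Real.logb 2 (2 / ε)⌉₊ with hNdef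
  have hN1 : (1 : ℝ) ≤ N := by exact_mod_cast hNpos
  have hpow1 : 2 / ε ≤ 2 ^ N := by
    rw [← Real.rpow_natCast, ← Real.logb_le_iff_le_rpow one_lt_two (by positivity)]
    exact hceil
  have hpow2 : (2 : ℝ) ^ N ≤ 4 / ε := by
    have h1 : ((N : ℝ) - 1) < Real.logb 2 (2 / ε) := by linarith
    rw [Real.lt_logb_iff_rpow_lt one_lt_two (by positivity), Real.rpow_sub_one two_ne_zero,
      Real.rpow_natCast, div_lt_iff₀ two_pos] at h1
    calc (2 : ℝ) ^ N ≤ 2 / ε * 2 := h1.le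
      _ = 4 / ε := by ring
  have hcard : (1 : ℝ) ≤ S.card := by exact_mod_cast Finset.card_pos.2 ⟨b, hb⟩
  have hlogS := Real.log_nonneg hcard
  refine (whp_naiveLoop hν hδ0 hδ1 b S N N 1 le_rfl (by omega) S subset_rfl hb hbest
    fun i _ => ?_).mono (by norm_num) ?_
  -- Initially the required closeness is `4 / 2 = 2`, trivial for means in `[0, 1]`.
  · have h1 := mean_mem (hν i)
    have h2 := mean_mem (hν b)
    norm_num
    linarith [h1.1, h2.2]
  · rintro a t ⟨ha, ha', ht⟩
    refine ⟨ha, ?_, ?_⟩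
    · have : (4 : ℝ) / 2 ^ (1 + N) ≤ ε := by
        rw [div_le_iff₀ hε0] at hpow1
        rw [div_le_iff₀ (by positivity), pow_add]
        linarith
      linarith
    · set A := Real.log (Real.exp 1 + Real.log (1 / ε)) with hA
      set Λ := Real.log (8 * N ^ 2 * S.card / δ) with hΛ
      have hNle : (N : ℝ) ≤ 4 * (Real.exp 1 + Real.log (1 / ε)) := by
        have h1 : Real.logb 2 (2 / ε) ≤ 2 * Real.log (2 / ε) := by
          have : 0 ≤ Real.log (2 / ε) := Real.log_nonneg (by linarith)
          rw [Real.logb, div_le_iff₀ (Real.log_pos one_lt_two)]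
          nlinarith [Real.log_two_gt_d9]
        have h2 : Real.log (2 / ε) = Real.log 2 + Real.log (1 / ε) := by
          rw [← Real.log_mul two_ne_zero (by positivity), mul_one_div]
        linarith [Real.log_two_lt_d9, Real.add_one_le_exp (1 : ℝ)]
      have hlog2 : ∀ m : ℕ, Real.log (2 ^ m) = m * Real.log 2 := fun m => Real.log_pow _ _
      have hlogN : Real.log N ≤ 2 * Real.log 2 + A := by
        calc Real.log N ≤ Real.log (2 ^ 2 * (Real.exp 1 + Real.log (1 / ε))) := by
              apply Real.log_le_log (by linarith)
              rw [show (2 : ℝ) ^ 2 = 4 by norm_num]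
              exact hNle
          _ = _ := by rw [Real.log_mul (by positivity) (by positivity), hlog2, Nat.cast_ofNat]
      have hΛle : Λ ≤ 7 * (Real.log (1 / δ) + A + Real.log S.card) := by
        have : Λ = 3 * Real.log 2 + 2 * Real.log N + Real.log S.card + Real.log (1 / δ) := by
          rw [hΛ, div_eq_mul_one_div, Real.log_mul (by positivity) (by positivity),
            Real.log_mul (by positivity) (by positivity),
            Real.log_mul (by norm_num) (by positivity), Real.log_pow,
            show (8 : ℝ) = 2 ^ 3 by norm_num, hlog2]
          norm_num
        rw [this]
        linarith [Real.log_two_lt_d9]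
      have hcost : roundCost ν S (1 + N) ≤ 256 * ∑ i ∈ S, (variance id (ν i) / ε ^ 2 + 1 / ε) := by
        unfold roundCost
        rw [Finset.mul_sum]
        refine Finset.sum_le_sum fun i _ => ?_
        have h4 : (4 : ℝ) ^ (1 + N + 1) = 16 * (2 ^ N) ^ 2 := by
          rw [show (4 : ℝ) = 2 ^ 2 by norm_num, ← pow_mul, ← pow_mul,
            show (16 : ℝ) = 2 ^ 4 by norm_num, ← pow_add]
          congr 1; ring
        have h5 : (2 : ℝ) ^ (1 + N + 1) = 4 * 2 ^ N := by ring
        have h6 : ((2 : ℝ) ^ N) ^ 2 ≤ (4 / ε) ^ 2 := by gcongr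
        have h7 := mul_le_mul_of_nonneg_left h6 (variance_nonneg id (ν i))
        have h8 : variance id (ν i) * (4 / ε) ^ 2 = 16 * (variance id (ν i) / ε ^ 2) := by ring
        have h9 : 4 / ε = 4 * (1 / ε) := by ring
        have h10 : 0 < 1 / ε := by positivity
        rw [h4, h5]
        linarith
      have hV0 : 0 ≤ ∑ i ∈ S, (variance id (ν i) / ε ^ 2 + 1 / ε) :=
        Finset.sum_nonneg fun i _ => by have := variance_nonneg id (ν i); positivity
      have hΛ0 : 0 ≤ Λ := by
        apply Real.log_nonneg
        rw [le_div_iff₀ hδ0]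
        have h1 : (1 : ℝ) ≤ (N : ℝ) ^ 2 := one_le_pow₀ hN1
        nlinarith
      have hdiff : roundCost ν S (1 + N) - roundCost ν S 1 ≤
          256 * ∑ i ∈ S, (variance id (ν i) / ε ^ 2 + 1 / ε) := by
        linarith [roundCost_nonneg (ν := ν) S 1]
      set V := ∑ i ∈ S, (variance id (ν i) / ε ^ 2 + 1 / ε) with hV
      -- The final constant comes from `2640 · 7 · 256 < 5000000`.
      have hdiff' : Λ * (roundCost ν S (1 + N) - roundCost ν S 1) ≤
          7 * (Real.log (1 / δ) + A + Real.log S.card) * (256 * V) :=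
        (mul_le_mul_of_nonneg_left hdiff hΛ0).trans
          (mul_le_mul_of_nonneg_right hΛle (by positivity))
      have hfin : 0 ≤ V * (Real.log (1 / δ) + A + Real.log S.card) := by positivity
      linarith

end Naive

/-! ### Measurability of the algorithm -/

section Measurability

variable {ν : Fin n → Measure ℝ} {α β : Type} [MeasurableSpace α] [MeasurableSpace β]

lemma measurable_law_done {X : Type*} [MeasurableSpace X] {f : X → α} (hf : Measurable f) :
    Measurable fun x => (Algo.done (f x) : Algo n α).law ν := by
  simp only [Algo.law]
  exact Measure.measurable_dirac.comp (hf.prodMk measurable_const)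

lemma meas_varTest (i : Fin n) (τ δ c : ℝ) : (varTest i τ δ c).Meas ν := by
  classical
  refine ⟨measurable_law_done (measurable_to_bool ?_), fun x => trivial⟩
  simp only [Set.preimage, Set.mem_singleton_iff, decide_eq_true_eq]
  exact measurableSet_lt measurable_const (by fun_prop)

lemma meas_varEst (i : Fin n) (δ ℓ : ℝ) : (varEst i δ ℓ).Meas ν := by
  have key : ∀ fuel r, (varEstLoop i δ ℓ fuel r).Meas ν := by
    intro fuel
    induction fuel with
    | zero => exact fun r => trivial
    | succ k ih =>
      intro r
      unfold varEstLoop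
      split_ifs
      · trivial
      · refine (meas_varTest i _ _ _).bind (Algo.sure_true _) (measurable_of_finite _) fun b _ => ?_
        split_ifs
        · trivial
        · exact ih _
  exact key _ _

/-- The continuation depends on the variance estimate only through the integer number of samples. -/
lemma meas_meanEst (i : Fin n) (ε δ : ℝ) : (meanEst i ε δ).Meas ν := by
  refine (meas_varEst i _ _).bind (Algo.sure_true _) ?_ fun v _ =>
    ⟨measurable_law_done (by fun_prop), fun _ => trivial⟩
  exact (measurable_from_nat (f := fun m : ℕ =>
    (Algo.pull i m fun x => Algo.done ((∑ r, x r) / m) : Algo n ℝ).law ν)).comp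
      (Nat.measurable_ceil.comp (by fun_prop))

variable [∀ i, IsProbabilityMeasure (ν i)]

lemma meas_forEach {f : Fin n → Algo n ℝ} (hf : ∀ i, (f i).Meas ν) (S : Finset (Fin n)) :
    (forEach S f).Meas ν := by
  have key : ∀ l, (forList f l).Meas ν := by
    intro l
    induction l with
    | nil => trivial
    | cons i l ih =>
      have hup : Measurable fun p : ℝ × ((Fin n → ℝ) × ℕ) => Function.update p.2.1 i p.1 :=
        measurable_update'.comp ((measurable_fst.comp measurable_snd).prodMk measurable_fst)
      have hup' : ∀ v : ℝ, Measurable fun g : Fin n → ℝ => Function.update g i v := fun v =>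
        measurable_update_left
      have hlaw : ∀ v : ℝ, (forList f l >>= fun g =>
          (pure (Function.update g i v) : Algo n (Fin n → ℝ))).law ν =
          ((forList f l).law ν).map fun p => (Function.update p.1 i v, p.2) := by
        intro v
        rw [Algo.law_bind (g := fun g => (pure (Function.update g i v) : Algo n (Fin n → ℝ))) ih
          (measurable_law_done (hup' v))]
        simp only [pure_eq_done, Algo.law]
        have hm : Measurable fun p : (Fin n → ℝ) × ℕ => (Function.update p.1 i v, p.2) :=
          ((hup' v).comp measurable_fst).prodMk measurable_snd
        rw [← Measure.bind_dirac_eq_map _ hm]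
        congr 1
        funext p
        rw [Measure.map_dirac' (measurable_add_snd p.2), zero_add]
      unfold forList
      refine (hf i).bind (Algo.sure_true _) ?_ fun v _ =>
        ih.bind (Algo.sure_true _) (measurable_law_done (hup' v)) fun _ _ => trivial
      simp_rw [hlaw]
      have : IsProbabilityMeasure ((forList f l).law ν) := ⟨Algo.law_univ ih⟩
      -- The law is a pushforward under a map that is jointly measurable in `v` and the recorded
      -- run, so each of its values is the measure of a section of a measurable set.
      refine Measure.measurable_of_measurable_coe _ fun s hs => ?_
      have hF : Measurable fun p : ℝ × ((Fin n → ℝ) × ℕ) =>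
          (Function.update p.2.1 i p.1, p.2.2) :=
        hup.prodMk (measurable_snd.comp measurable_snd)
      convert measurable_measure_prodMk_left (ν := (forList f l).law ν) (hF hs) using 2 with v
      exact Measure.map_apply (((hup' v).comp measurable_fst).prodMk measurable_snd) hs
  exact key _

lemma measurable_finset_valued {X : Type*} [MeasurableSpace X] {g : X → Finset (Fin n)}
    (hg : ∀ i, MeasurableSet {x | i ∈ g x}) : Measurable g :=
  measurable_finset_iff.2 fun i => measurableSet_setOfPred.1 (hg i)

/-- The active set never becomes empty, since an arm with maximal empirical mean always survives. -/
lemma meas_naiveLoop (δ : ℝ) (k r : ℕ) {S : Finset (Fin n)} (hS : S.Nonempty) :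
    (naiveLoop δ k r S).Meas ν := by
  classical
  induction k generalizing r S with
  | zero => exact ⟨hS, fun _ _ => trivial⟩
  | succ k ih =>
    unfold naiveLoop
    split_ifs
    · exact ⟨hS, fun _ _ => trivial⟩
    · refine (meas_forEach (fun i => meas_meanEst i _ _) S).bind (Algo.sure_true _) ?_ fun θ _ =>
        ih (r + 1) ?_
      · refine (measurable_of_finite fun T : Finset (Fin n) => (naiveLoop δ k (r + 1) T).law ν).comp
          (measurable_finset_valued fun i => ?_)
        simp only [Finset.mem_filter]
        by_cases hi : i ∈ S
        · simp only [hi, true_and]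
          have : {θ : Fin n → ℝ | ∀ a ∈ S, θ a - 1 / 2 ^ r ≤ θ i} =
              ⋂ a ∈ S, {θ : Fin n → ℝ | θ a - 1 / 2 ^ r ≤ θ i} := by ext; simp
          rw [this]
          exact Finset.measurableSet_biInter _ fun a _ =>
            measurableSet_le (by fun_prop) (by fun_prop)
        · simp [hi]
      · obtain ⟨b, hb, hmax⟩ := S.exists_max_image θ hS
        refine ⟨b, Finset.mem_filter.2 ⟨hb, fun a ha => ?_⟩⟩
        have : (0 : ℝ) < 1 / 2 ^ r := by positivity
        linarith [hmax a ha]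

lemma measurable_medianElim (B : Finset (Fin n)) : Measurable (medianElim B) := by
  classical
  refine measurable_finset_valued fun i => ?_
  have h : Measurable fun θ : Fin n → ℝ => B.filter fun a => θ i < θ a ∨ (θ a = θ i ∧ a < i) := by
    refine measurable_finset_valued fun a => ?_
    simp only [Finset.mem_filter]
    have h1 : MeasurableSet {θ : Fin n → ℝ | θ i < θ a} :=
      measurableSet_lt (by fun_prop) (by fun_prop)
    have h2 : MeasurableSet {θ : Fin n → ℝ | θ a = θ i} :=
      measurableSet_eq_fun (by fun_prop) (by fun_prop)
    exact (MeasurableSet.const _).inter (h1.union (h2.inter (MeasurableSet.const _)))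
  have h2 : MeasurableSet {θ : Fin n → ℝ | 2 * (B.filter fun a =>
      θ i < θ a ∨ (θ a = θ i ∧ a < i)).card < B.card} :=
    h (Set.toFinite {F : Finset (Fin n) | 2 * F.card < B.card}).measurableSet
  convert (MeasurableSet.const (i ∈ B)).inter h2 using 1
  ext θ
  simp only [medianElim, Finset.mem_filter, Set.mem_ofPred_eq, Set.mem_inter_iff]

lemma meas_groupLoop (S : Finset (Fin n)) (ε δ : ℝ) (N : ℕ) (v : Fin n → ℝ) (j : ℕ) :
    (groupLoop S ε δ N v j).Meas ν := by
  classical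
  induction j with
  | zero => trivial
  | succ j ih =>
    unfold groupLoop
    refine ih.bind (Algo.sure_true _) (measurable_of_finite _) fun p _ => ?_
    split_ifs
    · refine (meas_forEach (fun i => meas_meanEst i _ _) _).bind (Algo.sure_true _) ?_
        fun _ _ => trivial
      refine measurable_law_done ((measurable_of_finite
        fun T : Finset (Fin n) => (p.1 ∪ T, p.2)).comp (measurable_medianElim _))
    · trivial

-- The loop sees `v` only through the first `j` buckets, which take finitely many values.
omit [∀ i, IsProbabilityMeasure (ν i)] in
lemma measurable_law_groupLoop (S : Finset (Fin n)) (ε δ : ℝ) (N j : ℕ) :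
    Measurable fun v => (groupLoop S ε δ N v j).law ν := by
  classical
  have hcongr : ∀ v w : Fin n → ℝ, (∀ k < j, bucket S v (k + 1) = bucket S w (k + 1)) →
      groupLoop S ε δ N v j = groupLoop S ε δ N w j := by
    intro v w
    induction j with
    | zero => exact fun _ => rfl
    | succ j ih =>
      intro h
      unfold groupLoop
      rw [ih fun k hk => h k (hk.trans (Nat.lt_succ_self j)), h j (Nat.lt_succ_self j)]
  have hfac : Function.FactorsThrough (fun v => (groupLoop S ε δ N v j).law ν)
      fun v (k : Fin j) => bucket S v (k + 1) := fun v w h => by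
    simp only
    rw [hcongr v w fun k hk => congrFun h ⟨k, hk⟩]
  obtain ⟨F, hF⟩ := (Function.factorsThrough_iff _).1 hfac
  rw [hF]
  refine (measurable_of_finite F).comp (measurable_pi_iff.2 fun k =>
    measurable_finset_valued fun i => ?_)
  simp only [bucket, Finset.mem_filter]
  have h1 : MeasurableSet {v : Fin n → ℝ | (1 / 2 ^ ((k : ℕ) + 1) : ℝ) < v i} :=
    measurableSet_lt (by fun_prop) (by fun_prop)
  have h2 : MeasurableSet {v : Fin n → ℝ | v i ≤ 2 / 2 ^ ((k : ℕ) + 1)} :=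
    measurableSet_le (by fun_prop) (by fun_prop)
  exact (MeasurableSet.const _).inter (h1.inter h2)

lemma meas_groupElim (S : Finset (Fin n)) (ε δ : ℝ) : (groupElim S ε δ).Meas ν :=
  (meas_forEach (fun i => meas_varEst i _ _) S).bind (Algo.sure_true _)
    (measurable_law_groupLoop S ε δ _ _) fun v _ => meas_groupLoop S ε δ _ v _

lemma meas_iterElim (S : Finset (Fin n)) (ε δ : ℝ) : (iterElim S ε δ).Meas ν := by
  have key : ∀ fuel r T R, (iterLoop (n := n) ε δ fuel r T R).Meas ν := by
    intro fuel
    induction fuel with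
    | zero => exact fun _ _ _ => trivial
    | succ k ih =>
      intro r T R
      unfold iterLoop
      split_ifs
      · exact (meas_groupElim T _ _).bind (Algo.sure_true _) (measurable_of_finite _)
          fun p _ => ih _ _ _
      · trivial
  exact key _ _ _ _

/-- Nonemptiness is needed on every run, not just with high probability, for the final uniform draw
to be a probability law. -/
lemma sure_groupLoop (S : Finset (Fin n)) (ε δ : ℝ) (N : ℕ) (v : Fin n → ℝ) (j : ℕ) :
    (groupLoop S ε δ N v j).Sure fun p _ =>
      ∀ k < j, (bucket S v (k + 1)).Nonempty → (p.1 ∪ p.2).Nonempty := by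
  classical
  induction j with
  | zero => exact fun k hk => absurd hk (Nat.not_lt_zero k)
  | succ j ih =>
    unfold groupLoop
    refine Algo.sure_bind ih fun p t hp => ?_
    split_ifs with hB
    · refine Algo.sure_bind (Algo.sure_true _) fun θ s _ => ?_
      intro k hk _
      have hne : (medianElim (bucket S v (j + 1)) θ).Nonempty := by
        rw [← Finset.card_pos, card_medianElim]; omega
      exact hne.mono fun i hi => by simp only [Finset.mem_union]; tauto
    · intro k hk hne
      rcases Nat.lt_succ_iff_lt_or_eq.1 hk with hk | rfl
      · exact (hp k hk hne).mono fun i hi => by simp only [Finset.mem_union] at hi ⊢; tauto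
      · exact hne.mono fun i hi => by simp only [Finset.mem_union]; tauto

end Measurability

/-! ### Best arm identification -/

lemma sure_groupElim_nonempty {S : Finset (Fin n)} (hS : S.Nonempty) {ε δ : ℝ} (hε0 : 0 < ε)
    (hε1 : ε < 1) (hδ0 : 0 < δ) (hδ1 : δ ≤ 1) :
    (groupElim S ε δ).Sure fun p _ => (p.1 ∪ p.2).Nonempty := by
  obtain ⟨i, hi⟩ := hS
  have hN : 0 < ⌈Real.logb 2 (2 / ε)⌉₊ :=
    Nat.ceil_pos.2 (Real.logb_pos one_lt_two (by rw [lt_div_iff₀ hε0]; linarith))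
  have hN1 : (1 : ℝ) ≤ ⌈Real.logb 2 (2 / ε)⌉₊ := by exact_mod_cast hN
  have hN2 : (1 : ℝ) ≤ 2 * (⌈Real.logb 2 (2 / ε)⌉₊ : ℝ) ^ 2 := by
    linarith [one_le_pow₀ hN1 (n := 2)]
  refine Algo.sure_bind (sure_forEach (Q := fun _ v => (∃ s, 1 ≤ s ∧ v = 1 / 2 ^ s) ∧ ε < 2 * v)
    fun i _ => (sure_varEst i (by positivity) ((div_le_self hδ0.le hN2).trans hδ1) hε0 hε1).mono
      fun v t h => ⟨⟨h.1, h.2.1⟩, h.2.2⟩) ?_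
  rintro v t ⟨hv, -⟩
  obtain ⟨⟨s, -, hs⟩, hvε⟩ := hv i hi
  obtain ⟨hsN, hb⟩ := mem_bucket_of_eq hi hs hε0 hvε
  exact (sure_groupLoop S ε δ _ v _).mono fun p _ hp => hp s hsN ⟨i, hb⟩

lemma sure_iterElim_nonempty {S : Finset (Fin n)} (hS : S.Nonempty) {ε δ : ℝ} (hε0 : 0 < ε)
    (hε1 : ε ≤ 1) (hδ0 : 0 < δ) (hδ1 : δ ≤ 1) :
    (iterElim S ε δ).Sure fun O _ => O.Nonempty := by
  have hβ0 := beta_pos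
  have hβ1 := beta_lt_one
  have he : Real.exp (-0.1) < 1 := Real.exp_lt_one_iff.2 (by norm_num)
  have key : ∀ fuel r (T R : Finset (Fin n)), (T ∪ R).Nonempty →
      (iterLoop ε δ fuel r T R).Sure fun O _ => O.Nonempty := by
    intro fuel
    induction fuel with
    | zero => exact fun _ _ _ h => h
    | succ k ih =>
      intro r T R hTR
      unfold iterLoop
      split_ifs with hT
      · have h1 : beta ^ r ≤ 1 := pow_le_one₀ hβ0.le hβ1.le
        have h2 : Real.exp (-0.1 * (r : ℝ)) ≤ 1 :=
          Real.exp_le_one_iff.2 (by have : (0 : ℝ) ≤ r := r.cast_nonneg; linarith)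
        have h3 : 0 < 1 - beta := by linarith
        have h4 : 0 < 1 - Real.exp (-0.1) := by linarith
        have h5 : beta ^ r * (1 - beta) ≤ 1 * (1 - beta) := by gcongr
        have h6 : Real.exp (-0.1 * (r : ℝ)) * (1 - Real.exp (-0.1)) ≤ 1 :=
          mul_le_one₀ h2 h4.le (by linarith [Real.exp_pos (-0.1)])
        refine Algo.sure_bind (sure_groupElim_nonempty (Finset.card_pos.1 (by omega))
          (by positivity) ?_ (by positivity) (mul_le_one₀ h6 hδ0.le hδ1)) fun p t hp =>
            (ih _ _ _ (hp.mono fun i hi => ?_)).mono fun _ _ h => h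
        · have : beta ^ r * (1 - beta) * ε ≤ beta ^ r * (1 - beta) * 1 := by gcongr
          linarith
        · simp only [Finset.mem_union] at hi ⊢
          tauto
      · exact hTR
  exact key _ _ _ _ (by simpa using hS)

lemma bestArmEst_eq_bind (S : Finset (Fin n)) (ε δ : ℝ) :
    bestArmEst S ε δ = iterElim S (ε / 3) (δ / 3) >>= fun S₁ =>
      (if 1 / ε ≤ Real.log (S.card : ℝ) then pure S₁ else iterElim S₁ (ε / 3) (δ / 3)) >>=
        fun S₂ => naiveBestArmEst S₂ (ε / 3) (δ / 3) := by
  unfold bestArmEst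
  congr 1
  funext S₁
  split_ifs <;> rfl

lemma meas_bestArmEst {ν : Fin n → Measure ℝ} [∀ i, IsProbabilityMeasure (ν i)]
    {S : Finset (Fin n)} (hS : S.Nonempty) {ε δ : ℝ} (hε0 : 0 < ε) (hε1 : ε ≤ 1) (hδ0 : 0 < δ)
    (hδ1 : δ ≤ 1) : (bestArmEst S ε δ).Meas ν := by
  have h : ∀ T : Finset (Fin n), T.Nonempty →
      (iterElim T (ε / 3) (δ / 3)).Sure fun O _ => O.Nonempty := fun T hT =>
    sure_iterElim_nonempty hT (by positivity) (by linarith) (by positivity) (by linarith)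
  rw [bestArmEst_eq_bind]
  refine (meas_iterElim S _ _).bind (h S hS) (measurable_of_finite _) fun S₁ hS₁ => ?_
  refine Algo.Meas.bind (Q := fun O : Finset (Fin n) => O.Nonempty) ?_ ?_ (measurable_of_finite _) fun S₂ hS₂ =>
    meas_naiveLoop _ _ _ hS₂
  · split_ifs
    · trivial
    · exact meas_iterElim _ _ _
  · split_ifs
    · exact hS₁
    · exact h S₁ hS₁

/-- The order of the number of samples that is needed to find an `ε`-best arm of `S`. -/
def hardness (ν : Fin n → Measure ℝ) (ε : ℝ) (S : Finset (Fin n)) : ℝ :=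
  ∑ i ∈ S, (variance id (ν i) / ε ^ 2 + 1 / ε)

section Hardness

variable {ν : Fin n → Measure ℝ} {ε : ℝ}

lemma hardness_mono (hε0 : 0 < ε) {T S : Finset (Fin n)} (h : T ⊆ S) :
    hardness ν ε T ≤ hardness ν ε S :=
  Finset.sum_le_sum_of_subset_of_nonneg h fun i _ _ => by
    have := variance_nonneg id (ν i); positivity

lemma hardness_nonneg (hε0 : 0 < ε) (S : Finset (Fin n)) : 0 ≤ hardness ν ε S :=
  Finset.sum_nonneg fun i _ => by have := variance_nonneg id (ν i); positivity

lemma hardness_third_le (hε0 : 0 < ε) (S : Finset (Fin n)) :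
    hardness ν (ε / 3) S ≤ 9 * hardness ν ε S := by
  unfold hardness
  rw [Finset.mul_sum]
  refine Finset.sum_le_sum fun i _ => ?_
  have h1 : variance id (ν i) / (ε / 3) ^ 2 = 9 * (variance id (ν i) / ε ^ 2) := by
    field_simp; norm_num
  have h2 : 1 / (ε / 3) = 3 * (1 / ε) := by field_simp
  have h3 : 0 < 1 / ε := by positivity
  linarith

lemma card_div_le_hardness (S : Finset (Fin n)) : S.card / ε ≤ hardness ν ε S := by
  rw [div_eq_mul_one_div, ← nsmul_eq_mul]
  refine Finset.card_nsmul_le_sum _ _ _ fun i _ => ?_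
  have : 0 ≤ variance id (ν i) / ε ^ 2 := div_nonneg (variance_nonneg _ _) (sq_nonneg _)
  linarith

lemma hardness_le [∀ i, IsProbabilityMeasure (ν i)]
    (hν : ∀ i, ∀ᵐ x ∂(ν i), x ∈ Set.Icc (0 : ℝ) 1) (hε0 : 0 < ε) (hε1 : ε ≤ 1)
    (S : Finset (Fin n)) : hardness ν ε S ≤ S.card * (2 / ε ^ 2) := by
  rw [← nsmul_eq_mul]
  refine Finset.sum_le_card_nsmul _ _ _ fun i _ => ?_
  rw [show (2 : ℝ) / ε ^ 2 = 1 / ε ^ 2 + 1 / ε ^ 2 by ring]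
  gcongr
  · linarith [variance_le_quarter (hν i)]
  · nlinarith

end Hardness

lemma log_third_le {x : ℝ} (hx0 : 0 < x) : Real.log (1 / (x / 3)) ≤ Real.log (1 / x) + 2 := by
  have : 1 / (x / 3) = 1 / x * 3 := by field_simp
  rw [this, Real.log_mul (by positivity) (by norm_num)]
  linarith [Real.log_le_sub_one_of_pos (show (0 : ℝ) < 3 by norm_num)]

lemma log_factor_third_le {ε δ : ℝ} (hε0 : 0 < ε) (hε1 : ε ≤ 1) (hδ0 : 0 < δ) (hδ1 : δ ≤ 1) :
    0 ≤ Real.log (1 / (δ / 3)) + Real.log (Real.exp 1 + Real.log (1 / (ε / 3))) ∧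
    Real.log (1 / (δ / 3)) + Real.log (Real.exp 1 + Real.log (1 / (ε / 3))) ≤
      4 * (Real.log (1 / δ) + Real.log (Real.exp 1 + Real.log (1 / ε))) := by
  have hE : 0 ≤ Real.log (1 / ε) := Real.log_nonneg (by rw [le_div_iff₀ hε0]; linarith)
  have hD : 0 ≤ Real.log (1 / δ) := Real.log_nonneg (by rw [le_div_iff₀ hδ0]; linarith)
  have hE3 : 0 ≤ Real.log (1 / (ε / 3)) :=
    Real.log_nonneg (by rw [le_div_iff₀ (by positivity)]; linarith)
  have hD3 : 0 ≤ Real.log (1 / (δ / 3)) :=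
    Real.log_nonneg (by rw [le_div_iff₀ (by positivity)]; linarith)
  have hA := one_le_log_exp_add hE
  have hA3 := one_le_log_exp_add hE3
  refine ⟨by linarith, ?_⟩
  have h1 : Real.log (Real.exp 1 + Real.log (1 / (ε / 3))) ≤
      Real.log (2 * (Real.exp 1 + Real.log (1 / ε))) := by
    apply Real.log_le_log (by positivity)
    linarith [log_third_le hε0, Real.add_one_le_exp (1 : ℝ)]
  rw [Real.log_mul two_ne_zero (by positivity)] at h1
  linarith [log_third_le hδ0, Real.log_two_lt_d9]

/-- Raise `x/5 ≤ exp (x/5)` to the fifth power at `x = 1 + ln s`; the constant is `3125 e < 10000`.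
-/
lemma one_add_log_pow_five_le {s : ℝ} (hs : 1 ≤ s) : (1 + Real.log s) ^ 5 ≤ 10000 * s := by
  have hL := Real.log_nonneg hs
  have h1 : (1 + Real.log s) / 5 ≤ Real.exp ((1 + Real.log s) / 5) := by
    linarith [Real.add_one_le_exp ((1 + Real.log s) / 5)]
  have h2 : ((1 + Real.log s) / 5) ^ 5 ≤ Real.exp ((1 + Real.log s) / 5) ^ 5 := by gcongr
  rw [← Real.exp_nat_mul, show ((5 : ℕ) : ℝ) * ((1 + Real.log s) / 5) = 1 + Real.log s by
    push_cast; ring, Real.exp_add, Real.exp_log (by linarith)] at h2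
  have h3 : Real.exp 1 * s ≤ 3 * s := by
    gcongr
    linarith [Real.exp_one_lt_d9]
  have h4 : ((1 + Real.log s) / 5) ^ 5 = (1 + Real.log s) ^ 5 / 3125 := by ring
  linarith

/-- If `ε` is large compared to the number of arms then one round of `IterElim` is enough. -/
lemma mul_log_le_of_one_div_le {C s ε m : ℝ} (hC : 1 ≤ C) (hs : 1 ≤ s) (hε0 : 0 < ε)
    (hε : 1 / ε ≤ Real.log s) (hm1 : 1 ≤ m)
    (hm : m ≤ C * (1 + Real.log s) * (1 + Real.log s + Real.log (1 / (ε / 3)))) :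
    m * (2 / ε ^ 2) * Real.log m ≤ 180000 * C ^ 2 * (s / ε) := by
  have hL := Real.log_nonneg hs
  have h1ε : 0 < 1 / ε := by positivity
  have hE : Real.log (1 / ε) ≤ 1 / ε := by linarith [Real.log_le_sub_one_of_pos h1ε]
  have h3 := log_third_le hε0
  set L := Real.log s
  have hm2 : m ≤ 3 * C * (1 + L) ^ 2 := by
    calc m ≤ C * (1 + L) * (1 + L + Real.log (1 / (ε / 3))) := hm
      _ ≤ C * (1 + L) * (3 * (1 + L)) := by
        gcongr
        linarith
      _ = _ := by ring
  have hlogm : Real.log m ≤ m := by linarith [Real.log_le_sub_one_of_pos (zero_lt_one.trans_le hm1)]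
  -- One factor `1/ε` is traded for `1 + L` and `ln m` for `m`. As `m` is of order `(1 + L)²`, a
  -- fifth power of `1 + L` results.
  calc m * (2 / ε ^ 2) * Real.log m = 2 * m * (1 / ε) * (1 / ε) * Real.log m := by field_simp
    _ ≤ 2 * m * (1 / ε) * (1 + L) * m := by
      gcongr
      · exact Real.log_nonneg hm1
      · linarith
    _ = 2 * (1 / ε) * (1 + L) * m ^ 2 := by ring
    _ ≤ 2 * (1 / ε) * (1 + L) * (3 * C * (1 + L) ^ 2) ^ 2 := by gcongr
    _ = 18 * C ^ 2 * (1 / ε) * (1 + L) ^ 5 := by ring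
    _ ≤ 18 * C ^ 2 * (1 / ε) * (10000 * s) := by
      gcongr
      exact one_add_log_pow_five_le hs
    _ = _ := by ring

/-- Two rounds of `IterElim` leave a number of arms that depends on `ε` only. -/
lemma log_le_of_lt_one_div {C s ε m k : ℝ} (hC : 1 ≤ C) (hs : 1 ≤ s) (hε0 : 0 < ε) (hε1 : ε ≤ 1)
    (hε : Real.log s ≤ 1 / ε) (hm1 : 1 ≤ m)
    (hm : m ≤ C * (1 + Real.log s) * (1 + Real.log s + Real.log (1 / (ε / 3)))) (hk1 : 1 ≤ k)
    (hk : k ≤ C * (1 + Real.log m) * (1 + Real.log m + Real.log (1 / (ε / 3)))) :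
    Real.log k ≤ (Real.log C + 2 * Real.log (3 + Real.log (10 * C)) + 2) *
      Real.log (Real.exp 1 + Real.log (1 / ε)) := by
  have hL := Real.log_nonneg hs
  have h1ε : 1 ≤ 1 / ε := by rw [le_div_iff₀ hε0]; linarith
  have hE : Real.log (1 / ε) ≤ 1 / ε := by linarith [Real.log_le_sub_one_of_pos (by positivity :
    0 < 1 / ε)]
  have hE0 : 0 ≤ Real.log (1 / ε) := Real.log_nonneg h1ε
  have h3 := log_third_le hε0
  have hE3 : 0 ≤ Real.log (1 / (ε / 3)) :=
    Real.log_nonneg (by rw [le_div_iff₀ (by positivity)]; linarith)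
  have hA := one_le_log_exp_add hE0
  set E := Real.log (1 / ε)
  -- After the first elimination `m` is polynomial in `1/ε`, so `ln m` is linear in `E`; after the
  -- second, `k` is quadratic in `e + E`.
  have hm2 : m ≤ 10 * C * (1 / ε) ^ 2 := by
    calc m ≤ C * (1 + Real.log s) * (1 + Real.log s + Real.log (1 / (ε / 3))) := hm
      _ ≤ C * (2 * (1 / ε)) * (5 * (1 / ε)) := by
        gcongr <;> linarith
      _ = _ := by ring
  have hlogm : Real.log m ≤ Real.log (10 * C) + 2 * E := by
    refine (Real.log_le_log (by linarith) hm2).trans (le_of_eq ?_)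
    rw [Real.log_mul (by positivity) (by positivity), Real.log_pow, Nat.cast_ofNat]
  have hlogm0 := Real.log_nonneg hm1
  have hK0 : 0 ≤ Real.log (10 * C) := Real.log_nonneg (by linarith)
  have hlogC := Real.log_nonneg hC
  set K := Real.log (10 * C)
  have he := Real.add_one_le_exp (1 : ℝ)
  have hKE : 3 + K + 3 * E ≤ (3 + K) * (Real.exp 1 + E) := by nlinarith
  have hm3 : 1 + Real.log m ≤ 3 + K + 3 * E := by linarith
  have hm4 : 1 + Real.log m + Real.log (1 / (ε / 3)) ≤ 3 + K + 3 * E := by linarith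
  have hk2 : k ≤ C * ((3 + K) * (Real.exp 1 + E)) ^ 2 := by
    calc k ≤ C * (1 + Real.log m) * (1 + Real.log m + Real.log (1 / (ε / 3))) := hk
      _ ≤ C * (3 + K + 3 * E) * (3 + K + 3 * E) :=
        mul_le_mul (mul_le_mul_of_nonneg_left hm3 (by linarith)) hm4 (by linarith) (by positivity)
      _ ≤ C * ((3 + K) * (Real.exp 1 + E)) * ((3 + K) * (Real.exp 1 + E)) := by gcongr
      _ = _ := by ring
  have hK3 : 0 ≤ Real.log (3 + K) := Real.log_nonneg (by linarith)
  have hlogk : Real.log k ≤ Real.log C + 2 * (Real.log (3 + K) + Real.log (Real.exp 1 + E)) := by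
    refine (Real.log_le_log (by linarith) hk2).trans (le_of_eq ?_)
    rw [Real.log_mul (by positivity) (by positivity), Real.log_pow, Nat.cast_ofNat,
      Real.log_mul (by positivity) (by positivity)]
  nlinarith

lemma exists_whp_bestArmEst : ∃ C : ℝ, 0 < C ∧ ∀ (n : ℕ) (ν : Fin n → Measure ℝ),
    (∀ i, IsProbabilityMeasure (ν i)) → (∀ i, ∀ᵐ x ∂(ν i), x ∈ Set.Icc (0 : ℝ) 1) →
    ∀ (S : Finset (Fin n)) (b : Fin n) (ε δ : ℝ), b ∈ S → 0 < ε → ε ≤ 1 → 0 < δ → δ ≤ 1 →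
      (bestArmEst S ε δ).WHP ν δ fun a t => a ∈ S ∧ mean (ν b) - ε ≤ mean (ν a) ∧
        (t : ℝ) ≤ C * (hardness ν ε S *
          (Real.log (1 / δ) + Real.log (Real.exp 1 + Real.log (1 / ε)))) := by
  obtain ⟨C, hC1, hiter⟩ := exists_whp_iterElim
  have hlogC := Real.log_nonneg hC1
  have hlogC' : 0 ≤ Real.log (10 * C) := Real.log_nonneg (by linarith)
  have hlogC'' : 0 ≤ Real.log (3 + Real.log (10 * C)) := Real.log_nonneg (by linarith)
  set K₂ := Real.log C + 2 * Real.log (3 + Real.log (10 * C)) + 2 with hK₂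
  set K := 180000 * C ^ 2 + K₂ with hK
  have hK0 : 0 < K := by positivity
  -- Each of the two eliminations costs at most `36 C`. In the final selection `36` covers the
  -- confidence terms and `9 K` the term `ln |S₂|`, where `K` serves both branches and `36 = 9 · 4`
  -- and `9` come from replacing `ε, δ` by their thirds.
  refine ⟨72 * C + 5000000 * (36 + 9 * K), by positivity, ?_⟩
  intro n ν hp hν S b ε δ hb hε0 hε1 hδ0 hδ1
  have hE : 0 ≤ Real.log (1 / ε) := Real.log_nonneg (by rw [le_div_iff₀ hε0]; linarith)
  have hD : 0 ≤ Real.log (1 / δ) := Real.log_nonneg (by rw [le_div_iff₀ hδ0]; linarith)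
  have hA := one_le_log_exp_add hE
  obtain ⟨hF0, hF⟩ := log_factor_third_le hε0 hε1 hδ0 hδ1
  set A := Real.log (Real.exp 1 + Real.log (1 / ε)) with hAdef
  set D := Real.log (1 / δ) with hDdef
  set F := Real.log (1 / (δ / 3)) + Real.log (Real.exp 1 + Real.log (1 / (ε / 3))) with hFdef
  have hH0 := hardness_nonneg (ν := ν) hε0 S
  have hW0 : 0 ≤ hardness ν ε S * (D + A) := by positivity
  have hthird : ∀ T ⊆ S, hardness ν (ε / 3) T ≤ 9 * hardness ν ε S := fun T hT =>
    (hardness_third_le hε0 T).trans (by linarith [hardness_mono (ν := ν) hε0 hT])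
  have hcost : ∀ T ⊆ S, hardness ν (ε / 3) T * F ≤ 36 * (hardness ν ε S * (D + A)) := by
    intro T hT
    calc hardness ν (ε / 3) T * F ≤ 9 * hardness ν ε S * (4 * (D + A)) :=
          mul_le_mul (hthird T hT) hF hF0 (by positivity)
      _ = _ := by ring
  have hiter' : ∀ T ⊆ S, ∀ i ∈ T, (iterElim T (ε / 3) (δ / 3)).WHP ν (δ / 3) fun O t =>
      O ⊆ T ∧ (∃ j ∈ O, mean (ν i) - ε / 3 ≤ mean (ν j)) ∧
      (O.card : ℝ) ≤
        C * (1 + Real.log T.card) * (1 + Real.log T.card + Real.log (1 / (ε / 3))) ∧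
      (t : ℝ) ≤ 36 * C * (hardness ν ε S * (D + A)) := fun T hT i hi =>
    (hiter n ν hp hν T i (ε / 3) (δ / 3) hi (by positivity) (by linarith) (by positivity)
      (by linarith)).mono le_rfl fun O t h => ⟨h.1, h.2.1, h.2.2.1, h.2.2.2.trans
        ((mul_le_mul_of_nonneg_left (hcost T hT) (zero_le_one.trans hC1)).trans
          (le_of_eq (by ring)))⟩
  have hcard : ∀ {T : Finset (Fin n)} {i : Fin n}, i ∈ T → (1 : ℝ) ≤ T.card := fun hi => by
    exact_mod_cast Finset.card_pos.2 ⟨_, hi⟩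
  rw [bestArmEst_eq_bind]
  refine (Algo.WHP.bind (q := δ / 3 + δ / 3) (by positivity) (by positivity)
    (hiter' S subset_rfl b hb) ?_).mono (by linarith) fun _ _ h => h
  rintro S₁ t₁ ⟨hS₁, ⟨b₁, hb₁, hbb₁⟩, hcard₁, ht₁⟩
  have hsecond : Algo.WHP ν (if 1 / ε ≤ Real.log (S.card : ℝ) then pure S₁
      else iterElim S₁ (ε / 3) (δ / 3)) (δ / 3) fun O t =>
      O ⊆ S ∧ (∃ j ∈ O, mean (ν b) - 2 * (ε / 3) ≤ mean (ν j)) ∧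
      hardness ν ε O * Real.log O.card ≤ K * (hardness ν ε S * (D + A)) ∧
      (t : ℝ) ≤ 36 * C * (hardness ν ε S * (D + A)) := by
    split_ifs with hε
    · refine (Algo.Sure.whp ?_).mono (by positivity) fun _ _ h => h
      refine ⟨hS₁, ⟨b₁, hb₁, by linarith⟩, ?_, by rw [Nat.cast_zero]; positivity⟩
      calc hardness ν ε S₁ * Real.log S₁.card
          ≤ S₁.card * (2 / ε ^ 2) * Real.log S₁.card :=
            mul_le_mul_of_nonneg_right (hardness_le hν hε0 hε1 S₁) (Real.log_nonneg (hcard hb₁))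
        _ ≤ 180000 * C ^ 2 * (S.card / ε) :=
            mul_log_le_of_one_div_le hC1 (hcard hb) hε0 hε (hcard hb₁) hcard₁
        _ ≤ 180000 * C ^ 2 * (hardness ν ε S * 1) := by
            rw [mul_one]
            gcongr
            exact card_div_le_hardness S
        _ ≤ K * (hardness ν ε S * (D + A)) := by
            gcongr
            · rw [hK]; linarith [show 0 ≤ K₂ by positivity]
            · linarith
    · refine (hiter' S₁ hS₁ b₁ hb₁).mono le_rfl ?_
      rintro O t ⟨hO, ⟨j, hj, hbj⟩, hcard₂, ht⟩
      refine ⟨hO.trans hS₁, ⟨j, hj, by linarith⟩, ?_, ht⟩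
      calc hardness ν ε O * Real.log O.card ≤ hardness ν ε S * (K₂ * A) :=
            mul_le_mul (hardness_mono hε0 (hO.trans hS₁))
              (log_le_of_lt_one_div hC1 (hcard hb) hε0 hε1 (not_le.1 hε).le (hcard hb₁) hcard₁
                (hcard hj) hcard₂) (Real.log_nonneg (hcard hj)) hH0
        _ = K₂ * (hardness ν ε S * A) := by ring
        _ ≤ K * (hardness ν ε S * (D + A)) := by
            gcongr
            · rw [hK]; linarith [show 0 ≤ 180000 * C ^ 2 by positivity]
            · linarith
  refine Algo.WHP.bind (q := δ / 3) (by positivity) (by positivity) hsecond ?_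
  rintro S₂ t₂ ⟨hS₂, ⟨b₂, hb₂, hbb₂⟩, hlog₂, ht₂⟩
  -- The final selection competes with the best arm of `S₂`, which is at least as good as the
  -- surviving `b₂`, hence within `2 ε / 3` of `b`.
  obtain ⟨m, hm, hmax⟩ := S₂.exists_max_image (fun i => mean (ν i)) ⟨b₂, hb₂⟩
  refine (whp_naiveBestArmEst hν (by positivity : 0 < ε / 3) (by linarith)
    (by positivity : 0 < δ / 3) (by linarith) hm hmax).mono le_rfl ?_
  rintro a t₃ ⟨ha, ha', ht₃⟩
  refine ⟨hS₂ ha, by linarith [hmax b₂ hb₂], ?_⟩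
  have h1 := hcost S₂ hS₂
  have h2 : hardness ν (ε / 3) S₂ * Real.log S₂.card ≤
      9 * (K * (hardness ν ε S * (D + A))) := by
    have := mul_le_mul_of_nonneg_right (hardness_third_le (ν := ν) hε0 S₂)
      (Real.log_nonneg (hcard hb₂))
    linarith
  have h3 : (t₃ : ℝ) ≤ 5000000 * (hardness ν (ε / 3) S₂ * F +
      hardness ν (ε / 3) S₂ * Real.log S₂.card) := by
    rw [← mul_add]
    exact ht₃
  push_cast
  linarith

end Bandit

end

theorem mainTheorem4 :
    ∃ C : ℝ, 0 < C ∧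
      ∀ (n : ℕ) (ν : Fin n → Measure ℝ), (∀ i, IsProbabilityMeasure (ν i)) →
        (∀ i, ∀ᵐ x ∂(ν i), x ∈ Set.Icc (0 : ℝ) 1) →
        ∀ (S : Finset (Fin n)) (hS : S.Nonempty) (ε δ : ℝ),
          0 < ε → ε ≤ 1 → 0 < δ → δ < 1 →
          ENNReal.ofReal (1 - δ) ≤
            (Bandit.bestArmEst S ε δ).law ν
              {p : Fin n × ℕ | p.1 ∈ S ∧
                |Bandit.mean (ν p.1) - S.sup' hS (fun i => Bandit.mean (ν i))| ≤ ε ∧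
                (p.2 : ℝ) ≤ C * ∑ i ∈ S,
                  (variance id (ν i) / ε ^ 2 + 1 / ε) *
                    (Real.log (1 / δ) + Real.log (Real.exp 1 + Real.log (1 / ε)))} := by
  obtain ⟨C, hC0, hC⟩ := Bandit.exists_whp_bestArmEst
  refine ⟨C, hC0, fun n ν hp hν S hS ε δ hε0 hε1 hδ0 hδ1 => ?_⟩
  obtain ⟨b, hb, hsup⟩ := S.exists_mem_eq_sup' hS fun i => Bandit.mean (ν i)
  refine Bandit.Algo.WHP.le_law (Q := fun a t => a ∈ S ∧
      |Bandit.mean (ν a) - S.sup' hS (fun i => Bandit.mean (ν i))| ≤ ε ∧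
      (t : ℝ) ≤ C * ∑ i ∈ S, (variance id (ν i) / ε ^ 2 + 1 / ε) *
        (Real.log (1 / δ) + Real.log (Real.exp 1 + Real.log (1 / ε))))
    (Bandit.meas_bestArmEst hS hε0 hε1 hδ0 hδ1.le) hδ0.le
    ((hC n ν hp hν S b ε δ hb hε0 hε1 hδ0 hδ1.le).mono le_rfl ?_)
    (Set.to_countable _).measurableSet
  rintro a t ⟨ha, ha', ht⟩
  refine ⟨ha, ?_, ?_⟩
  · have := S.le_sup' (fun i => Bandit.mean (ν i)) ha
    rw [abs_le]
    constructor <;> linarith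
  · rwa [← Finset.sum_mul]
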